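/- **Setting.** Fix real numbers $q_0>0$, $\sigma$ and a time $t$. For $\mathbf v=(v_1,v_2)^T\in\mathbb C^2$ put $\mathbf v^{\perp}=(v_2^*,-v_1^*)^T$, and let $\|\cdot\|$ be the Euclidean norm. For $z\in\mathbb C\setminus\{0,\pm q_0\}$ let $$k=\tfrac12\Big(z+\frac{q_0^2}{z}\Big),\quad \lambda=\tfrac12\Big(z-\frac{q_0^2}{z}\Big),\quad \hat\rho(z)=\frac{z^2}{z^2-q_0^2},\quad \mathbf J=\operatorname{diag}(1,-1,-1),\quad \mathbf Q=\begin{pmatrix}0&-\mathbf q^\dagger\\ \mathbf q&\mathbf 0\end{pmatrix},$$ $$\hat{\mathbf Y}_\pm(z)=\begin{pmatrix} i\hat\rho & 0 & \hat\rho q_0/z\\ i\hat\rho\,\mathbf q_\pm/z & \mathbf q_\pm^\perp/q_0 & \hat\rho\,\mathbf q_\pm/q_0\end{pmatrix},\qquad \mathbf\Delta=\operatorname{diag}(\delta_1,\delta_2,-\delta_1),$$ $\delta_1=\lambda x+2\lambda[k+\sigma(3k^2-\lambda^2)]t$, $\delta_2=-kx-(\lambda^2+k^2+4\sigma k^3)t$.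 Let $\mathbf q(x,t)\in\mathbb C^2$ be such that $\mathbf q(\cdot,t)$ is differentiable with $\mathbf q_x(\cdot,t)\in L^1(\mathbb R)$, $\mathbf q(x,t)\to\mathbf q_\pm$ as $x\to\pm\infty$ with $\|\mathbf q_\pm\|=q_0$, and $(1+|x|)(\mathbf q(x,t)-\mathbf q_\pm)\in L^1(\mathbb R^\pm_x)$. For $z\in\mathbb R\setminus\{0,\pm q_0\}$ let $\psi_\pm(z;x,t)$ be the $3\times3$ matrix (Jost) solutions of $\psi_x=(ik\mathbf J+i\mathbf Q)\psi$ with $\psi_\pm=\hat{\mathbf Y}_\pm e^{i\mathbf\Delta}+o(1)$ as $x\to\pm\infty$, let $\mathbf H(z)=(h_{ij}(z))$ be the scattering matrix, $\psi_+=\psi_-\mathbf H$, and $\mathbf S=\mathbf H^{-1}=(s_{ij})$. The coefficients $s_{33},h_{11}$ are extended to the closed upper half-plane without $\{0,\pm q_0\}$, and $s_{11},h_{33}$ to the closed lower half-plane without $\{0,\pm q_0\}$, as functions that are continuous there and holomorphic in the open half-plane. **Proposition.** Assume $\mathbf q_+^\dagger\mathbf q_-=0$. Then $\mathbf q_+=\mathbf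 q_-^\perp e^{-i\vartheta}$ for some $\vartheta\in\mathbb R$; the integral $$\vartheta_1=\int_{\mathbb R}[\mathbf q_+^\dagger\mathbf q(x,t)][\mathbf q^\dagger(x,t)\mathbf q_-]\,dx=\frac{\mathbf q_+^\dagger\mathbf q_-^\perp}{q_0^2}\int_{\mathbb R}[(\mathbf q_-^\perp)^\dagger\mathbf q(x,t)][\mathbf q^\dagger(x,t)\mathbf q_-]\,dx$$ converges absolutely; the Jost solutions, the scattering matrices and the stated extensions exist; and they satisfy the following. As $z\to\infty$, $$s_{33}(z)=\frac{i\vartheta_1}{q_0^2z}+O\Big(\frac1{z^2}\Big)\ (\operatorname{Im}z\ge0),\qquad h_{33}(z)=-\frac{i\vartheta_1^*}{q_0^2z}+O\Big(\frac1{z^2}\Big)\ (\operatorname{Im}z\le0),$$ $$s_{22}(z)=O\Big(\frac1z\Big),\quad h_{22}(z)=O\Big(\frac1z\Big)\ (z\in\mathbb R),$$ and as $z\to0$, $$s_{11}(z)=\frac{i\vartheta_1}{q_0^4}z+O(z^2)\ (\operatorname{Im}z\le0),\qquad h_{11}(z)=-\frac{i\vartheta_1^*}{q_0^4}z+O(z^2)\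 (\operatorname{Im}z\ge0),$$ $$s_{22}(z)=O(z),\quad h_{22}(z)=O(z)\ (z\in\mathbb R).$$ -/

import Mathlib

open Filter Topology Asymptotics MeasureTheory Complex

noncomputable section

namespace CoupledHirota

/-- Two-component complex vectors with the Euclidean norm; `inner ℂ v w` is `v† w`. -/
abbrev Vec2 := EuclideanSpace ℂ (Fin 2)

abbrev Mat3 := Matrix (Fin 3) (Fin 3) ℂ

/-- `v^⊥ = (v₂, -v₁)†`. -/
def perp (v : Vec2) : Vec2 := !₂[star (v 1), -star (v 0)]

/-- `J = diag(1, -1, -1)`. -/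
def matJ : Mat3 := Matrix.diagonal ![1, -1, -1]

/-- The block matrix with rows `(0, -v†)` and `(v, 0)`. -/
def matQ (v : Vec2) : Mat3 :=
  !![0, -star (v 0), -star (v 1);
     v 0, 0, 0;
     v 1, 0, 0]

/-- `k(z) = (z + q₀²/z)/2`. -/
def kOf (q₀ : ℝ) (z : ℂ) : ℂ := (z + (q₀ : ℂ) ^ 2 / z) / 2

/-- `λ(z) = (z - q₀²/z)/2`. -/
def lamOf (q₀ : ℝ) (z : ℂ) : ℂ := (z - (q₀ : ℂ) ^ 2 / z) / 2

/-- `ρ̂(z) = z²/(z² - q₀²)`. -/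
def rhoHat (q₀ : ℝ) (z : ℂ) : ℂ := z ^ 2 / (z ^ 2 - (q₀ : ℂ) ^ 2)

/-- The matrix `X = i k(z) J + i Q` of the scattering problem `ψ_x = X ψ`, where `v` is the
value of the potential. -/
def matX (q₀ : ℝ) (v : Vec2) (z : ℂ) : Mat3 := (I * kOf q₀ z) • matJ + I • matQ v

/-- The eigenvector matrix `Ŷ` of the scattering problem with constant potential `v`. -/
def matY (q₀ : ℝ) (v : Vec2) (z : ℂ) : Mat3 :=
  !![I * rhoHat q₀ z, 0, rhoHat q₀ z * q₀ / z;
     I * rhoHat q₀ z * v 0 / z, perp v 0 / q₀, rhoHat q₀ z * v 0 / q₀;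
     I * rhoHat q₀ z * v 1 / z, perp v 1 / q₀, rhoHat q₀ z * v 1 / q₀]

/-- `δ₁ = λ x + 2 λ [k + σ (3 k² - λ²)] t`. -/
def delta₁ (q₀ σ : ℝ) (z : ℂ) (x t : ℝ) : ℂ :=
  lamOf q₀ z * x
    + 2 * lamOf q₀ z * (kOf q₀ z + σ * (3 * kOf q₀ z ^ 2 - lamOf q₀ z ^ 2)) * t

/-- `δ₂ = -k x - (λ² + k² + 4 σ k³) t`. -/
def delta₂ (q₀ σ : ℝ) (z : ℂ) (x t : ℝ) : ℂ :=
  -kOf q₀ z * x - (lamOf q₀ z ^ 2 + kOf q₀ z ^ 2 + 4 * σ * kOf q₀ z ^ 3) * t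

/-- `e^{iΔ}` with `Δ = diag(δ₁, δ₂, -δ₁)`. -/
def expDelta (q₀ σ : ℝ) (z : ℂ) (x t : ℝ) : Mat3 :=
  Matrix.diagonal ![Complex.exp (I * delta₁ q₀ σ z x t), Complex.exp (I * delta₂ q₀ σ z x t),
    Complex.exp (-(I * delta₁ q₀ σ z x t))]

/-- The set `{0, q₀, -q₀}` of exceptional spectral values. -/
def exceptional (q₀ : ℝ) : Set ℂ := {0, (q₀ : ℂ), -(q₀ : ℂ)}

/-- The continuous spectrum `ℝ \ {0, ±q₀}`. -/
def realSpectrum (q₀ : ℝ) : Set ℝ := {z | (z : ℂ) ∉ exceptional q₀}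

/-- `ψ z x` is the matrix Jost solution at time `t` normalized along `l` (`atTop` for `ψ₊`, `atBot`
for `ψ₋`) by the boundary vector `qb`: `ψ_x = X ψ` and `ψ = Ŷ e^{iΔ} + o(1)`. -/
structure IsJost (q₀ σ : ℝ) (q : ℝ → ℝ → Vec2) (t : ℝ) (l : Filter ℝ) (qb : Vec2)
    (ψ : ℝ → ℝ → Mat3) : Prop where
  ode : ∀ z ∈ realSpectrum q₀, ∀ x : ℝ, ∀ i j : Fin 3,
    HasDerivAt (fun y : ℝ => ψ z y i j) ((matX q₀ (q x t) z * ψ z x) i j) x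
  boundary : ∀ z ∈ realSpectrum q₀,
    Tendsto (fun x : ℝ => ψ z x - matY q₀ qb z * expDelta q₀ σ z x t) l (𝓝 0)

/-- `F` extends `f` from `ℝ \ {0, ±q₀}` continuously to the closed half-plane `{0 ≤ Im z}`
without `{0, ±q₀}`, and holomorphically to its interior. -/
structure ExtendsToUpper (q₀ : ℝ) (f : ℝ → ℂ) (F : ℂ → ℂ) : Prop where
  holo : DifferentiableOn ℂ F {z : ℂ | 0 < z.im}
  cont : ContinuousOn F ({z : ℂ | 0 ≤ z.im} \ exceptional q₀)
  boundary : ∀ z ∈ realSpectrum q₀, F z = f z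

/-- The same for the lower half-plane. -/
structure ExtendsToLower (q₀ : ℝ) (f : ℝ → ℂ) (F : ℂ → ℂ) : Prop where
  holo : DifferentiableOn ℂ F {z : ℂ | z.im < 0}
  cont : ContinuousOn F ({z : ℂ | z.im ≤ 0} \ exceptional q₀)
  boundary : ∀ z ∈ realSpectrum q₀, F z = f z

/-- Scattering data of the potential `q` at time `t`: the Jost solutions `ψ±`, the scattering matrix
`H` with `ψ₊ = ψ₋ H`, its inverse `S`, and the continuations `s₁₁, h₃₃` to the lower and
`s₃₃, h₁₁` to the upper half-plane. -/
structure ScatteringData (q₀ σ : ℝ) (q : ℝ → ℝ → Vec2) (t : ℝ) (qm qp : Vec2) where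
  ψm : ℝ → ℝ → Mat3
  ψp : ℝ → ℝ → Mat3
  H : ℝ → Mat3
  S : ℝ → Mat3
  s₁₁ : ℂ → ℂ
  s₃₃ : ℂ → ℂ
  h₁₁ : ℂ → ℂ
  h₃₃ : ℂ → ℂ
  jost_minus : IsJost q₀ σ q t atBot qm ψm
  jost_plus : IsJost q₀ σ q t atTop qp ψp
  scattering : ∀ z ∈ realSpectrum q₀, ∀ x : ℝ, ψp z x = ψm z x * H z
  inverse : ∀ z ∈ realSpectrum q₀, H z * S z = 1 ∧ S z * H z = 1
  s₁₁_ext : ExtendsToLower q₀ (fun z => S z 0 0) s₁₁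
  s₃₃_ext : ExtendsToUpper q₀ (fun z => S z 2 2) s₃₃
  h₁₁_ext : ExtendsToUpper q₀ (fun z => H z 0 0) h₁₁
  h₃₃_ext : ExtendsToLower q₀ (fun z => H z 2 2) h₃₃

/-- `ϑ₁ = ∫ (q₊† q)(q† q₋) dx`. -/
def thetaOne (q : ℝ → ℝ → Vec2) (t : ℝ) (qm qp : Vec2) : ℂ :=
  ∫ x : ℝ, inner ℂ qp (q x t) * inner ℂ (q x t) qm

end CoupledHirota

end

noncomputable section

namespace CoupledHirota

/-! ### Calculus on left half-lines -/

section HalfLineIntegrals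

variable {F : Type*} [NormedAddCommGroup F] [NormedSpace ℝ F] {f : ℝ → F}

/-! Removing the plane wave from a Jost column at `-∞` turns the scattering problem into a Volterra
equation with exponents `i (freq j - freq j₀) (x - y)`. These are bounded for every column when `z`
is real, and for the third column throughout `Im z ≥ 0`. The Neumann series gives existence,
continuity and holomorphy in `z` for the third column, and bounds uniform for large `z`
(`volterraSol`, `leftSol`).

For real `z` the matrix `X` is skew for the form `φ† J χ`, so the form of two solutions is constant
in `x` and the Gram matrix of a Jost solution is an explicit diagonal (`IsJostAt.gram`). Hence Jost
matrices are invertible and their columns unique, the scattering matrix exists, and `S j j` is up to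
an explicit factor the form of the right and left columns at `x = 0` (`ScatteringAt.S_diag`). The
time phases have modulus one and cancel, and `H j j` is the conjugate of `S j j`.

Two symmetries reduce everything to left columns and large `z`. The map `(x, z, q) ↦ (-x, -z, -q)`
exchanges the two ends of the line. The map `z ↦ q₀²/z` fixes `k` and reverses `λ`, so it carries
the third column to a multiple of the first and fixes the second; behaviour at `0` is behaviour at
`∞`.

For large `z` let `(w₀, u)` be a left column without its phase, `v` its boundary vector and `p ⟂ v`.
The combination `z w₀ - q†u` oscillates fast with integrable forcing, which is where `q_x ∈ L¹`
enters, so it is bounded and `w₀ = O(1/z)`. Then `v†u` stays within `O(1/z)` of its limit. For the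
third column one integration by parts gives `p†u = (i/z) ∫ (p†q)(q†v) + O(1/z²)` at `x = 0`
(`exists_transverse_bound`); the weight `1 + |x|` pays for the slow phase `e^{i q₀² x/z}`.

Orthogonality makes `q₋, q₊` an orthogonal basis of `ℂ²`. Expanding the form in it, every product
for `s₃₃` has one factor of order one and one of order `1/z`, and the left and right columns
contribute the two halves of `ϑ₁` (`isBigO_scatCoeff`). For `s₂₂` every product has a factor
`O(1/z)`. Since arbitrary continuations are allowed, they are identified with the constructed ones
by a boundary uniqueness theorem. -/

theorem hasDerivAt_integral_Iic [CompleteSpace F] (hf : Continuous f)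
    (hi : ∀ x, IntegrableOn f (Set.Iic x)) (x : ℝ) :
    HasDerivAt (fun x => ∫ y in Set.Iic x, f y) (f x) x := by
  have h : (fun x => ∫ y in Set.Iic x, f y)
      = fun x => (∫ y in Set.Iic 0, f y) + ∫ y in (0:ℝ)..x, f y := by
    ext x
    rw [← intervalIntegral.integral_Iic_sub_Iic (hi 0) (hi x)]
    abel
  rw [h]
  exact (hf.integral_hasStrictDerivAt 0 x).hasDerivAt.const_add _

theorem tendsto_integral_Iic_atBot (hi : ∀ x, IntegrableOn f (Set.Iic x)) :
    Tendsto (fun x => ∫ y in Set.Iic x, f y) atBot (𝓝 0) := by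
  have h : (fun x => ∫ y in Set.Iic x, f y)
      = fun x => (∫ y in Set.Iic 0, f y) - ∫ y in x..(0:ℝ), f y := by
    ext x
    rw [← intervalIntegral.integral_Iic_sub_Iic (hi x) (hi 0)]
    abel
  rw [h]
  have h := (intervalIntegral_tendsto_integral_Iic (0:ℝ) (hi 0) tendsto_id).const_sub
    (∫ y in Set.Iic 0, f y)
  simpa using h

end HalfLineIntegrals

/-! ### Neumann series for the Volterra equation on a left half-line -/

section Volterra

variable {E : Type*} [NormedAddCommGroup E] [NormedSpace ℂ E]
  {ι : Type*} [Fintype ι]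

/-- The iterates of the Volterra equation `w(x) = a + ∫_{-∞}^x ∑ⱼ e^{cⱼ(x-y)} Pⱼ B(y) w(y) dy`. -/
def volterraTerm (c : ι → ℂ) (P : ι → E →L[ℂ] E) (B : ℝ → E →L[ℂ] E) (a : E) : ℕ → ℝ → E
  | 0 => fun _ => a
  | n + 1 => fun x => ∑ j, P j (∫ y in Set.Iic x,
      Complex.exp (c j * (x - y)) • B y (volterraTerm c P B a n y))

/-- The solution of the Volterra equation, as a Neumann series. -/
def volterraSol (c : ι → ℂ) (P : ι → E →L[ℂ] E) (B : ℝ → E →L[ℂ] E) (a : E) (x : ℝ) : E :=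
  ∑' n, volterraTerm c P B a n x

/-- `∫_{-∞}^x ‖B‖`. -/
def cumNorm (B : ℝ → E →L[ℂ] E) (x : ℝ) : ℝ := ∫ y in Set.Iic x, ‖B y‖

variable {c : ι → ℂ} {P : ι → E →L[ℂ] E} {B : ℝ → E →L[ℂ] E} {a : E} {M : ℝ}

theorem hasDerivAt_cumNorm (hB : Continuous B)
    (hBi : ∀ x, IntegrableOn (fun y => ‖B y‖) (Set.Iic x)) (x : ℝ) :
    HasDerivAt (cumNorm B) ‖B x‖ x :=
  hasDerivAt_integral_Iic hB.norm hBi x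

theorem continuous_cumNorm (hB : Continuous B)
    (hBi : ∀ x, IntegrableOn (fun y => ‖B y‖) (Set.Iic x)) : Continuous (cumNorm B) :=
  continuous_iff_continuousAt.2 fun x => (hasDerivAt_cumNorm hB hBi x).continuousAt

theorem cumNorm_nonneg (x : ℝ) : 0 ≤ cumNorm B x :=
  integral_nonneg fun _ => norm_nonneg _

theorem monotone_cumNorm (hBi : ∀ x, IntegrableOn (fun y => ‖B y‖) (Set.Iic x)) :
    Monotone (cumNorm B) := fun _ y h =>
  setIntegral_mono_set (hBi y) (Eventually.of_forall fun _ => norm_nonneg _)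
    (Set.Iic_subset_Iic.2 h).eventuallyLE

theorem integrableOn_norm_mul_exp_cumNorm (hM : 0 ≤ M) (hB : Continuous B)
    (hBi : ∀ x, IntegrableOn (fun y => ‖B y‖) (Set.Iic x)) (x : ℝ) :
    IntegrableOn (fun y => ‖B y‖ * Real.exp (2 * M * cumNorm B y)) (Set.Iic x) := by
  refine Integrable.mono' ((hBi x).mul_const (Real.exp (2 * M * cumNorm B x))) ?_ ?_
  · have := continuous_cumNorm hB hBi
    exact (by fun_prop : Continuous fun y => ‖B y‖ * Real.exp (2 * M * cumNorm B y)).aestronglyMeasurable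
  · refine (ae_restrict_iff' measurableSet_Iic).2 (Eventually.of_forall fun y hy => ?_)
    rw [Real.norm_of_nonneg (by positivity)]
    gcongr
    exact monotone_cumNorm hBi hy

/-- The integrand is an exact derivative. The factor `2 M` in the exponent is chosen so that
integration returns half of the weight. -/
theorem integral_norm_mul_exp_cumNorm (hM : 0 ≤ M) (hB : Continuous B)
    (hBi : ∀ x, IntegrableOn (fun y => ‖B y‖) (Set.Iic x)) (x : ℝ) :
    M * ∫ y in Set.Iic x, ‖B y‖ * Real.exp (2 * M * cumNorm B y)
      = 1 / 2 * (Real.exp (2 * M * cumNorm B x) - 1) := by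
  have h1 : ∀ y ∈ Set.Iic x, HasDerivAt (fun y => 1 / 2 * Real.exp (2 * M * cumNorm B y))
      (M * (‖B y‖ * Real.exp (2 * M * cumNorm B y))) y := fun y _ => by
    have := (((hasDerivAt_cumNorm hB hBi y).const_mul (2 * M)).exp).const_mul (1 / 2)
    exact this.congr_deriv (by ring)
  have h2 : Tendsto (fun y => 1 / 2 * Real.exp (2 * M * cumNorm B y)) atBot (𝓝 (1 / 2)) := by
    have h0 : Tendsto (cumNorm B) atBot (𝓝 0) := tendsto_integral_Iic_atBot hBi
    have := ((Real.continuous_exp.tendsto _).comp (h0.const_mul (2 * M))).const_mul (1 / 2)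
    simpa using this
  have h3 := integral_Iic_of_hasDerivAt_of_tendsto' h1
    ((integrableOn_norm_mul_exp_cumNorm hM hB hBi x).const_mul M) h2
  rw [← integral_const_mul, h3]
  ring

theorem norm_exp_mul_sub_le_one {c : ℂ} (hc : c.re ≤ 0) {x y : ℝ} (h : y ≤ x) :
    ‖Complex.exp (c * (x - y))‖ ≤ 1 := by
  rw [Complex.norm_exp, Real.exp_le_one_iff]
  have : (c * (x - y)).re = c.re * (x - y) := by
    rw [← Complex.ofReal_sub, Complex.re_mul_ofReal]
  rw [this]
  exact mul_nonpos_of_nonpos_of_nonneg hc (by linarith)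

section Step

variable {f : ℝ → E} {K : ℝ} {c₀ : ℂ}

theorem norm_volterra_integrand_le (hc : c₀.re ≤ 0)
    (hfb : ∀ y, ‖f y‖ ≤ K * Real.exp (2 * M * cumNorm B y)) {x y : ℝ} (h : y ≤ x) :
    ‖Complex.exp (c₀ * (x - y)) • B y (f y)‖
      ≤ K * (‖B y‖ * Real.exp (2 * M * cumNorm B y)) := by
  rw [norm_smul]
  calc _ ≤ 1 * (‖B y‖ * ‖f y‖) :=
        mul_le_mul (norm_exp_mul_sub_le_one hc h) ((B y).le_opNorm _) (norm_nonneg _) zero_le_one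
    _ ≤ 1 * (‖B y‖ * (K * Real.exp (2 * M * cumNorm B y))) := by gcongr; exact hfb y
    _ = _ := by ring

theorem integrableOn_volterra_integrand (hM : 0 ≤ M) (hB : Continuous B)
    (hBi : ∀ x, IntegrableOn (fun y => ‖B y‖) (Set.Iic x)) (hc : c₀.re ≤ 0)
    (hf : Continuous f) (hfb : ∀ y, ‖f y‖ ≤ K * Real.exp (2 * M * cumNorm B y)) (x : ℝ) :
    IntegrableOn (fun y : ℝ => Complex.exp (c₀ * (x - y)) • B y (f y)) (Set.Iic x) := by
  refine Integrable.mono' ((integrableOn_norm_mul_exp_cumNorm hM hB hBi x).const_mul K) ?_ ?_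
  · exact (by fun_prop : Continuous fun y : ℝ =>
      Complex.exp (c₀ * (x - y)) • B y (f y)).aestronglyMeasurable
  · exact (ae_restrict_iff' measurableSet_Iic).2 (Eventually.of_forall fun y hy =>
      norm_volterra_integrand_le hc hfb hy)

theorem norm_volterra_integral_le (hM : 0 ≤ M) (hB : Continuous B)
    (hBi : ∀ x, IntegrableOn (fun y => ‖B y‖) (Set.Iic x)) (hc : c₀.re ≤ 0)
    (hfb : ∀ y, ‖f y‖ ≤ K * Real.exp (2 * M * cumNorm B y)) (x : ℝ) :
    ‖∫ y in Set.Iic x, Complex.exp (c₀ * (x - y)) • B y (f y)‖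
      ≤ K * ∫ y in Set.Iic x, ‖B y‖ * Real.exp (2 * M * cumNorm B y) := by
  rw [← integral_const_mul]
  exact norm_integral_le_of_norm_le ((integrableOn_norm_mul_exp_cumNorm hM hB hBi x).const_mul K)
    ((ae_restrict_iff' measurableSet_Iic).2 (Eventually.of_forall fun y hy =>
      norm_volterra_integrand_le hc hfb hy))

/-- The kernel factors as `e^{c₀ x} e^{-c₀ y}`, so the product rule applies although `x` occurs both
in the integrand and in the limit of integration. -/
theorem hasDerivAt_volterra_integral [CompleteSpace E] (hM : 0 ≤ M) (hB : Continuous B)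
    (hBi : ∀ x, IntegrableOn (fun y => ‖B y‖) (Set.Iic x)) (hc : c₀.re ≤ 0)
    (hf : Continuous f) (hfb : ∀ y, ‖f y‖ ≤ K * Real.exp (2 * M * cumNorm B y)) (x : ℝ) :
    HasDerivAt (fun x : ℝ => ∫ y in Set.Iic x, Complex.exp (c₀ * (x - y)) • B y (f y))
      (c₀ • (∫ y in Set.Iic x, Complex.exp (c₀ * (x - y)) • B y (f y)) + B x (f x)) x := by
  have hsplit : ∀ x y : ℝ, Complex.exp (c₀ * (x - y)) • B y (f y)
      = Complex.exp (c₀ * x) • (Complex.exp (-(c₀ * y)) • B y (f y)) := fun x y => by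
    rw [smul_smul, ← Complex.exp_add]
    ring_nf
  have hi : ∀ x, IntegrableOn (fun y : ℝ => Complex.exp (-(c₀ * y)) • B y (f y)) (Set.Iic x) :=
    fun x => by
      have := (integrableOn_volterra_integrand hM hB hBi hc hf hfb x).smul
        (Complex.exp (-(c₀ * x)))
      refine this.congr (Eventually.of_forall fun y => ?_)
      simp only [Pi.smul_apply]
      rw [hsplit, smul_smul, ← Complex.exp_add]
      simp
  have hd := hasDerivAt_integral_Iic
    (by fun_prop : Continuous fun y : ℝ => Complex.exp (-(c₀ * y)) • B y (f y)) hi x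
  have he : HasDerivAt (fun x : ℝ => Complex.exp (c₀ * x)) (Complex.exp (c₀ * x) * c₀) x := by
    have := ((hasDerivAt_id x).ofReal_comp.const_mul c₀).cexp
    simpa using this
  have hs := he.smul hd
  simp only [hsplit, integral_smul]
  refine hs.congr_deriv ?_
  rw [add_comm]
  congr 1
  · rw [smul_smul, mul_comm]
  · rw [smul_smul, ← Complex.exp_add]
    simp

end Step

theorem volterraTerm_zero (x : ℝ) : volterraTerm c P B a 0 x = a := rfl

theorem volterraTerm_succ (n : ℕ) (x : ℝ) : volterraTerm c P B a (n + 1) x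
    = ∑ j, P j (∫ y in Set.Iic x,
      Complex.exp (c j * (x - y)) • B y (volterraTerm c P B a n y)) := rfl

/-- One Volterra step gains a factor `1/2` in the weighted norm, so the series is geometric without
any smallness of `B`. The subtracted `1` is kept because it makes the correction vanish at `-∞`. -/
theorem norm_volterra_step_le {f : ℝ → E} {K : ℝ} (hM : ∑ j, ‖P j‖ ≤ M) (hB : Continuous B)
    (hBi : ∀ x, IntegrableOn (fun y => ‖B y‖) (Set.Iic x)) (hc : ∀ j, (c j).re ≤ 0)
    (hK : 0 ≤ K) (hfb : ∀ y, ‖f y‖ ≤ K * Real.exp (2 * M * cumNorm B y)) (x : ℝ) :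
    ‖∑ j, P j (∫ y in Set.Iic x, Complex.exp (c j * (x - y)) • B y (f y))‖
      ≤ K * (1 / 2) * (Real.exp (2 * M * cumNorm B x) - 1) := by
  have hM0 : 0 ≤ M := (Finset.sum_nonneg fun _ _ => norm_nonneg _).trans hM
  set R := ∫ y in Set.Iic x, ‖B y‖ * Real.exp (2 * M * cumNorm B y) with hR
  have hR0 : 0 ≤ R := integral_nonneg fun _ => by positivity
  calc _ ≤ ∑ j, ‖P j‖ * (K * R) := (norm_sum_le _ _).trans (Finset.sum_le_sum fun j _ =>
        ((P j).le_opNorm _).trans (mul_le_mul_of_nonneg_left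
          (norm_volterra_integral_le hM0 hB hBi (hc j) hfb x) (norm_nonneg _)))
    _ = (∑ j, ‖P j‖) * (K * R) := by rw [Finset.sum_mul]
    _ ≤ M * (K * R) := by gcongr
    _ = K * (M * R) := by ring
    _ = _ := by rw [hR, integral_norm_mul_exp_cumNorm hM0 hB hBi]; ring

variable [CompleteSpace E]

theorem volterraTerm_continuous_and_le (hM : ∑ j, ‖P j‖ ≤ M) (hB : Continuous B)
    (hBi : ∀ x, IntegrableOn (fun y => ‖B y‖) (Set.Iic x)) (hc : ∀ j, (c j).re ≤ 0) (n : ℕ) :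
    Continuous (volterraTerm c P B a n) ∧ ∀ x, ‖volterraTerm c P B a n x‖
      ≤ ‖a‖ * (1 / 2) ^ n * Real.exp (2 * M * cumNorm B x) := by
  have hM0 : 0 ≤ M := (Finset.sum_nonneg fun _ _ => norm_nonneg _).trans hM
  induction n with
  | zero =>
    refine ⟨continuous_const, fun x => ?_⟩
    rw [volterraTerm_zero, pow_zero, mul_one]
    refine le_mul_of_one_le_right (norm_nonneg _) (Real.one_le_exp ?_)
    have := cumNorm_nonneg (B := B) x
    positivity
  | succ n ih =>
    obtain ⟨ihc, ihb⟩ := ih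
    constructor
    · refine continuous_iff_continuousAt.2 fun x => ?_
      have : ∀ j, ContinuousAt (fun x : ℝ => P j (∫ y in Set.Iic x,
          Complex.exp (c j * (x - y)) • B y (volterraTerm c P B a n y))) x := fun j =>
        (P j).continuous.continuousAt.comp
          (hasDerivAt_volterra_integral hM0 hB hBi (hc j) ihc ihb x).continuousAt
      exact tendsto_finsetSum _ fun j _ => this j
    · intro x
      rw [volterraTerm_succ]
      refine (norm_volterra_step_le hM hB hBi hc (by positivity) ihb x).trans ?_
      rw [pow_succ, ← mul_assoc]
      gcongr
      linarith

theorem norm_volterraTerm_succ_le (hM : ∑ j, ‖P j‖ ≤ M) (hB : Continuous B)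
    (hBi : ∀ x, IntegrableOn (fun y => ‖B y‖) (Set.Iic x)) (hc : ∀ j, (c j).re ≤ 0) (n : ℕ)
    (x : ℝ) : ‖volterraTerm c P B a (n + 1) x‖
      ≤ ‖a‖ * (1 / 2) ^ (n + 1) * (Real.exp (2 * M * cumNorm B x) - 1) := by
  rw [volterraTerm_succ, pow_succ, ← mul_assoc]
  exact norm_volterra_step_le hM hB hBi hc (by positivity)
    (volterraTerm_continuous_and_le hM hB hBi hc n).2 x

/-- In the `j`-th summand the scalar `c j` acts on the range of `P j` as `A` does, and the
projections sum to the identity; so the summands reassemble into `A` and `B`. -/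
theorem hasDerivAt_volterraTerm_succ {A : E →L[ℂ] E} (hM : ∑ j, ‖P j‖ ≤ M) (hB : Continuous B)
    (hBi : ∀ x, IntegrableOn (fun y => ‖B y‖) (Set.Iic x)) (hc : ∀ j, (c j).re ≤ 0)
    (hA : ∀ j v, A (P j v) = c j • P j v) (hP : ∀ v, ∑ j, P j v = v) (n : ℕ) (x : ℝ) :
    HasDerivAt (volterraTerm c P B a (n + 1))
      (A (volterraTerm c P B a (n + 1) x) + B x (volterraTerm c P B a n x)) x := by
  have hM0 : 0 ≤ M := (Finset.sum_nonneg fun _ _ => norm_nonneg _).trans hM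
  obtain ⟨ihc, ihb⟩ := volterraTerm_continuous_and_le (a := a) hM hB hBi hc n
  have : ∀ j ∈ Finset.univ, HasDerivAt (fun x : ℝ => P j (∫ y in Set.Iic x,
      Complex.exp (c j * (x - y)) • B y (volterraTerm c P B a n y)))
      (P j (c j • (∫ y in Set.Iic x,
        Complex.exp (c j * (x - y)) • B y (volterraTerm c P B a n y))
        + B x (volterraTerm c P B a n x))) x := fun j _ =>
    ((P j).restrictScalars ℝ).hasFDerivAt.comp_hasDerivAt x
      (hasDerivAt_volterra_integral hM0 hB hBi (hc j) ihc ihb x)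
  have hs := HasDerivAt.fun_sum this
  refine hs.congr_deriv ?_
  rw [volterraTerm_succ, map_sum]
  simp only [map_add, map_smul, hA]
  rw [Finset.sum_add_distrib, hP]

theorem summable_volterraTerm (hM : ∑ j, ‖P j‖ ≤ M) (hB : Continuous B)
    (hBi : ∀ x, IntegrableOn (fun y => ‖B y‖) (Set.Iic x)) (hc : ∀ j, (c j).re ≤ 0) (x : ℝ) :
    Summable fun n => volterraTerm c P B a n x :=
  Summable.of_norm_bounded
    (g := fun n => ‖a‖ * (1 / 2) ^ n * Real.exp (2 * M * cumNorm B x))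
    ((summable_geometric_two.mul_left _).mul_right _)
    fun n => (volterraTerm_continuous_and_le hM hB hBi hc n).2 x

theorem norm_volterraSol_sub_le (hM : ∑ j, ‖P j‖ ≤ M) (hB : Continuous B)
    (hBi : ∀ x, IntegrableOn (fun y => ‖B y‖) (Set.Iic x)) (hc : ∀ j, (c j).re ≤ 0) (x : ℝ) :
    ‖volterraSol c P B a x - a‖ ≤ ‖a‖ * (Real.exp (2 * M * cumNorm B x) - 1) := by
  have h : volterraSol c P B a x - a = ∑' n, volterraTerm c P B a (n + 1) x := by
    rw [volterraSol, (summable_volterraTerm hM hB hBi hc x).tsum_eq_zero_add, volterraTerm_zero]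
    abel
  rw [h]
  have hs : HasSum (fun n : ℕ => ‖a‖ * (1 / 2) ^ (n + 1) * (Real.exp (2 * M * cumNorm B x) - 1))
      (‖a‖ * (Real.exp (2 * M * cumNorm B x) - 1)) := by
    have h1 : HasSum (fun n : ℕ => (1 / 2 : ℝ) ^ (n + 1)) 1 := by
      have := hasSum_geometric_two.mul_left (1 / 2 : ℝ)
      simpa [pow_succ, mul_comm] using this
    simpa using (h1.mul_left ‖a‖).mul_right (Real.exp (2 * M * cumNorm B x) - 1)
  exact tsum_of_norm_bounded hs fun n => norm_volterraTerm_succ_le hM hB hBi hc n x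

theorem tendsto_volterraSol (hM : ∑ j, ‖P j‖ ≤ M) (hB : Continuous B)
    (hBi : ∀ x, IntegrableOn (fun y => ‖B y‖) (Set.Iic x)) (hc : ∀ j, (c j).re ≤ 0) :
    Tendsto (volterraSol c P B a) atBot (𝓝 a) := by
  rw [tendsto_iff_norm_sub_tendsto_zero]
  refine squeeze_zero (fun _ => norm_nonneg _) (norm_volterraSol_sub_le hM hB hBi hc) ?_
  have h0 : Tendsto (cumNorm B) atBot (𝓝 0) := tendsto_integral_Iic_atBot hBi
  have := (((Real.continuous_exp.tendsto _).comp (h0.const_mul (2 * M))).sub_const 1).const_mul ‖a‖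
  simpa using this

theorem hasDerivAt_volterraSol {A : E →L[ℂ] E} (hM : ∑ j, ‖P j‖ ≤ M) (hB : Continuous B)
    (hBi : ∀ x, IntegrableOn (fun y => ‖B y‖) (Set.Iic x)) (hc : ∀ j, (c j).re ≤ 0)
    (hA : ∀ j v, A (P j v) = c j • P j v) (hP : ∀ v, ∑ j, P j v = v) (ha : A a = 0)
    (hBb : ∃ R, ∀ x, ‖B x‖ ≤ R) (x : ℝ) :
    HasDerivAt (volterraSol c P B a)
      (A (volterraSol c P B a x) + B x (volterraSol c P B a x)) x := by
  have hM0 : 0 ≤ M := (Finset.sum_nonneg fun _ _ => norm_nonneg _).trans hM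
  obtain ⟨R, hR⟩ := hBb
  have hR0 : 0 ≤ R := (norm_nonneg _).trans (hR 0)
  -- Termwise differentiation needs uniform bounds on an open connected set around `x`. On `Iio (x +
  -- 1)` the increasing weight is bounded by its value at the end point.
  obtain ⟨e, he0, he⟩ : ∃ e : ℝ, 0 ≤ e ∧
      ∀ y ∈ Set.Iio (x + 1), Real.exp (2 * M * cumNorm B y) ≤ e := by
    refine ⟨Real.exp (2 * M * cumNorm B (x + 1)), (Real.exp_pos _).le, fun y hy => ?_⟩
    gcongr
    exact monotone_cumNorm hBi (Set.mem_Iio.1 hy).le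
  obtain ⟨T, hT⟩ : ∃ T, T = volterraTerm c P B a := ⟨_, rfl⟩
  have hTe : ∀ n y, y ∈ Set.Iio (x + 1) → ‖T n y‖ ≤ ‖a‖ * (1 / 2) ^ n * e := fun n y hy => by
    rw [hT]
    refine ((volterraTerm_continuous_and_le hM hB hBi hc n).2 y).trans ?_
    gcongr
    exact he y hy
  have hsum : ∀ y, Summable fun n => T n y := fun y => by
    rw [hT]
    exact summable_volterraTerm hM hB hBi hc y
  have hder : ∀ n y, HasDerivAt (T (n + 1)) (A (T (n + 1) y) + B y (T n y)) y := fun n y => by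
    rw [hT]
    exact hasDerivAt_volterraTerm_succ hM hB hBi hc hA hP n y
  have hT0 : ∀ y, T 0 y = a := fun y => by rw [hT, volterraTerm_zero]
  have hsol : volterraSol c P B a = fun y => ∑' n, T n y := by
    rw [hT]
    rfl
  clear hT
  let T' : ℕ → ℝ → E := fun n y => A (T (n + 1) y) + B y (T n y)
  have hd : HasDerivAt (fun y => ∑' n, T (n + 1) y) (∑' n, T' n x) x := by
    refine hasDerivAt_tsum_of_isPreconnected
      (u := fun n => (‖A‖ + R) * (‖a‖ * (1 / 2) ^ n * e)) (t := Set.Iio (x + 1)) (y₀ := x)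
      (((summable_geometric_two.mul_left _).mul_right _).mul_left _) isOpen_Iio
      isPreconnected_Iio (fun n y _ => hder n y)
      (fun n y hy => ?_) (by simp) ((summable_nat_add_iff 1).2 (hsum x)) (by simp)
    refine (norm_add_le _ _).trans ?_
    rw [add_mul]
    refine add_le_add ((A.le_opNorm _).trans ?_) (((B y).le_opNorm _).trans ?_)
    · gcongr
      refine (hTe (n + 1) y hy).trans ?_
      gcongr ‖a‖ * ?_ * e
      rw [pow_succ]
      exact mul_le_of_le_one_right (by positivity) (by norm_num)
    · exact mul_le_mul (hR y) (hTe n y hy) (norm_nonneg _) hR0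
  have hf : ∀ y, ∑' n, T n y = a + ∑' n, T (n + 1) y := fun y => by
    rw [(hsum y).tsum_eq_zero_add, hT0]
  -- As `A a = 0`, omitting the zeroth term does not change the value of `A` on the sum.
  have hv : ∑' n, T' n x = A (∑' n, T n x) + B x (∑' n, T n x) := by
    have h1 : Summable fun n => T (n + 1) x := (summable_nat_add_iff 1).2 (hsum x)
    have e1 : HasSum (fun n => A (T (n + 1) x)) (A (∑' n, T n x)) := by
      rw [hf, map_add, ha, zero_add]
      exact A.hasSum h1.hasSum
    have e2 : HasSum (fun n => B x (T n x)) (B x (∑' n, T n x)) := (B x).hasSum (hsum x).hasSum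
    exact (e1.add e2).tsum_eq
  rw [hsol]
  simp only [← hv]
  simp only [hf]
  exact hd.const_add a

end Volterra

/-! ### Dependence of the Volterra solution on the spectral parameter -/

section VolterraParameter

variable {E : Type*} [NormedAddCommGroup E] [NormedSpace ℂ E]
  {ι : Type*} [Fintype ι]

/-- A dominated integral of holomorphic functions of a parameter is holomorphic. -/
theorem differentiableOn_integral_of_dominated {α : Type*} [MeasurableSpace α] {μ : Measure α}
    {F : ℂ → α → E} {bound : α → ℝ} {U : Set ℂ} (hU : IsOpen U)
    (hm : ∀ z ∈ U, AEStronglyMeasurable (F z) μ)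
    (hd : ∀ᵐ y ∂μ, DifferentiableOn ℂ (fun z => F z y) U)
    (hb : ∀ᵐ y ∂μ, ∀ z ∈ U, ‖F z y‖ ≤ bound y) (hbi : Integrable bound μ) :
    DifferentiableOn ℂ (fun z => ∫ y, F z y ∂μ) U := by
  intro z₀ hz₀
  obtain ⟨r, hr, hrU⟩ := Metric.isOpen_iff.1 hU z₀ hz₀
  have hr2 : 0 < r / 2 := half_pos hr
  have hsub : ∀ z ∈ Metric.ball z₀ (r / 2), Metric.ball z (r / 2) ⊆ U := fun z hz w hw =>
    hrU (by
      have := dist_triangle w z z₀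
      simp only [Metric.mem_ball] at *
      linarith)
  have hzU : ∀ z ∈ Metric.ball z₀ (r / 2), z ∈ U := fun z hz =>
    hsub z hz (Metric.mem_ball_self hr2)
  -- Only each `F z` is assumed measurable; the derivative is measurable as an almost everywhere
  -- limit of difference quotients along a null sequence.
  have hF' : AEStronglyMeasurable (fun y => deriv (fun z => F z y) z₀) μ := by
    obtain ⟨h, hh0, hhlim⟩ : ∃ h : ℕ → ℂ, (∀ n, z₀ + h n ∈ U ∧ h n ≠ 0) ∧ Tendsto h atTop (𝓝 0) := by
      have hpos : ∀ n : ℕ, 0 < r / 4 * (1 / ((n : ℝ) + 1)) := fun n => by positivity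
      refine ⟨fun n => ((r / 4 * (1 / ((n : ℝ) + 1)) : ℝ) : ℂ), fun n => ⟨hzU _ ?_, ?_⟩, ?_⟩
      · rw [mem_ball_iff_norm, add_sub_cancel_left, Complex.norm_real, Real.norm_of_nonneg (hpos n).le]
        have : r / 4 * (1 / ((n : ℝ) + 1)) ≤ r / 4 := mul_le_of_le_one_right (by positivity)
          (div_le_one_of_le₀ (by linarith [n.cast_nonneg (α := ℝ)]) (by positivity))
        linarith
      · exact Complex.ofReal_ne_zero.2 (hpos n).ne'
      · have h1 := (tendsto_one_div_add_atTop_nhds_zero_nat (𝕜 := ℝ)).const_mul (r / 4)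
        rw [mul_zero] at h1
        exact (Complex.continuous_ofReal.tendsto' 0 0 Complex.ofReal_zero).comp h1
    refine aestronglyMeasurable_of_tendsto_ae atTop
      (f := fun n y => slope (fun z => F z y) z₀ (z₀ + h n)) (fun n => ?_) ?_
    · simp only [slope_def_module]
      exact ((hm _ (hh0 n).1).sub (hm _ hz₀)).const_smul _
    · filter_upwards [hd] with y hy
      have h1 := ((hy z₀ hz₀).differentiableAt (hU.mem_nhds hz₀)).hasDerivAt
      rw [hasDerivAt_iff_tendsto_slope] at h1
      refine h1.comp (tendsto_nhdsWithin_iff.2 ⟨?_, Eventually.of_forall fun n => ?_⟩)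
      · simpa using hhlim.const_add z₀
      · simpa using (hh0 n).2
  -- The derivative is dominated by Cauchy's estimate on circles of radius `r / 4` about points of
  -- the ball of radius `r / 2`; these circles stay in `U`.
  have key := hasDerivAt_integral_of_dominated_loc_of_deriv_le (𝕜 := ℂ) (μ := μ) (F := F)
    (F' := fun z y => deriv (fun z => F z y) z) (x₀ := z₀)
    (bound := fun y => bound y / (r / 4)) (s := Metric.ball z₀ (r / 2)) (Metric.ball_mem_nhds _ hr2)
    (by filter_upwards [hU.mem_nhds hz₀] with z hz using hm z hz)
    (Integrable.mono' hbi (hm z₀ hz₀) (hb.mono fun y hy => hy z₀ hz₀)) hF'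
    (by
      filter_upwards [hd, hb] with y hy hby z hz
      refine Complex.norm_deriv_le_of_forall_mem_sphere_norm_le (by positivity)
        (DifferentiableOn.diffContOnCl_ball (U := U) hy
          ((Metric.closedBall_subset_ball (by linarith)).trans (hsub z hz))) fun w hw => hby w ?_
      refine hsub z hz ?_
      rw [mem_sphere_iff_norm] at hw
      rw [mem_ball_iff_norm, hw]
      linarith)
    (hbi.div_const _)
    (by
      filter_upwards [hd] with y hy z hz
      exact ((hy z (hzU z hz)).differentiableAt (hU.mem_nhds (hzU z hz))).hasDerivAt)
  exact key.2.differentiableAt.differentiableWithinAt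

variable [CompleteSpace E]
  {c : ι → ℂ → ℂ} {P : ι → ℂ → E →L[ℂ] E} {B : ℝ → E →L[ℂ] E} {a : ℂ → E} {M K : ℝ}
  {U : Set ℂ}

theorem differentiableOn_volterraTerm (hU : IsOpen U) (hM : ∀ z ∈ U, ∑ j, ‖P j z‖ ≤ M)
    (hB : Continuous B)
    (hBi : ∀ x, IntegrableOn (fun y => ‖B y‖) (Set.Iic x)) (hc : ∀ z ∈ U, ∀ j, (c j z).re ≤ 0)
    (hK : ∀ z ∈ U, ‖a z‖ ≤ K) (hcd : ∀ j, DifferentiableOn ℂ (c j) U)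
    (hPd : ∀ j, DifferentiableOn ℂ (P j) U) (had : DifferentiableOn ℂ a U) (n : ℕ) (x : ℝ) :
    DifferentiableOn ℂ (fun z => volterraTerm (fun j => c j z) (fun j => P j z) B (a z) n x) U := by
  rcases U.eq_empty_or_nonempty with rfl | ⟨z₁, hz₁⟩
  · exact differentiableOn_empty
  have hM0 : 0 ≤ M := (Finset.sum_nonneg fun _ _ => norm_nonneg _).trans (hM z₁ hz₁)
  induction n generalizing x with
  | zero => exact had
  | succ n ih =>
    simp only [volterraTerm_succ]
    refine DifferentiableOn.fun_sum fun j _ => (hPd j).clm_apply ?_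
    have hcb := fun z (hz : z ∈ U) =>
      volterraTerm_continuous_and_le (a := a z) (hM z hz) hB hBi (hc z hz) n
    refine differentiableOn_integral_of_dominated (bound := fun y =>
      K * (1 / 2) ^ n * (‖B y‖ * Real.exp (2 * M * cumNorm B y))) hU (fun z hz => ?_)
      (Eventually.of_forall fun y => ?_)
      ((ae_restrict_iff' measurableSet_Iic).2 (Eventually.of_forall fun y hy z hz => ?_))
      ((integrableOn_norm_mul_exp_cumNorm hM0 hB hBi x).const_mul _)
    · exact (integrableOn_volterra_integrand hM0 hB hBi (hc z hz j) (hcb z hz).1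
        (hcb z hz).2 x).aestronglyMeasurable
    · exact ((hcd j).mul_const _).cexp.smul
        ((B y).differentiable.comp_differentiableOn (ih y))
    · refine norm_volterra_integrand_le (hc z hz j) (fun y => ((hcb z hz).2 y).trans ?_) hy
      gcongr
      exact hK z hz

theorem differentiableOn_volterraSol (hU : IsOpen U) (hM : ∀ z ∈ U, ∑ j, ‖P j z‖ ≤ M)
    (hB : Continuous B)
    (hBi : ∀ x, IntegrableOn (fun y => ‖B y‖) (Set.Iic x)) (hc : ∀ z ∈ U, ∀ j, (c j z).re ≤ 0)
    (hK : ∀ z ∈ U, ‖a z‖ ≤ K) (hcd : ∀ j, DifferentiableOn ℂ (c j) U)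
    (hPd : ∀ j, DifferentiableOn ℂ (P j) U) (had : DifferentiableOn ℂ a U) (x : ℝ) :
    DifferentiableOn ℂ (fun z => volterraSol (fun j => c j z) (fun j => P j z) B (a z) x) U := by
  refine Complex.differentiableOn_tsum_of_summable_norm
    (u := fun n => K * (1 / 2) ^ n * Real.exp (2 * M * cumNorm B x))
    ((summable_geometric_two.mul_left _).mul_right _)
    (fun n => differentiableOn_volterraTerm hU hM hB hBi hc hK hcd hPd had n x) hU
    fun n z hz => ((volterraTerm_continuous_and_le (hM z hz) hB hBi (hc z hz) n).2 x).trans ?_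
  gcongr
  exact hK z hz

theorem continuousOn_volterraTerm (hM : ∀ z ∈ U, ∑ j, ‖P j z‖ ≤ M)
    (hB : Continuous B)
    (hBi : ∀ x, IntegrableOn (fun y => ‖B y‖) (Set.Iic x)) (hc : ∀ z ∈ U, ∀ j, (c j z).re ≤ 0)
    (hK : ∀ z ∈ U, ‖a z‖ ≤ K) (hcd : ∀ j, ContinuousOn (c j) U)
    (hPd : ∀ j, ContinuousOn (P j) U) (had : ContinuousOn a U) (n : ℕ) (x : ℝ) :
    ContinuousOn (fun z => volterraTerm (fun j => c j z) (fun j => P j z) B (a z) n x) U := by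
  rcases U.eq_empty_or_nonempty with rfl | ⟨z₁, hz₁⟩
  · exact continuousOn_empty _
  have hM0 : 0 ≤ M := (Finset.sum_nonneg fun _ _ => norm_nonneg _).trans (hM z₁ hz₁)
  induction n generalizing x with
  | zero => exact had
  | succ n ih =>
    simp only [volterraTerm_succ]
    refine continuousOn_finsetSum _ fun j _ => (hPd j).clm_apply ?_
    have hcb := fun z (hz : z ∈ U) =>
      volterraTerm_continuous_and_le (a := a z) (hM z hz) hB hBi (hc z hz) n
    refine continuousOn_of_dominated (bound := fun y =>
      K * (1 / 2) ^ n * (‖B y‖ * Real.exp (2 * M * cumNorm B y))) (fun z hz => ?_)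
      (fun z hz => (ae_restrict_iff' measurableSet_Iic).2 (Eventually.of_forall fun y hy => ?_))
      ((integrableOn_norm_mul_exp_cumNorm hM0 hB hBi x).const_mul _)
      (Eventually.of_forall fun y => ?_)
    · exact (integrableOn_volterra_integrand hM0 hB hBi (hc z hz j) (hcb z hz).1
        (hcb z hz).2 x).aestronglyMeasurable
    · refine norm_volterra_integrand_le (hc z hz j) (fun y => ((hcb z hz).2 y).trans ?_) hy
      gcongr
      exact hK z hz
    · exact ((hcd j).mul continuousOn_const).cexp.smul
        ((B y).continuous.comp_continuousOn (ih y))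

/-- Here `U` need not be open, so that pieces of the closed half-plane containing real points are
covered. -/
theorem continuousOn_volterraSol (hM : ∀ z ∈ U, ∑ j, ‖P j z‖ ≤ M)
    (hB : Continuous B)
    (hBi : ∀ x, IntegrableOn (fun y => ‖B y‖) (Set.Iic x)) (hc : ∀ z ∈ U, ∀ j, (c j z).re ≤ 0)
    (hK : ∀ z ∈ U, ‖a z‖ ≤ K) (hcd : ∀ j, ContinuousOn (c j) U)
    (hPd : ∀ j, ContinuousOn (P j) U) (had : ContinuousOn a U) (x : ℝ) :
    ContinuousOn (fun z => volterraSol (fun j => c j z) (fun j => P j z) B (a z) x) U := by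
  refine continuousOn_tsum
    (u := fun n => K * (1 / 2) ^ n * Real.exp (2 * M * cumNorm B x))
    (fun n => continuousOn_volterraTerm hM hB hBi hc hK hcd hPd had n x)
    ((summable_geometric_two.mul_left _).mul_right _)
    fun n z hz => ((volterraTerm_continuous_and_le (hM z hz) hB hBi (hc z hz) n).2 x).trans ?_
  gcongr
  exact hK z hz

end VolterraParameter

/-! ### Eigenvectors and spectral projections for a constant potential -/

section SpectralData

/-- A matrix acting on column vectors, written as a combination of matrix units so that it is
visibly as regular as its entries. -/
def matCLM (A : Mat3) : (Fin 3 → ℂ) →L[ℂ] (Fin 3 → ℂ) :=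
  ∑ i, ∑ j, A i j • (ContinuousLinearMap.proj (R := ℂ) (φ := fun _ : Fin 3 => ℂ) j).smulRight
    (Pi.single i (1 : ℂ) : Fin 3 → ℂ)

theorem matCLM_apply (A : Mat3) (u : Fin 3 → ℂ) : matCLM A u = A.mulVec u := by
  ext l
  simp [matCLM, Matrix.mulVec, dotProduct, Fin.sum_univ_three]
  fin_cases l <;> simp

theorem norm_matCLM_le {A : Mat3} {m : ℝ} (h : ∀ i j, ‖A i j‖ ≤ m) : ‖matCLM A‖ ≤ 9 * m := by
  have hm : 0 ≤ m := (norm_nonneg _).trans (h 0 0)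
  refine ContinuousLinearMap.opNorm_le_bound _ (by positivity) fun u => ?_
  rw [matCLM_apply, pi_norm_le_iff_of_nonneg (by positivity)]
  intro i
  simp only [Matrix.mulVec, dotProduct]
  calc _ ≤ ∑ j, ‖A i j * u j‖ := norm_sum_le _ _
    _ ≤ ∑ _j : Fin 3, m * ‖u‖ := Finset.sum_le_sum fun j _ => by
        rw [norm_mul]
        exact mul_le_mul (h i j) (norm_le_pi_norm u j) (norm_nonneg _) hm
    _ = 3 * m * ‖u‖ := by simp; ring
    _ ≤ _ := by
      have := mul_nonneg hm (norm_nonneg u)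
      nlinarith

theorem continuousOn_matCLM {X : Type*} [TopologicalSpace X] {f : X → Mat3} {s : Set X}
    (h : ∀ i j, ContinuousOn (fun x => f x i j) s) : ContinuousOn (fun x => matCLM (f x)) s :=
  continuousOn_finsetSum _ fun i _ => continuousOn_finsetSum _ fun j _ =>
    (h i j).smul continuousOn_const

theorem differentiableOn_matCLM {f : ℂ → Mat3} {s : Set ℂ}
    (h : ∀ i j, DifferentiableOn ℂ (fun x => f x i j) s) :
    DifferentiableOn ℂ (fun x => matCLM (f x)) s :=
  DifferentiableOn.fun_sum fun i _ => DifferentiableOn.fun_sum fun j _ => (h i j).smul_const _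

/-- The eigenvectors of `matX q₀ v z` for `‖v‖ = q₀`. -/
def eigCol (q₀ : ℝ) (v : Vec2) (z : ℂ) : Fin 3 → Fin 3 → ℂ :=
  ![![1, v 0 / z, v 1 / z], ![0, perp v 0, perp v 1], ![(q₀ : ℂ) ^ 2 / z, v 0, v 1]]

/-- The basis dual to `eigCol`. -/
def eigRow (q₀ : ℝ) (v : Vec2) (z : ℂ) : Fin 3 → Fin 3 → ℂ :=
  ![![rhoHat q₀ z, -(rhoHat q₀ z * star (v 0) / z), -(rhoHat q₀ z * star (v 1) / z)],
    ![0, star (perp v 0) / (q₀ : ℂ) ^ 2, star (perp v 1) / (q₀ : ℂ) ^ 2],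
    ![-(rhoHat q₀ z / z), rhoHat q₀ z * star (v 0) / (q₀ : ℂ) ^ 2,
      rhoHat q₀ z * star (v 1) / (q₀ : ℂ) ^ 2]]

/-- The frequencies: `matX q₀ v z` has the eigenvalues `i freq`. -/
def freq (q₀ : ℝ) (z : ℂ) : Fin 3 → ℂ := ![lamOf q₀ z, -kOf q₀ z, -lamOf q₀ z]

theorem matX_mulVec (q₀ : ℝ) (v : Vec2) (z : ℂ) (φ : Fin 3 → ℂ) :
    (matX q₀ v z).mulVec φ = ![I * kOf q₀ z * φ 0 - I * (star (v 0) * φ 1 + star (v 1) * φ 2),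
      I * v 0 * φ 0 - I * kOf q₀ z * φ 1, I * v 1 * φ 0 - I * kOf q₀ z * φ 2] := by
  ext i
  fin_cases i <;>
    simp [matX, matJ, matQ, Matrix.mulVec, dotProduct, Fin.sum_univ_three, Matrix.diagonal] <;> ring

variable {q₀ : ℝ} {v : Vec2} {z : ℂ}

theorem vec2_norm_sq (v : Vec2) : v 0 * star (v 0) + v 1 * star (v 1) = ((‖v‖ ^ 2 : ℝ) : ℂ) := by
  rw [EuclideanSpace.norm_sq_eq]
  simp [Complex.mul_conj, Complex.normSq_eq_norm_sq]

theorem perp_zero (v : Vec2) : perp v 0 = star (v 1) := by simp [perp]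

theorem perp_one (v : Vec2) : perp v 1 = -star (v 0) := by simp [perp]

theorem eigCol_eigen (hz : z ≠ 0) (hv : ‖v‖ = q₀) (j : Fin 3) :
    (matX q₀ v z).mulVec (eigCol q₀ v z j) = (I * freq q₀ z j) • eigCol q₀ v z j := by
  have hn := vec2_norm_sq v
  rw [hv] at hn
  push_cast at hn
  simp only [← starRingEnd_apply] at hn
  rw [matX_mulVec]
  ext i
  fin_cases j <;> fin_cases i <;>
    simp [eigCol, freq, kOf, lamOf, perp_zero, perp_one] <;> field_simp <;>
    first | ring1 | linear_combination (-2:ℂ) * hn | linear_combination (-2 * z ^ 2) * hn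

theorem not_mem_exceptional_iff :
    z ∉ exceptional q₀ ↔ z ≠ 0 ∧ z ^ 2 - (q₀ : ℂ) ^ 2 ≠ 0 := by
  have : z ^ 2 - (q₀ : ℂ) ^ 2 = (z - q₀) * (z + q₀) := by ring
  simp [exceptional, this, sub_eq_zero, add_eq_zero_iff_eq_neg]

/-- Only `v†v = q₀²` is used besides algebra. At `z = ±q₀` the first and third eigenvectors become
parallel, hence the exclusion of these points. -/
theorem sum_eigCol_mul_eigRow (hq : 0 < q₀) (hz : z ∉ exceptional q₀) (hv : ‖v‖ = q₀)
    (i l : Fin 3) : ∑ j, eigCol q₀ v z j i * eigRow q₀ v z j l = if i = l then 1 else 0 := by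
  obtain ⟨hz0, hz1⟩ := not_mem_exceptional_iff.1 hz
  have hn := vec2_norm_sq v
  rw [hv] at hn
  push_cast at hn
  simp only [← starRingEnd_apply] at hn
  have hq' : (q₀ : ℂ) ≠ 0 := by exact_mod_cast hq.ne'
  rw [Fin.sum_univ_three]
  fin_cases i <;> fin_cases l <;>
    simp [eigCol, eigRow, rhoHat, perp_zero, perp_one] <;> field_simp <;>
    first | ring1 | linear_combination hn | linear_combination -hn | linear_combination (z ^ 2 - q₀ ^ 2) * hn

theorem perp_norm (v : Vec2) : ‖perp v‖ = ‖v‖ := by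
  rw [EuclideanSpace.norm_eq, EuclideanSpace.norm_eq]
  simp [Fin.sum_univ_two, perp_zero, perp_one, add_comm]

theorem differentiableOn_rhoHat : DifferentiableOn ℂ (rhoHat q₀) (exceptional q₀)ᶜ := by
  intro z hz
  have := (not_mem_exceptional_iff.1 hz).2
  unfold rhoHat
  exact DifferentiableAt.differentiableWithinAt (by fun_prop (disch := assumption))

theorem differentiableOn_freq (j : Fin 3) :
    DifferentiableOn ℂ (fun z => freq q₀ z j) (exceptional q₀)ᶜ := by
  intro z hz
  have := (not_mem_exceptional_iff.1 hz).1
  refine DifferentiableAt.differentiableWithinAt ?_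
  fin_cases j <;> simp only [freq, kOf, lamOf] <;> simp <;> fun_prop (disch := assumption)

theorem differentiableOn_eigCol (j i : Fin 3) :
    DifferentiableOn ℂ (fun z => eigCol q₀ v z j i) (exceptional q₀)ᶜ := by
  intro z hz
  have := (not_mem_exceptional_iff.1 hz).1
  refine DifferentiableAt.differentiableWithinAt ?_
  fin_cases j <;> fin_cases i <;> simp [eigCol] <;> fun_prop (disch := assumption)

theorem differentiableOn_eigRow (j i : Fin 3) :
    DifferentiableOn ℂ (fun z => eigRow q₀ v z j i) (exceptional q₀)ᶜ := by
  have hid : DifferentiableOn ℂ (fun z : ℂ => z) (exceptional q₀)ᶜ := differentiableOn_id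
  have hne : ∀ z ∈ (exceptional q₀)ᶜ, z ≠ 0 := fun z hz => (not_mem_exceptional_iff.1 hz).1
  have hr := differentiableOn_rhoHat (q₀ := q₀)
  fin_cases j <;> fin_cases i <;> simp [eigRow]
  · exact hr
  · exact (hr.mul_const _).fun_div hid hne
  · exact (hr.mul_const _).fun_div hid hne
  · exact hr.fun_div hid hne
  · exact (hr.mul_const _).div_const _
  · exact (hr.mul_const _).div_const _

/-- The spectral projections of `matX q₀ v z`. -/
def eigProj (q₀ : ℝ) (v : Vec2) (j : Fin 3) (z : ℂ) : (Fin 3 → ℂ) →L[ℂ] (Fin 3 → ℂ) :=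
  matCLM (Matrix.vecMulVec (eigCol q₀ v z j) (eigRow q₀ v z j))

theorem eigProj_apply (j : Fin 3) (u : Fin 3 → ℂ) :
    eigProj q₀ v j z u = (eigRow q₀ v z j ⬝ᵥ u) • eigCol q₀ v z j := by
  rw [eigProj, matCLM_apply]
  ext i
  simp [Matrix.mulVec, Matrix.vecMulVec, dotProduct, Fin.sum_univ_three]
  ring

theorem sum_eigProj_apply (hq : 0 < q₀) (hz : z ∉ exceptional q₀) (hv : ‖v‖ = q₀)
    (u : Fin 3 → ℂ) : ∑ j, eigProj q₀ v j z u = u := by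
  ext i
  have h := sum_eigCol_mul_eigRow hq hz hv i
  have h0 := h 0
  have h1 := h 1
  have h2 := h 2
  simp only [eigProj_apply, Fin.sum_univ_three, dotProduct, Pi.add_apply, Pi.smul_apply,
    smul_eq_mul] at *
  have : u i = (if i = 0 then 1 else 0) * u 0 + (if i = 1 then 1 else 0) * u 1
      + (if i = 2 then 1 else 0) * u 2 := by fin_cases i <;> simp
  rw [this]
  linear_combination u 0 * h0 + u 1 * h1 + u 2 * h2

theorem differentiableOn_eigProj (j : Fin 3) :
    DifferentiableOn ℂ (eigProj q₀ v j) (exceptional q₀)ᶜ :=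
  differentiableOn_matCLM fun i l => (differentiableOn_eigCol j i).mul (differentiableOn_eigRow j l)

theorem vec2_apply_norm_le (v : Vec2) (i : Fin 2) : ‖v i‖ ≤ ‖v‖ := PiLp.norm_apply_le v i

theorem four_mul_sq_le (hq : 0 < q₀) (hz : 2 * q₀ ≤ ‖z‖) : 3 * ‖z‖ ^ 2 ≤ 4 * ‖z ^ 2 - (q₀ : ℂ) ^ 2‖ := by
  have h1 : ‖z ^ 2‖ - ‖(q₀ : ℂ) ^ 2‖ ≤ ‖z ^ 2 - (q₀ : ℂ) ^ 2‖ := norm_sub_norm_le _ _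
  rw [norm_pow, norm_pow, Complex.norm_real, Real.norm_of_nonneg hq.le] at h1
  nlinarith

theorem not_mem_exceptional_of_le (hq : 0 < q₀) (hz : 2 * q₀ ≤ ‖z‖) : z ∉ exceptional q₀ := by
  have h0 : 0 < ‖z‖ := by linarith
  rw [not_mem_exceptional_iff]
  refine ⟨norm_pos_iff.1 h0, norm_pos_iff.1 ?_⟩
  have := four_mul_sq_le hq hz
  have : 0 < ‖z‖ ^ 2 := by positivity
  linarith

theorem norm_rhoHat_le (hq : 0 < q₀) (hz : 2 * q₀ ≤ ‖z‖) : ‖rhoHat q₀ z‖ ≤ 2 := by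
  have h0 : 0 < ‖z‖ := by linarith
  have h1 := four_mul_sq_le hq hz
  have h2 : 0 < ‖z‖ ^ 2 := by positivity
  rw [rhoHat, norm_div, norm_pow, div_le_iff₀ (by linarith)]
  linarith

theorem norm_rhoHat_sub_one_le (hq : 0 < q₀) (hz : 2 * q₀ ≤ ‖z‖) :
    ‖rhoHat q₀ z - 1‖ ≤ 2 * q₀ ^ 2 / ‖z‖ ^ 2 := by
  have h0 : 0 < ‖z‖ := by linarith
  have h1 := four_mul_sq_le hq hz
  have h2 : 0 < ‖z‖ ^ 2 := by positivity
  have h3 := (not_mem_exceptional_iff.1 (not_mem_exceptional_of_le hq hz)).2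
  have : rhoHat q₀ z - 1 = (q₀ : ℂ) ^ 2 / (z ^ 2 - (q₀ : ℂ) ^ 2) := by
    rw [rhoHat]
    field_simp
    ring
  rw [this, norm_div, norm_pow, Complex.norm_real, Real.norm_of_nonneg hq.le,
    div_le_div_iff₀ (norm_pos_iff.2 h3) h2]
  nlinarith [sq_nonneg q₀]

/-- The spectral projections are bounded uniformly for large `z`. -/
theorem norm_eigProj_le (hq : 0 < q₀) (hv : ‖v‖ = q₀) (hz : 2 * q₀ ≤ ‖z‖) (j : Fin 3) :
    ‖eigProj q₀ v j z‖ ≤ 18 := by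
  have h0 : 0 < ‖z‖ := by linarith
  have hr := norm_rhoHat_le hq hz
  have hqz : q₀ / ‖z‖ ≤ 1 := (div_le_one h0).2 (by linarith)
  have hv0 : ‖v 0‖ ≤ q₀ := hv ▸ vec2_apply_norm_le v 0
  have hv1 : ‖v 1‖ ≤ q₀ := hv ▸ vec2_apply_norm_le v 1
  -- Eigenvector and dual vector are bounded on reciprocal scales `s` and `2 / s`, so the entries of
  -- the projection are at most `2` whatever `q₀` is.
  have hcol : ∃ s : ℝ, 0 < s ∧ (∀ i, ‖eigCol q₀ v z j i‖ ≤ s) ∧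
      ∀ i, ‖eigRow q₀ v z j i‖ ≤ 2 / s := by
    fin_cases j
    · refine ⟨1, one_pos, fun i => ?_, fun i => ?_⟩ <;> fin_cases i <;> simp [eigCol, eigRow]
      · exact (div_le_one h0).2 (by linarith)
      · exact (div_le_one h0).2 (by linarith)
      · exact hr
      · rw [div_le_iff₀ h0]
        exact mul_le_mul hr (by linarith) (norm_nonneg _) (by norm_num)
      · rw [div_le_iff₀ h0]
        exact mul_le_mul hr (by linarith) (norm_nonneg _) (by norm_num)
    · refine ⟨q₀, hq, fun i => ?_, fun i => ?_⟩ <;> fin_cases i <;>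
        simp [eigCol, eigRow, perp_zero, perp_one, abs_of_pos hq]
      · exact hq.le
      · exact hv1
      · exact hv0
      · positivity
      · rw [div_le_div_iff₀ (by positivity) hq]
        nlinarith
      · rw [div_le_div_iff₀ (by positivity) hq]
        nlinarith
    · refine ⟨q₀, hq, fun i => ?_, fun i => ?_⟩ <;> fin_cases i <;>
        simp [eigCol, eigRow, abs_of_pos hq]
      · rw [div_le_iff₀ h0]
        nlinarith
      · exact hv0
      · exact hv1
      · rw [div_le_div_iff₀ h0 hq]
        exact mul_le_mul hr (by linarith) hq.le (by norm_num)
      · rw [div_le_div_iff₀ (by positivity) hq]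
        have := mul_le_mul hr hv0 (norm_nonneg _) (by norm_num)
        nlinarith
      · rw [div_le_div_iff₀ (by positivity) hq]
        have := mul_le_mul hr hv1 (norm_nonneg _) (by norm_num)
        nlinarith
  obtain ⟨s, hs, h1, h2⟩ := hcol
  refine (norm_matCLM_le (m := 2) fun i l => ?_).trans (by norm_num)
  rw [Matrix.vecMulVec_apply, norm_mul]
  calc _ ≤ s * (2 / s) := mul_le_mul (h1 i) (h2 l) (norm_nonneg _) hs.le
    _ = 2 := by field_simp

theorem im_inv_nonpos (hz : 0 ≤ z.im) : (z⁻¹).im ≤ 0 := by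
  rw [Complex.inv_im]
  exact div_nonpos_of_nonpos_of_nonneg (by linarith) (Complex.normSq_nonneg z)

/-- The differences of frequencies are `2λ`, `-q₀²/z` and `0`, all of nonnegative imaginary part in
the closed upper half-plane. This singles out the third column as the one that continues there from
`-∞`. -/
theorem re_I_mul_freq_sub_le (hz : 0 ≤ z.im) (j : Fin 3) :
    (I * (freq q₀ z j - freq q₀ z 2)).re ≤ 0 := by
  have h := im_inv_nonpos hz
  have h1 : ((q₀ : ℂ) ^ 2 / z).im = q₀ ^ 2 * (z⁻¹).im := by
    rw [div_eq_mul_inv, ← Complex.ofReal_pow, Complex.im_ofReal_mul]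
  have h2 : q₀ ^ 2 * (z⁻¹).im ≤ 0 := mul_nonpos_of_nonneg_of_nonpos (sq_nonneg _) h
  fin_cases j <;> simp [freq, kOf, lamOf] <;> rw [h1] <;> linarith

theorem freq_ofReal_im (z : ℝ) (j : Fin 3) : (freq q₀ (z : ℂ) j).im = 0 := by
  have : ((q₀ : ℂ) ^ 2 / (z : ℂ)).im = 0 := by
    rw [← Complex.ofReal_pow, ← Complex.ofReal_div, Complex.ofReal_im]
  fin_cases j <;> simp [freq, kOf, lamOf, this]

end SpectralData

/-! ### The columns normalized at `-∞` -/

section LeftSolution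

/-- A potential with the regularity and decay needed for the Jost solutions normalized at `-∞`. -/
structure LeftPotential (q₀ : ℝ) (q : ℝ → Vec2) (v : Vec2) : Prop where
  pos : 0 < q₀
  norm_eq : ‖v‖ = q₀
  tendsto : Tendsto q atBot (𝓝 v)
  bdd : ∃ R, ∀ x, ‖q x‖ ≤ R
  integrableOn : IntegrableOn (fun x => (1 + |x|) • (q x - v)) (Set.Iic 0)
  diff : Differentiable ℝ q
  deriv_integrableOn : IntegrableOn (deriv q) (Set.Iic 0)

/-- The perturbation `i (Q(q(x)) - Q(v))` as an operator. -/
def potPerturb (q : ℝ → Vec2) (v : Vec2) (x : ℝ) : (Fin 3 → ℂ) →L[ℂ] (Fin 3 → ℂ) :=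
  matCLM (I • matQ (q x) - I • matQ v)

/-- The solution `w` of `w' = (X - i freq j₀) w` that tends to the `j₀`-th eigenvector
at `-∞`. -/
def leftSol (q₀ : ℝ) (q : ℝ → Vec2) (v : Vec2) (j₀ : Fin 3) (z : ℂ) (x : ℝ) : Fin 3 → ℂ :=
  volterraSol (fun j => I * (freq q₀ z j - freq q₀ z j₀)) (fun j => eigProj q₀ v j z)
    (potPerturb q v) (eigCol q₀ v z j₀) x

variable {q₀ : ℝ} {q : ℝ → Vec2} {v : Vec2} {z : ℂ} {j₀ : Fin 3}

theorem norm_potPerturb_le (x : ℝ) : ‖potPerturb q v x‖ ≤ 9 * ‖q x - v‖ := by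
  have h0 := vec2_apply_norm_le (q x - v) 0
  have h1 := vec2_apply_norm_le (q x - v) 1
  simp only [PiLp.sub_apply] at h0 h1
  have h2 : ‖star (v 0) - star (q x 0)‖ ≤ ‖q x - v‖ := by
    rwa [← star_sub, norm_star, norm_sub_rev]
  have h3 : ‖star (v 1) - star (q x 1)‖ ≤ ‖q x - v‖ := by
    rwa [← star_sub, norm_star, norm_sub_rev]
  refine norm_matCLM_le fun i j => ?_
  rw [Matrix.sub_apply, Matrix.smul_apply, Matrix.smul_apply, ← smul_sub, norm_smul, norm_I, one_mul]
  fin_cases i <;> fin_cases j <;> simp [matQ] <;> first | exact h0 | exact h1 | skip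
  · simpa [add_comm, sub_eq_add_neg] using h2
  · simpa [add_comm, sub_eq_add_neg] using h3

theorem integrableOn_Iic_of_continuous {F : Type*} [NormedAddCommGroup F] {f : ℝ → F}
    (hf : Continuous f) (h0 : IntegrableOn f (Set.Iic 0)) (x : ℝ) :
    IntegrableOn f (Set.Iic x) := by
  refine (h0.union (hf.integrableOn_Icc (a := 0) (b := x))).mono_set fun y hy => ?_
  rcases le_total y 0 with h | h
  · exact Or.inl h
  · exact Or.inr ⟨h, hy⟩

/-- Local uniformity of the spectral data around a point that is not exceptional. -/
theorem exists_nhds_bound (hz : z ∉ exceptional q₀) (j₀ : Fin 3) : ∃ U : Set ℂ, IsOpen U ∧ z ∈ U ∧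
    U ⊆ (exceptional q₀)ᶜ ∧ (∃ M, ∀ w ∈ U, ∑ j, ‖eigProj q₀ v j w‖ ≤ M) ∧
    ∃ K, ∀ w ∈ U, ‖eigCol q₀ v w j₀‖ ≤ K := by
  have ho : IsOpen (exceptional q₀)ᶜ := by
    refine IsClosed.isOpen_compl (self := Set.Finite.isClosed ?_)
    simp [exceptional]
  have hzn := ho.mem_nhds hz
  have h1 : ContinuousAt (fun w => ∑ j, ‖eigProj q₀ v j w‖) z :=
    tendsto_finsetSum _ fun j _ =>
      ((differentiableOn_eigProj j).continuousOn.continuousAt hzn).norm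
  have h2 : ContinuousAt (fun w => ‖eigCol q₀ v w j₀‖) z := by
    refine ContinuousAt.norm (continuousAt_pi.2 fun i => ?_)
    exact (differentiableOn_eigCol j₀ i).continuousOn.continuousAt hzn
  have h3 := (h1.eventually_lt continuousAt_const (lt_add_one _)).and
    ((h2.eventually_lt continuousAt_const (lt_add_one _)).and hzn)
  obtain ⟨U, hU, hUo, hzU⟩ := mem_nhds_iff.1 h3
  exact ⟨U, hUo, hzU, fun w hw => (hU hw).2.2, ⟨_, fun w hw => (hU hw).1.le⟩,
    ⟨_, fun w hw => (hU hw).2.1.le⟩⟩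

namespace LeftPotential

theorem continuous (h : LeftPotential q₀ q v) : Continuous q := h.diff.continuous

theorem integrableOn_sub (h : LeftPotential q₀ q v) : IntegrableOn (fun x => q x - v) (Set.Iic 0) := by
  refine Integrable.mono h.integrableOn
    (h.continuous.sub continuous_const).aestronglyMeasurable (Eventually.of_forall fun x => ?_)
  rw [norm_smul, Real.norm_of_nonneg (by positivity)]
  nlinarith [abs_nonneg x, norm_nonneg (q x - v)]

theorem continuous_potPerturb (h : LeftPotential q₀ q v) : Continuous (potPerturb q v) := by
  rw [← continuousOn_univ]
  have h0 := h.continuous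
  have h1 : Continuous fun x => q x 0 := by fun_prop
  have h2 : Continuous fun x => q x 1 := by fun_prop
  refine continuousOn_matCLM fun i j => Continuous.continuousOn ?_
  fin_cases i <;> fin_cases j <;> simp [matQ] <;> fun_prop

theorem integrableOn_potPerturb (h : LeftPotential q₀ q v) (x : ℝ) :
    IntegrableOn (fun y => ‖potPerturb q v y‖) (Set.Iic x) := by
  refine integrableOn_Iic_of_continuous h.continuous_potPerturb.norm ?_ x
  refine Integrable.mono' (h.integrableOn_sub.norm.const_mul 9)
    h.continuous_potPerturb.norm.aestronglyMeasurable (Eventually.of_forall fun y => ?_)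
  rw [norm_norm]
  exact norm_potPerturb_le y

theorem exists_norm_potPerturb_le (h : LeftPotential q₀ q v) : ∃ R, ∀ x, ‖potPerturb q v x‖ ≤ R := by
  obtain ⟨R, hR⟩ := h.bdd
  refine ⟨9 * (R + ‖v‖), fun x => (norm_potPerturb_le x).trans ?_⟩
  gcongr
  exact (norm_sub_le _ _).trans (by gcongr; exact hR x)

theorem tendsto_leftSol (h : LeftPotential q₀ q v) (hc : ∀ j, (I * (freq q₀ z j - freq q₀ z j₀)).re ≤ 0) :
    Tendsto (leftSol q₀ q v j₀ z) atBot (𝓝 (eigCol q₀ v z j₀)) :=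
  tendsto_volterraSol le_rfl h.continuous_potPerturb h.integrableOn_potPerturb hc

theorem norm_leftSol_le (h : LeftPotential q₀ q v) {M : ℝ} (hM : ∑ j, ‖eigProj q₀ v j z‖ ≤ M)
    (hc : ∀ j, (I * (freq q₀ z j - freq q₀ z j₀)).re ≤ 0) {x y : ℝ} (hxy : x ≤ y) :
    ‖leftSol q₀ q v j₀ z x‖
      ≤ ‖eigCol q₀ v z j₀‖ * Real.exp (2 * M * cumNorm (potPerturb q v) y) := by
  have hM0 : 0 ≤ M := (Finset.sum_nonneg fun _ _ => norm_nonneg _).trans hM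
  have h1 := norm_volterraSol_sub_le (a := eigCol q₀ v z j₀) hM h.continuous_potPerturb
    h.integrableOn_potPerturb hc x
  have h2 := norm_le_insert' (leftSol q₀ q v j₀ z x) (eigCol q₀ v z j₀)
  have h3 : Real.exp (2 * M * cumNorm (potPerturb q v) x)
      ≤ Real.exp (2 * M * cumNorm (potPerturb q v) y) := by
    gcongr
    exact monotone_cumNorm h.integrableOn_potPerturb hxy
  have h4 := mul_le_mul_of_nonneg_left h3 (norm_nonneg (eigCol q₀ v z j₀))
  change ‖leftSol q₀ q v j₀ z x - _‖ ≤ _ at h1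
  linarith

theorem hasDerivAt_leftSol (h : LeftPotential q₀ q v) (hz : z ∉ exceptional q₀)
    (hc : ∀ j, (I * (freq q₀ z j - freq q₀ z j₀)).re ≤ 0) (x : ℝ) :
    HasDerivAt (leftSol q₀ q v j₀ z) ((matX q₀ (q x) z).mulVec (leftSol q₀ q v j₀ z x)
      - (I * freq q₀ z j₀) • leftSol q₀ q v j₀ z x) x := by
  have hz0 := (not_mem_exceptional_iff.1 hz).1
  have hA : ∀ u, (matCLM (matX q₀ v z) - (I * freq q₀ z j₀) • ContinuousLinearMap.id ℂ (Fin 3 → ℂ)) u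
      = (matX q₀ v z).mulVec u - (I * freq q₀ z j₀) • u := fun u => by
    simp [matCLM_apply]
  have hd := hasDerivAt_volterraSol (a := eigCol q₀ v z j₀)
    (A := matCLM (matX q₀ v z) - (I * freq q₀ z j₀) • ContinuousLinearMap.id ℂ (Fin 3 → ℂ))
    (le_refl (∑ j, ‖eigProj q₀ v j z‖)) h.continuous_potPerturb h.integrableOn_potPerturb hc
    (fun j u => by
      rw [hA, eigProj_apply, Matrix.mulVec_smul, eigCol_eigen hz0 h.norm_eq]
      module)
    (sum_eigProj_apply h.pos hz h.norm_eq)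
    (by rw [hA, eigCol_eigen hz0 h.norm_eq, sub_self]) h.exists_norm_potPerturb_le x
  refine hd.congr_deriv ?_
  change (_ : (Fin 3 → ℂ) →L[ℂ] (Fin 3 → ℂ)) (leftSol q₀ q v j₀ z x)
    + potPerturb q v x (leftSol q₀ q v j₀ z x) = _
  rw [hA, potPerturb, matCLM_apply, matX, matX, Matrix.sub_mulVec, Matrix.add_mulVec,
    Matrix.add_mulVec]
  abel

/-- Continuity is local: near a point that is not exceptional the projections and the initial vector
are bounded, and the Volterra theorem applies to the trace of a small neighbourhood on the closed
half-plane. -/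
theorem continuousOn_leftSol (h : LeftPotential q₀ q v) (x : ℝ) :
    ContinuousOn (fun z => leftSol q₀ q v 2 z x) ({z : ℂ | 0 ≤ z.im} \ exceptional q₀) := by
  rintro z ⟨hz, hze⟩
  obtain ⟨U, hUo, hzU, hUe, ⟨M, hM⟩, K, hK⟩ := exists_nhds_bound (v := v) hze 2
  have hd := fun j => (differentiableOn_freq (q₀ := q₀) j).continuousOn
  have := continuousOn_volterraSol (U := {z : ℂ | 0 ≤ z.im} ∩ U)
    (c := fun j z => I * (freq q₀ z j - freq q₀ z 2)) (P := eigProj q₀ v)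
    (a := fun z => eigCol q₀ v z 2) (fun w hw => hM w hw.2)
    h.continuous_potPerturb h.integrableOn_potPerturb (fun w hw => re_I_mul_freq_sub_le hw.1)
    (fun w hw => hK w hw.2)
    (fun j => ContinuousOn.mono (continuousOn_const.mul ((hd j).sub (hd 2)))
      (Set.inter_subset_right.trans hUe))
    (fun j => (differentiableOn_eigProj j).continuousOn.mono (Set.inter_subset_right.trans hUe))
    (continuousOn_pi.2 fun i => (differentiableOn_eigCol 2 i).continuousOn.mono
      (Set.inter_subset_right.trans hUe)) x
  refine (this z ⟨hz, hzU⟩).mono_of_mem_nhdsWithin ?_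
  filter_upwards [self_mem_nhdsWithin, mem_nhdsWithin_of_mem_nhds (hUo.mem_nhds hzU)] with w h1 h2
  exact ⟨h1.1, h2⟩

theorem differentiableOn_leftSol (h : LeftPotential q₀ q v) (x : ℝ) :
    DifferentiableOn ℂ (fun z => leftSol q₀ q v 2 z x) {z : ℂ | 0 < z.im} := by
  intro z hz
  have hze : z ∉ exceptional q₀ := by
    have hz' : z.im ≠ 0 := (Set.mem_ofPred.1 hz).ne'
    rintro (rfl | rfl | rfl) <;> simp at hz'
  obtain ⟨U, hUo, hzU, hUe, ⟨M, hM⟩, K, hK⟩ := exists_nhds_bound (v := v) hze 2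
  have ho : IsOpen ({z : ℂ | 0 < z.im} ∩ U) :=
    (isOpen_lt continuous_const Complex.continuous_im).inter hUo
  have hd := differentiableOn_freq (q₀ := q₀)
  have := differentiableOn_volterraSol ho
    (c := fun j z => I * (freq q₀ z j - freq q₀ z 2)) (P := eigProj q₀ v)
    (a := fun z => eigCol q₀ v z 2) (fun w hw => hM w hw.2)
    h.continuous_potPerturb h.integrableOn_potPerturb
    (fun w hw => re_I_mul_freq_sub_le (Set.mem_ofPred.1 hw.1).le)
    (fun w hw => hK w hw.2)
    (fun j => DifferentiableOn.mono (((hd j).sub (hd 2)).const_mul I)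
      (Set.inter_subset_right.trans hUe))
    (fun j => (differentiableOn_eigProj j).mono (Set.inter_subset_right.trans hUe))
    (differentiableOn_pi.2 fun i => (differentiableOn_eigCol 2 i).mono
      (Set.inter_subset_right.trans hUe)) x
  exact (this.differentiableAt (ho.mem_nhds ⟨hz, hzU⟩)).differentiableWithinAt

end LeftPotential

end LeftSolution

/-! ### Large `z`: the fast and slow combinations of a column -/

section Asymptotics

/-- A solution of a damped scalar equation that vanishes at `-∞` is bounded by the `L¹` norm of the
forcing term. -/
theorem norm_le_integral_of_damped {f h : ℝ → ℂ} {b : ℝ → ℝ} {c : ℂ} (hc : c.re ≤ 0)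
    (hd : ∀ x, HasDerivAt f (c * f x + h x) x) (hf : Tendsto f atBot (𝓝 0))
    (hb : ∀ x ≤ 0, ‖h x‖ ≤ b x) (hbi : IntegrableOn b (Set.Iic 0)) {x : ℝ} (hx : x ≤ 0) :
    ‖f x‖ ≤ ∫ y in Set.Iic 0, b y := by
  have hcont : Continuous f := continuous_iff_continuousAt.2 fun x => (hd x).continuousAt
  -- The forcing may contain `q_x` and need not be continuous; it is measurable because the equation
  -- expresses it through a derivative.
  have hmeas : Measurable h := by
    have : h = fun x => deriv f x - c * f x := by
      ext x
      rw [(hd x).deriv]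
      ring
    rw [this]
    exact (measurable_deriv f).sub (hcont.measurable.const_mul c)
  have hFd : ∀ y ∈ Set.Iic x, HasDerivAt (fun y : ℝ => Complex.exp (c * (x - y)) * f y)
      (Complex.exp (c * (x - y)) * h y) y := fun y _ => by
    have h1 : HasDerivAt (fun y : ℝ => Complex.exp (c * (x - y)))
        (Complex.exp (c * (x - y)) * (c * (-1))) y := by
      have := (((hasDerivAt_id y).ofReal_comp.const_sub (x : ℂ)).const_mul c).cexp
      simpa using this
    exact (h1.mul (hd y)).congr_deriv (by ring)
  have hle : ∀ y ∈ Set.Iic x, ‖Complex.exp (c * (x - y)) * h y‖ ≤ b y := fun y hy => by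
    rw [norm_mul]
    exact (mul_le_of_le_one_left (norm_nonneg _) (norm_exp_mul_sub_le_one hc hy)).trans
      (hb y (le_trans hy hx))
  have hbx : IntegrableOn b (Set.Iic x) := hbi.mono_set (Set.Iic_subset_Iic.2 hx)
  have hle' := (ae_restrict_iff' (μ := volume) (measurableSet_Iic (a := x))).2
    (Eventually.of_forall hle)
  have hlim : Tendsto (fun y : ℝ => Complex.exp (c * (x - y)) * f y) atBot (𝓝 0) := by
    refine squeeze_zero_norm' ?_ (tendsto_zero_iff_norm_tendsto_zero.1 hf)
    filter_upwards [eventually_le_atBot x] with y hy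
    rw [norm_mul]
    exact mul_le_of_le_one_left (norm_nonneg _) (norm_exp_mul_sub_le_one hc hy)
  have hint := integral_Iic_of_hasDerivAt_of_tendsto' hFd
    (Integrable.mono' hbx (by fun_prop) hle') hlim
  rw [sub_self, mul_zero, Complex.exp_zero, one_mul, sub_zero] at hint
  rw [← hint]
  refine (norm_integral_le_of_norm_le hbx hle').trans ?_
  refine setIntegral_mono_set hbi ?_ (Set.Iic_subset_Iic.2 hx).eventuallyLE
  exact (ae_restrict_iff' measurableSet_Iic).2 (Eventually.of_forall fun y hy =>
    (norm_nonneg _).trans (hb y hy))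

/-- A scaled column `(w₀, u)` of a solution of the scattering problem, bounded on the left
half-line; the scaling factor has exponent `i (k - ε) x`. -/
structure ReducedColumn (q₀ : ℝ) (q : ℝ → Vec2) (K : ℝ) (z ε : ℂ) (w₀ : ℝ → ℂ) (u : ℝ → Vec2) :
    Prop where
  one_le : 1 ≤ ‖z‖
  w_deriv : ∀ x, HasDerivAt w₀ (I * (2 * kOf q₀ z - ε) * w₀ x - I * inner ℂ (q x) (u x)) x
  u_deriv : ∀ x, HasDerivAt u ((I * w₀ x) • q x - (I * ε) • u x) x
  w_le : ∀ x ≤ 0, ‖w₀ x‖ ≤ K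
  u_le : ∀ x ≤ 0, ‖u x‖ ≤ K

variable {q₀ K : ℝ} {q : ℝ → Vec2} {v p : Vec2} {z ε : ℂ} {w₀ : ℝ → ℂ} {u : ℝ → Vec2}

namespace ReducedColumn

theorem ne_zero (hR : ReducedColumn q₀ q K z ε w₀ u) : z ≠ 0 :=
  norm_pos_iff.1 (one_pos.trans_le hR.one_le)

theorem hasDerivAt_inner_const (hR : ReducedColumn q₀ q K z ε w₀ u) (p : Vec2) (x : ℝ) :
    HasDerivAt (fun x => inner ℂ p (u x))
      (I * w₀ x * inner ℂ p (q x) - I * ε * inner ℂ p (u x)) x := by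
  refine ((hasDerivAt_const x p).inner ℂ (hR.u_deriv x)).congr_deriv ?_
  simp only [inner_sub_right, inner_smul_right, inner_zero_left, add_zero]

theorem hasDerivAt_inner (hR : ReducedColumn q₀ q K z ε w₀ u) (hq : Differentiable ℝ q) (x : ℝ) :
    HasDerivAt (fun x => inner ℂ (q x) (u x))
      (I * w₀ x * inner ℂ (q x) (q x) - I * ε * inner ℂ (q x) (u x)
        + inner ℂ (deriv q x) (u x)) x := by
  refine ((hq x).hasDerivAt.inner ℂ (hR.u_deriv x)).congr_deriv ?_
  simp only [inner_sub_right, inner_smul_right]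

/-- The identity `2kz = z² + q₀²` leaves the large frequency `z - ε`. The forcing involves `q₀² -
‖q‖²` and `q_x`, both integrable on the left half-line, with no explicit factor of `z`. -/
theorem hasDerivAt_fast (hR : ReducedColumn q₀ q K z ε w₀ u) (hq : Differentiable ℝ q) (x : ℝ) :
    HasDerivAt (fun x => z * w₀ x - inner ℂ (q x) (u x))
      (I * (z - ε) * (z * w₀ x - inner ℂ (q x) (u x))
        + (I * ((q₀ : ℂ) ^ 2 - inner ℂ (q x) (q x)) * w₀ x - inner ℂ (deriv q x) (u x))) x := by
  have hz := hR.ne_zero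
  refine (((hR.w_deriv x).const_mul z).sub (hR.hasDerivAt_inner hq x)).congr_deriv ?_
  have hk : 2 * kOf q₀ z * z = z ^ 2 + (q₀ : ℂ) ^ 2 := by
    rw [kOf]
    field_simp
  linear_combination (I * w₀ x) * hk

/-- This combination carries the other frequency `q₀²/z - ε`. Each forcing term contains `1/z` or
`w₀`, hence is `O(1/z)` once `w₀` is. -/
theorem hasDerivAt_slow (hR : ReducedColumn q₀ q K z ε w₀ u) (hv : inner ℂ v v = (q₀ : ℂ) ^ 2)
    (x : ℝ) :
    HasDerivAt (fun x => (q₀ : ℂ) ^ 2 / z * w₀ x - inner ℂ v (u x))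
      (I * ((q₀ : ℂ) ^ 2 / z - ε) * ((q₀ : ℂ) ^ 2 / z * w₀ x - inner ℂ v (u x))
        + (-(I * ((q₀ : ℂ) ^ 2 / z) * inner ℂ (q x - v) (u x))
          - I * inner ℂ v (q x - v) * w₀ x)) x := by
  have hz := hR.ne_zero
  refine (((hR.w_deriv x).const_mul ((q₀ : ℂ) ^ 2 / z)).sub
    (hR.hasDerivAt_inner_const v x)).congr_deriv ?_
  have hk : 2 * kOf q₀ z = z + (q₀ : ℂ) ^ 2 / z := by
    rw [kOf]
    ring
  have hz2 : (q₀ : ℂ) ^ 2 / z * z = (q₀ : ℂ) ^ 2 := by field_simp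
  rw [inner_sub_left, inner_sub_right, hv, hk]
  linear_combination (I * w₀ x) * hz2

end ReducedColumn

namespace LeftPotential

theorem inner_self (h : LeftPotential q₀ q v) : inner ℂ v v = (q₀ : ℂ) ^ 2 := by
  rw [inner_self_eq_norm_sq_to_K, h.norm_eq]
  rfl

theorem norm_sq_sub_le (h : LeftPotential q₀ q v) {R : ℝ} (hR : ∀ x, ‖q x‖ ≤ R) (x : ℝ) :
    ‖(q₀ : ℂ) ^ 2 - inner ℂ (q x) (q x)‖ ≤ (R + q₀) * ‖q x - v‖ := by
  have e : (q₀ : ℂ) ^ 2 - inner ℂ (q x) (q x)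
      = -(inner ℂ (q x) (q x - v) + inner ℂ (q x - v) v) := by
    rw [inner_sub_right, inner_sub_left, ← h.inner_self]
    ring
  rw [e, norm_neg]
  refine (norm_add_le _ _).trans ?_
  have h1 := norm_inner_le_norm (𝕜 := ℂ) (q x) (q x - v)
  have h2 := norm_inner_le_norm (𝕜 := ℂ) (q x - v) v
  rw [h.norm_eq] at h2
  nlinarith [hR x, norm_nonneg (q x - v)]

/-- Leading behaviour for large `z` of a bounded reduced column with prescribed limits. -/
theorem exists_reducedColumn_bound (h : LeftPotential q₀ q v) (hK : 0 ≤ K) :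
    ∃ C, 0 ≤ C ∧ ∀ (z ε : ℂ) (w₀ : ℝ → ℂ) (u : ℝ → Vec2) (r : ℂ), ReducedColumn q₀ q K z ε w₀ u →
      (I * (z - ε)).re ≤ 0 → (I * ((q₀ : ℂ) ^ 2 / z - ε)).re ≤ 0 → ((q₀ : ℂ) ^ 2 / z - ε) * r = 0 →
      Tendsto (fun x => z * w₀ x - inner ℂ (q x) (u x)) atBot (𝓝 0) →
      Tendsto (fun x => (q₀ : ℂ) ^ 2 / z * w₀ x - inner ℂ v (u x)) atBot (𝓝 r) →
      ∀ x ≤ 0, ‖z * w₀ x - inner ℂ (q x) (u x)‖ ≤ C ∧ ‖w₀ x‖ ≤ C / ‖z‖ ∧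
        ‖inner ℂ v (u x) + r‖ ≤ C / ‖z‖ := by
  obtain ⟨R, hRb⟩ := h.bdd
  have hq := h.pos
  have hR0 : 0 ≤ R := (norm_nonneg _).trans (hRb 0)
  have hbi := h.integrableOn_sub.norm
  have hdi := h.deriv_integrableOn.norm
  -- `G` and `L` integrate majorants of the fast and slow forcing; the factor `1 / ‖z‖` is left out
  -- of `L`.
  set G := ∫ y in Set.Iic 0, ((R + q₀) * K) * ‖q y - v‖ + K * ‖deriv q y‖ with hG
  set L := ∫ y in Set.Iic 0, (q₀ ^ 2 * K + q₀ * (|G| + R * K)) * ‖q y - v‖ with hL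
  refine ⟨|G| + R * K + |L| + q₀ ^ 2 * K, by positivity, ?_⟩
  intro z ε w₀ u r hR hre1 hre2 hr hlim1 hlim2
  have hz1 := hR.one_le
  have hz0 : 0 < ‖z‖ := by linarith
  have hg : ∀ x ≤ 0, ‖z * w₀ x - inner ℂ (q x) (u x)‖ ≤ |G| := fun x hx => by
    refine (norm_le_integral_of_damped hre1 (hR.hasDerivAt_fast h.diff) hlim1 (fun y hy => ?_)
      ((hbi.const_mul _).add (hdi.const_mul _)) hx).trans (le_abs_self G)
    refine (norm_sub_le _ _).trans (add_le_add ?_ ?_)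
    · rw [norm_mul, norm_mul, norm_I, one_mul]
      calc _ ≤ ((R + q₀) * ‖q y - v‖) * K :=
            mul_le_mul (h.norm_sq_sub_le hRb y) (hR.w_le y hy) (norm_nonneg _) (by positivity)
        _ = _ := by ring
    · refine (norm_inner_le_norm _ _).trans ?_
      rw [mul_comm]
      exact mul_le_mul_of_nonneg_right (hR.u_le y hy) (norm_nonneg _)
  have hw : ∀ x ≤ 0, ‖w₀ x‖ ≤ (|G| + R * K) / ‖z‖ := fun x hx => by
    rw [le_div_iff₀ hz0, mul_comm, ← norm_mul]
    have e : z * w₀ x = (z * w₀ x - inner ℂ (q x) (u x)) + inner ℂ (q x) (u x) := by ring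
    rw [e]
    refine (norm_add_le _ _).trans (add_le_add (hg x hx) ((norm_inner_le_norm _ _).trans ?_))
    exact mul_le_mul (hRb x) (hR.u_le x hx) (norm_nonneg _) hR0
  -- Subtracting the limit `r` leaves the equation unchanged since `(q₀²/z - ε) r = 0`.
  have hs : ∀ x ≤ 0, ‖(q₀ : ℂ) ^ 2 / z * w₀ x - inner ℂ v (u x) - r‖ ≤ |L| / ‖z‖ := fun x hx => by
    have hlim3 : Tendsto (fun x => (q₀ : ℂ) ^ 2 / z * w₀ x - inner ℂ v (u x) - r) atBot (𝓝 0) := by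
      simpa using hlim2.sub_const r
    have hqz : ‖(q₀ : ℂ) ^ 2 / z‖ = q₀ ^ 2 / ‖z‖ := by
      rw [norm_div, norm_pow, Complex.norm_real, Real.norm_of_nonneg hq.le]
    have key := norm_le_integral_of_damped (f := fun x => (q₀ : ℂ) ^ 2 / z * w₀ x - inner ℂ v (u x) - r)
      (h := fun x => -(I * ((q₀ : ℂ) ^ 2 / z) * inner ℂ (q x - v) (u x))
          - I * inner ℂ v (q x - v) * w₀ x)
      (b := fun y => (q₀ ^ 2 * K + q₀ * (|G| + R * K)) * ‖q y - v‖ / ‖z‖) hre2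
      (fun y => ((hR.hasDerivAt_slow h.inner_self y).sub_const r).congr_deriv (by
        linear_combination I * hr)) hlim3 (fun y hy => ?_)
      ((hbi.const_mul _).div_const _) hx
    · rw [integral_div] at key
      exact key.trans (by gcongr; exact le_abs_self L)
    · refine (norm_sub_le _ _).trans ?_
      rw [norm_neg, norm_mul, norm_mul, norm_mul, norm_mul, norm_I, one_mul, one_mul, hqz]
      have h1 : ‖(inner ℂ (q y - v) (u y) : ℂ)‖ ≤ ‖q y - v‖ * K :=
        (norm_inner_le_norm _ _).trans (by gcongr; exact hR.u_le y hy)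
      have h2 : ‖(inner ℂ v (q y - v) : ℂ)‖ ≤ q₀ * ‖q y - v‖ :=
        (norm_inner_le_norm _ _).trans (by rw [h.norm_eq])
      calc _ ≤ q₀ ^ 2 / ‖z‖ * (‖q y - v‖ * K) + (q₀ * ‖q y - v‖) * ((|G| + R * K) / ‖z‖) := by
            gcongr
            exact hw y hy
        _ = _ := by ring
  intro x hx
  have hLK : 0 ≤ q₀ ^ 2 * K := by positivity
  have hRK : 0 ≤ R * K := by positivity
  refine ⟨(hg x hx).trans (by linarith [abs_nonneg L]), (hw x hx).trans ?_, ?_⟩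
  · exact div_le_div_of_nonneg_right (by linarith [abs_nonneg L]) hz0.le
  · have e : inner ℂ v (u x) + r = (q₀ : ℂ) ^ 2 / z * w₀ x
        - ((q₀ : ℂ) ^ 2 / z * w₀ x - inner ℂ v (u x) - r) := by ring
    rw [e]
    refine (norm_sub_le _ _).trans ?_
    have : ‖(q₀ : ℂ) ^ 2 / z * w₀ x‖ ≤ q₀ ^ 2 * K / ‖z‖ := by
      rw [norm_mul, norm_div, norm_pow, Complex.norm_real, Real.norm_of_nonneg hq.le, div_mul_eq_mul_div]
      gcongr
      exact hR.w_le x hx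
    refine (add_le_add this (hs x hx)).trans ?_
    rw [← add_div]
    exact div_le_div_of_nonneg_right (by linarith [abs_nonneg G]) hz0.le

end LeftPotential

end Asymptotics

/-! ### Large `z`: the component orthogonal to the boundary vector -/

section TransverseAsymptotics

variable {q₀ K : ℝ} {q : ℝ → Vec2} {v p : Vec2} {z ε : ℂ} {w₀ : ℝ → ℂ} {u : ℝ → Vec2}

/-- On the left half-plane the exponential is bounded by one, which extends the local estimate to
all `‖w‖`. It controls the slow phase linearly in `|x| / ‖z‖`. -/
theorem norm_exp_sub_one_le_of_re_nonpos {w : ℂ} (hw : w.re ≤ 0) :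
    ‖Complex.exp w - 1‖ ≤ 2 * ‖w‖ := by
  rcases le_total ‖w‖ 1 with h | h
  · exact Complex.norm_exp_sub_one_le h
  · refine (norm_sub_le _ _).trans ?_
    have : ‖Complex.exp w‖ ≤ 1 := by
      rw [Complex.norm_exp]
      exact Real.exp_le_one_iff.2 hw
    rw [norm_one]
    linarith

theorem re_I_mul_sq_div_nonneg (q₀ : ℝ) (hz : 0 ≤ z.im) : 0 ≤ (I * ((q₀ : ℂ) ^ 2 / z)).re := by
  have h := im_inv_nonpos hz
  rw [div_eq_mul_inv, ← Complex.ofReal_pow, Complex.I_mul_re, Complex.im_ofReal_mul]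
  nlinarith [sq_nonneg q₀]

namespace LeftPotential

/-- The dominating function of the transverse remainder. -/
theorem integrableOn_dominating (h : LeftPotential q₀ q v) (a b : ℝ) :
    IntegrableOn (fun x => a * ((1 + |x|) * ‖q x - v‖) + b * ‖deriv q x‖) (Set.Iic 0) := by
  refine Integrable.add (Integrable.const_mul ?_ _) (h.deriv_integrableOn.norm.const_mul _)
  refine h.integrableOn.norm.congr (Eventually.of_forall fun x => ?_)
  simp only [norm_smul]
  rw [Real.norm_of_nonneg (by positivity)]

/-- The derivative of the corrected transverse component of a reduced column. -/
theorem hasDerivAt_transverse (h : LeftPotential q₀ q v)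
    (hR : ReducedColumn q₀ q K z ((q₀ : ℂ) ^ 2 / z) w₀ u) (hm : z ^ 2 - (q₀ : ℂ) ^ 2 ≠ 0) (x : ℝ) :
    HasDerivAt (fun x : ℝ => Complex.exp (I * ((q₀ : ℂ) ^ 2 / z) * x) * (inner ℂ p (u x)
        - inner ℂ p (q x) * (z * w₀ x - inner ℂ (q x) (u x)) / (z ^ 2 - (q₀ : ℂ) ^ 2)))
      (Complex.exp (I * ((q₀ : ℂ) ^ 2 / z) * x) * (
        I / z * inner ℂ p (q x) * inner ℂ (q x) (u x)
        - (I * ((q₀ : ℂ) ^ 2 / z) * inner ℂ p (q x) * (z * w₀ x - inner ℂ (q x) (u x))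
          + inner ℂ p (deriv q x) * (z * w₀ x - inner ℂ (q x) (u x))
          + inner ℂ p (q x) * (I * ((q₀ : ℂ) ^ 2 - inner ℂ (q x) (q x)) * w₀ x
            - inner ℂ (deriv q x) (u x))) / (z ^ 2 - (q₀ : ℂ) ^ 2))) x := by
  have hz := hR.ne_zero
  have hE : HasDerivAt (fun x : ℝ => Complex.exp (I * ((q₀ : ℂ) ^ 2 / z) * x))
      (Complex.exp (I * ((q₀ : ℂ) ^ 2 / z) * x) * (I * ((q₀ : ℂ) ^ 2 / z))) x := by
    have := ((hasDerivAt_id x).ofReal_comp.const_mul (I * ((q₀ : ℂ) ^ 2 / z))).cexp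
    simpa using this
  have hpq : HasDerivAt (fun x => inner ℂ p (q x)) (inner ℂ p (deriv q x)) x := by
    refine ((hasDerivAt_const x p).inner ℂ (h.diff x).hasDerivAt).congr_deriv ?_
    simp
  -- The subtracted quotient is the boundary term of an integration by parts. Since `z (z - q₀²/z) =
  -- z² - q₀²`, its fast oscillation cancels the term `(i/z) (p†q) (z w₀ - q†u)`, which alone would
  -- only be `O(1/z)`.
  have hF := hE.mul ((hR.hasDerivAt_inner_const p x).sub
    ((hpq.mul (hR.hasDerivAt_fast h.diff x)).div_const (z ^ 2 - (q₀ : ℂ) ^ 2)))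
  refine hF.congr_deriv ?_
  simp only [Pi.sub_apply, Pi.mul_apply]
  field_simp
  ring

-- The corrected component of `hasDerivAt_transverse` is integrated over the half-line. In the main
-- term `u` may be replaced by `v` at the cost of `O(1/z)`, and the exponential by `1` at the cost
-- of `O(|x|/z)`; the factor `1/z` in front makes both errors second order. The hypothesis `hpars`
-- is Parseval's identity in the orthogonal basis `v, p`.
set_option maxHeartbeats 400000 in
theorem exists_transverse_bound (h : LeftPotential q₀ q v) (hK : 0 ≤ K) (hp : inner ℂ p v = 0)
    (hpars : ∀ y : Vec2, q₀ ^ 2 * ‖y‖ ^ 2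
      = ‖(inner ℂ v y : ℂ)‖ ^ 2 + ‖(inner ℂ p y : ℂ)‖ ^ 2) :
    ∃ C, 0 ≤ C ∧ ∀ (z : ℂ) (w₀ : ℝ → ℂ) (u : ℝ → Vec2),
      ReducedColumn q₀ q K z ((q₀ : ℂ) ^ 2 / z) w₀ u → 0 ≤ z.im → 2 * q₀ ≤ ‖z‖ →
      Tendsto (fun x => z * w₀ x - inner ℂ (q x) (u x)) atBot (𝓝 0) →
      Tendsto (fun x => (q₀ : ℂ) ^ 2 / z * w₀ x - inner ℂ v (u x)) atBot
        (𝓝 ((q₀ : ℂ) ^ 4 / z ^ 2 - (q₀ : ℂ) ^ 2)) →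
      Tendsto (fun x => inner ℂ p (u x)) atBot (𝓝 0) →
      ‖w₀ 0‖ ≤ C / ‖z‖ ∧ ‖inner ℂ v (u 0) - (q₀ : ℂ) ^ 2‖ ≤ C / ‖z‖ ∧
      ‖inner ℂ p (u 0) - I / z * ∫ x in Set.Iic 0, inner ℂ p (q x) * inner ℂ (q x) v‖
        ≤ C / ‖z‖ ^ 2 := by
  obtain ⟨C, hC0, hC⟩ := h.exists_reducedColumn_bound hK
  obtain ⟨R, hRb⟩ := h.bdd
  have hq := h.pos
  have hR0 : 0 ≤ R := (norm_nonneg _).trans (hRb 0)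
  have hbi := h.integrableOn_sub.norm
  have hpq : ∀ x, ‖(inner ℂ p (q x) : ℂ)‖ ≤ ‖p‖ * ‖q x - v‖ := fun x => by
    have : (inner ℂ p (q x) : ℂ) = inner ℂ p (q x - v) := by rw [inner_sub_right, hp, sub_zero]
    rw [this]
    exact norm_inner_le_norm _ _
  have hpq' : ∀ x, ‖(inner ℂ p (q x) : ℂ)‖ ≤ ‖p‖ * R := fun x =>
    (norm_inner_le_norm _ _).trans (by gcongr; exact hRb x)
  obtain ⟨A, hA⟩ : ∃ A, A = ∫ y in Set.Iic 0, ‖p‖ * C * ‖q y - v‖ := ⟨_, rfl⟩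
  have hA0 : 0 ≤ A := hA ▸ integral_nonneg fun y => by positivity
  obtain ⟨D, hD⟩ : ∃ D, D = (C + q₀ ^ 4 + A) / q₀ := ⟨_, rfl⟩
  have hD0 : 0 ≤ D := by rw [hD]; positivity
  obtain ⟨a, ha⟩ : ∃ a, a = ‖p‖ * (R * D + 2 * q₀ ^ 2 * (R * q₀)) + 2 * (q₀ ^ 2 * ‖p‖ * C)
    + 2 * (‖p‖ * R * ((R + q₀) * K)) := ⟨_, rfl⟩
  obtain ⟨b, hb⟩ : ∃ b, b = 2 * (‖p‖ * C) + 2 * (‖p‖ * R * K) := ⟨_, rfl⟩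
  have ha0 : 0 ≤ a := by rw [ha]; positivity
  have hb0 : 0 ≤ b := by rw [hb]; positivity
  obtain ⟨L, hL⟩ : ∃ L, L = ∫ x in Set.Iic 0, a * ((1 + |x|) * ‖q x - v‖) + b * ‖deriv q x‖ :=
    ⟨_, rfl⟩
  have hL0 : 0 ≤ L := hL ▸ integral_nonneg fun y => by positivity
  have hpRC : 0 ≤ 2 * (‖p‖ * R * C) := by positivity
  have hq4 : 0 ≤ q₀ ^ 4 := by positivity
  refine ⟨C + q₀ ^ 4 + L + 2 * (‖p‖ * R * C), by positivity, ?_⟩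
  intro z w₀ u hR hzim hzn hlim1 hlim2 hlim3
  have hz1 := hR.one_le
  have hz0 : 0 < ‖z‖ := by linarith
  have hzne := hR.ne_zero
  have hm := (not_mem_exceptional_iff.1 (not_mem_exceptional_of_le hq hzn)).2
  have hqn : ‖(q₀ : ℂ)‖ = q₀ := by rw [Complex.norm_real, Real.norm_of_nonneg hq.le]
  have hre := re_I_mul_sq_div_nonneg q₀ hzim
  have hre1 : (I * (z - (q₀ : ℂ) ^ 2 / z)).re ≤ 0 := by
    rw [mul_sub, Complex.sub_re, Complex.I_mul_re]
    linarith
  -- With `ε = q₀²/z` the slow frequency is zero, so the limit `r` is unrestricted.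
  have hcol := hC z _ w₀ u _ hR hre1 (by simp) (by simp) hlim1 hlim2
  have hsq : 1 / ‖z‖ ^ 2 ≤ 1 / ‖z‖ := by
    apply one_div_le_one_div_of_le hz0
    nlinarith
  have hvu : ∀ x ≤ 0, ‖inner ℂ v (u x) - (q₀ : ℂ) ^ 2‖ ≤ (C + q₀ ^ 4) / ‖z‖ := fun x hx => by
    have e : inner ℂ v (u x) - (q₀ : ℂ) ^ 2 = (inner ℂ v (u x)
      + ((q₀ : ℂ) ^ 4 / z ^ 2 - (q₀ : ℂ) ^ 2)) - (q₀ : ℂ) ^ 4 / z ^ 2 := by ring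
    rw [e]
    refine (norm_sub_le _ _).trans ?_
    rw [add_div]
    refine add_le_add (hcol x hx).2.2 ?_
    rw [norm_div, norm_pow, norm_pow, hqn]
    have := mul_le_mul_of_nonneg_left hsq hq4
    rwa [mul_one_div, mul_one_div] at this
  -- A first, crude bound: the forcing `w₀ (p†q)` is already `O(1/z)` in `L¹`, because `p†q = p†(q -
  -- v)`.
  have hpu : ∀ x ≤ 0, ‖(inner ℂ p (u x) : ℂ)‖ ≤ A / ‖z‖ := fun x hx => by
    have key := norm_le_integral_of_damped (f := fun x => inner ℂ p (u x))
      (c := -(I * ((q₀ : ℂ) ^ 2 / z))) (h := fun x => I * w₀ x * inner ℂ p (q x))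
      (b := fun y => ‖p‖ * C * ‖q y - v‖ / ‖z‖) (by rw [Complex.neg_re]; linarith)
      (fun y => (hR.hasDerivAt_inner_const p y).congr_deriv (by ring)) hlim3 (fun y hy => ?_)
      ((hbi.const_mul _).div_const _) hx
    · rwa [integral_div, ← hA] at key
    · rw [norm_mul, norm_mul, norm_I, one_mul]
      calc _ ≤ (C / ‖z‖) * (‖p‖ * ‖q y - v‖) :=
            mul_le_mul (hcol y hy).2.1 (hpq y) (norm_nonneg _) (by positivity)
        _ = _ := by ring
  -- Both components of `u - v` are `O(1/z)`, and Parseval combines them.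
  have huv : ∀ x ≤ 0, ‖u x - v‖ ≤ D / ‖z‖ := fun x hx => by
    have h1 := hpars (u x - v)
    rw [inner_sub_right, inner_sub_right, hp, sub_zero, h.inner_self] at h1
    have h2 := hvu x hx
    have h3 := hpu x hx
    have h4 : q₀ * ‖u x - v‖ ≤ ‖inner ℂ v (u x) - (q₀ : ℂ) ^ 2‖ + ‖(inner ℂ p (u x) : ℂ)‖ := by
      refine abs_le_of_sq_le_sq' ?_ (by positivity) |>.2
      nlinarith [norm_nonneg (inner ℂ v (u x) - (q₀ : ℂ) ^ 2), norm_nonneg (inner ℂ p (u x) : ℂ)]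
    have h5 : q₀ * (D / ‖z‖) = (C + q₀ ^ 4) / ‖z‖ + A / ‖z‖ := by
      rw [hD]
      field_simp
    refine le_of_mul_le_mul_left ?_ hq
    rw [h5]
    linarith
  have hminv : ‖(z ^ 2 - (q₀ : ℂ) ^ 2)⁻¹‖ ≤ 2 / ‖z‖ ^ 2 := by
    have h1 := four_mul_sq_le hq hzn
    have h2 : 0 < ‖z‖ ^ 2 := by positivity
    rw [norm_inv, inv_eq_one_div, div_le_div_iff₀ (by linarith) h2]
    linarith
  have hE : ∀ x : ℝ, x ≤ 0 → (I * ((q₀ : ℂ) ^ 2 / z) * x).re ≤ 0 := fun x hx => by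
    rw [Complex.re_mul_ofReal]
    exact mul_nonpos_of_nonneg_of_nonpos hre hx
  have hE1 : ∀ x : ℝ, x ≤ 0 → ‖Complex.exp (I * ((q₀ : ℂ) ^ 2 / z) * x)‖ ≤ 1 := fun x hx => by
    rw [Complex.norm_exp]
    exact Real.exp_le_one_iff.2 (hE x hx)
  have hE2 : ∀ x : ℝ, x ≤ 0 → ‖Complex.exp (I * ((q₀ : ℂ) ^ 2 / z) * x) - 1‖
      ≤ 2 * q₀ ^ 2 * |x| / ‖z‖ := fun x hx => by
    refine (norm_exp_sub_one_le_of_re_nonpos (hE x hx)).trans (le_of_eq ?_)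
    rw [norm_mul, norm_mul, norm_I, norm_div, norm_pow, hqn, Complex.norm_real, Real.norm_eq_abs]
    ring
  obtain ⟨g, hg⟩ : ∃ g : ℝ → ℂ, ∀ x, g x = z * w₀ x - inner ℂ (q x) (u x) := ⟨_, fun _ => rfl⟩
  obtain ⟨m, hmdef⟩ : ∃ m : ℂ, m = z ^ 2 - (q₀ : ℂ) ^ 2 := ⟨_, rfl⟩
  obtain ⟨E, hEdef⟩ : ∃ E : ℝ → ℂ, ∀ x : ℝ, E x = Complex.exp (I * ((q₀ : ℂ) ^ 2 / z) * x) :=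
    ⟨_, fun _ => rfl⟩
  -- `N` is what the integration by parts leaves over: bounded in `L¹` uniformly in `z`, and divided
  -- by `m` of size `z²`.
  obtain ⟨N, hN⟩ : ∃ N : ℝ → ℂ, ∀ x, N x = I * ((q₀ : ℂ) ^ 2 / z) * inner ℂ p (q x) * g x
      + inner ℂ p (deriv q x) * g x + inner ℂ p (q x) * (I * ((q₀ : ℂ) ^ 2 - inner ℂ (q x) (q x))
        * w₀ x - inner ℂ (deriv q x) (u x)) := ⟨_, fun _ => rfl⟩
  have hF : ∀ x, HasDerivAt (fun x => E x * (inner ℂ p (u x) - inner ℂ p (q x) * g x / m))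
      (E x * (I / z * inner ℂ p (q x) * inner ℂ (q x) (u x) - N x / m)) x := fun x => by
    have := h.hasDerivAt_transverse (p := p) hR hm x
    simp only [hEdef, hg, hN, hmdef]
    exact this
  have hgC : ∀ x ≤ 0, ‖g x‖ ≤ C := fun x hx => hg x ▸ (hcol x hx).1
  simp only [← hEdef] at hE1 hE2
  rw [← hmdef] at hminv
  have hNle : ∀ x ≤ 0, ‖N x‖ ≤ q₀ ^ 2 * ‖p‖ * C * ‖q x - v‖ + ‖p‖ * C * ‖deriv q x‖
      + ‖p‖ * R * ((R + q₀) * K * ‖q x - v‖ + K * ‖deriv q x‖) := fun x hx => by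
    rw [hN]
    refine (norm_add₃_le).trans (add_le_add (add_le_add ?_ ?_) ?_)
    · rw [norm_mul, norm_mul, norm_mul, norm_I, one_mul, norm_div, norm_pow, hqn]
      calc _ ≤ q₀ ^ 2 * (‖p‖ * ‖q x - v‖) * C := by
            gcongr
            · exact div_le_self (by positivity) hz1
            · exact hpq x
            · exact hgC x hx
        _ = _ := by ring
    · rw [norm_mul]
      calc _ ≤ (‖p‖ * ‖deriv q x‖) * C := by
            gcongr
            · exact norm_inner_le_norm _ _
            · exact hgC x hx
        _ = _ := by ring
    · rw [norm_mul]
      refine mul_le_mul (hpq' x) ?_ (norm_nonneg _) (by positivity)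
      refine (norm_sub_le _ _).trans (add_le_add ?_ ?_)
      · rw [norm_mul, norm_mul, norm_I, one_mul]
        calc _ ≤ ((R + q₀) * ‖q x - v‖) * K :=
              mul_le_mul (h.norm_sq_sub_le hRb x) (hR.w_le x hx) (norm_nonneg _) (by positivity)
          _ = _ := by ring
      · refine (norm_inner_le_norm _ _).trans ?_
        rw [mul_comm]
        exact mul_le_mul_of_nonneg_right (hR.u_le x hx) (norm_nonneg _)
  have hrem : ∀ x ∈ Set.Iic (0 : ℝ),
      ‖E x * (I / z * inner ℂ p (q x) * inner ℂ (q x) (u x) - N x / m)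
        - I / z * (inner ℂ p (q x) * inner ℂ (q x) v)‖
      ≤ (a * ((1 + |x|) * ‖q x - v‖) + b * ‖deriv q x‖) / ‖z‖ ^ 2 := fun x hx => by
    have e : E x * (I / z * inner ℂ p (q x) * inner ℂ (q x) (u x) - N x / m)
        - I / z * (inner ℂ p (q x) * inner ℂ (q x) v)
        = I / z * inner ℂ p (q x) * (E x * inner ℂ (q x) (u x - v) + (E x - 1) * inner ℂ (q x) v)
          - E x * (N x * m⁻¹) := by
      rw [inner_sub_right, div_eq_mul_inv (N x)]
      ring
    have h1 : ‖E x * inner ℂ (q x) (u x - v) + (E x - 1) * inner ℂ (q x) v‖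
        ≤ (R * D + 2 * q₀ ^ 2 * (R * q₀) * |x|) / ‖z‖ := by
      refine (norm_add_le _ _).trans ?_
      rw [norm_mul, norm_mul]
      calc _ ≤ 1 * (R * (D / ‖z‖)) + (2 * q₀ ^ 2 * |x| / ‖z‖) * (R * q₀) := by
            gcongr
            · exact hE1 x hx
            · exact (norm_inner_le_norm _ _).trans
                (mul_le_mul (hRb x) (huv x hx) (norm_nonneg _) hR0)
            · exact hE2 x hx
            · refine (norm_inner_le_norm _ _).trans ?_
              rw [h.norm_eq]
              exact mul_le_mul_of_nonneg_right (hRb x) hq.le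
        _ = _ := by ring
    rw [e]
    refine (norm_sub_le _ _).trans ?_
    rw [norm_mul, norm_mul, norm_div, norm_I, norm_mul, norm_mul]
    have h2 := hNle x hx
    have hx0 := abs_nonneg x
    have hb0 := norm_nonneg (q x - v)
    calc _ ≤ 1 / ‖z‖ * (‖p‖ * ‖q x - v‖) * ((R * D + 2 * q₀ ^ 2 * (R * q₀) * |x|) / ‖z‖)
          + 1 * ((q₀ ^ 2 * ‖p‖ * C * ‖q x - v‖ + ‖p‖ * C * ‖deriv q x‖
            + ‖p‖ * R * ((R + q₀) * K * ‖q x - v‖ + K * ‖deriv q x‖)) * (2 / ‖z‖ ^ 2)) := by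
          gcongr
          · exact hpq x
          · exact hE1 x hx
      _ = (‖p‖ * (R * D + 2 * q₀ ^ 2 * (R * q₀) * |x|) * ‖q x - v‖
          + 2 * (q₀ ^ 2 * ‖p‖ * C) * ‖q x - v‖
          + 2 * (‖p‖ * R * ((R + q₀) * K)) * ‖q x - v‖ + b * ‖deriv q x‖) / ‖z‖ ^ 2 := by
          rw [hb]
          field_simp
          ring
      _ ≤ _ := by
          refine div_le_div_of_nonneg_right ?_ (by positivity)
          have e1 : 0 ≤ ‖p‖ * (R * D) * (|x| * ‖q x - v‖) := by positivity
          have e2 : 0 ≤ ‖p‖ * (2 * q₀ ^ 2 * (R * q₀)) * ‖q x - v‖ := by positivity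
          have e3 : 0 ≤ (2 * (q₀ ^ 2 * ‖p‖ * C) + 2 * (‖p‖ * R * ((R + q₀) * K)))
            * (|x| * ‖q x - v‖) := by positivity
          rw [ha]
          nlinarith [e1, e2, e3]
  have hremi : IntegrableOn (fun x =>
      (a * ((1 + |x|) * ‖q x - v‖) + b * ‖deriv q x‖) / ‖z‖ ^ 2) (Set.Iic 0) :=
    (h.integrableOn_dominating a b).div_const _
  have hrem' := (ae_restrict_iff' (μ := volume) (measurableSet_Iic (a := (0 : ℝ)))).2
    (Eventually.of_forall hrem)
  have hmain : IntegrableOn (fun x => I / z * (inner ℂ p (q x) * inner ℂ (q x) v))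
      (Set.Iic 0) := by
    have hqc := h.continuous
    refine Integrable.const_mul (Integrable.mono' (hbi.const_mul (‖p‖ * (R * q₀)))
      (by fun_prop) (Eventually.of_forall fun x => ?_)) _
    rw [norm_mul]
    calc _ ≤ (‖p‖ * ‖q x - v‖) * (R * q₀) := by
          refine mul_le_mul (hpq x) ((norm_inner_le_norm _ _).trans ?_) (norm_nonneg _)
            (by positivity)
          rw [h.norm_eq]
          exact mul_le_mul_of_nonneg_right (hRb x) hq.le
      _ = _ := by ring
  -- The integrand contains `deriv q`, but it is itself a derivative, hence measurable.
  have hTmeas : Measurable fun x => E x * (I / z * inner ℂ p (q x) * inner ℂ (q x) (u x)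
      - N x / m) := by
    have := measurable_deriv fun x => E x * (inner ℂ p (u x) - inner ℂ p (q x) * g x / m)
    rwa [funext fun x => (hF x).deriv] at this
  have hdiff : IntegrableOn (fun x => E x * (I / z * inner ℂ p (q x) * inner ℂ (q x) (u x)
      - N x / m) - I / z * (inner ℂ p (q x) * inner ℂ (q x) v)) (Set.Iic 0) :=
    Integrable.mono' hremi (hTmeas.aestronglyMeasurable.sub hmain.aestronglyMeasurable) hrem'
  have hlimF : Tendsto (fun x => E x * (inner ℂ p (u x) - inner ℂ p (q x) * g x / m))
      atBot (𝓝 0) := by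
    have h1 : Tendsto (fun x => (inner ℂ p (u x) : ℂ) - inner ℂ p (q x) * g x / m) atBot (𝓝 0) := by
      have hpl : Tendsto (fun x => (inner ℂ p (q x) : ℂ)) atBot (𝓝 (inner ℂ p v)) :=
        tendsto_const_nhds.inner h.tendsto
      have hgl : Tendsto g atBot (𝓝 0) := by
        rw [funext hg]
        exact hlim1
      simpa using hlim3.sub ((hpl.mul hgl).div_const m)
    refine squeeze_zero_norm' ?_ (tendsto_zero_iff_norm_tendsto_zero.1 h1)
    filter_upwards [eventually_le_atBot 0] with x hx
    rw [norm_mul]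
    exact mul_le_of_le_one_left (norm_nonneg _) (hE1 x hx)
  have hint := integral_Iic_of_hasDerivAt_of_tendsto' (a := 0) (fun x _ => hF x)
    ((hdiff.add hmain).congr (Eventually.of_forall fun x => by simp)) hlimF
  have hE0 : E 0 = 1 := by simp [hEdef]
  have hbound : ‖(inner ℂ p (u 0) - inner ℂ p (q 0) * g 0 / m)
      - I / z * ∫ x in Set.Iic 0, inner ℂ p (q x) * inner ℂ (q x) v‖ ≤ L / ‖z‖ ^ 2 := by
    rw [hE0, one_mul, sub_zero] at hint
    rw [← hint, ← integral_const_mul, ← integral_sub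
      ((hdiff.add hmain).congr (Eventually.of_forall fun x => by simp)) hmain, hL, ← integral_div]
    exact norm_integral_le_of_norm_le hremi hrem'
  refine ⟨(hcol 0 le_rfl).2.1.trans (div_le_div_of_nonneg_right (by linarith) hz0.le),
    (hvu 0 le_rfl).trans (div_le_div_of_nonneg_right (by linarith) hz0.le), ?_⟩
  have e : inner ℂ p (u 0) - I / z * ∫ x in Set.Iic 0, inner ℂ p (q x) * inner ℂ (q x) v
      = ((inner ℂ p (u 0) - inner ℂ p (q 0) * g 0 / m)
      - I / z * ∫ x in Set.Iic 0, inner ℂ p (q x) * inner ℂ (q x) v)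
      + inner ℂ p (q 0) * g 0 * m⁻¹ := by
    rw [div_eq_mul_inv]
    ring
  rw [e]
  -- The boundary term at `0` is of second order because `g` is bounded.
  have h3 : ‖inner ℂ p (q 0) * g 0 * m⁻¹‖ ≤ 2 * (‖p‖ * R * C) / ‖z‖ ^ 2 := by
    rw [norm_mul, norm_mul]
    calc _ ≤ ‖p‖ * R * C * (2 / ‖z‖ ^ 2) := by
          gcongr
          · exact hpq' 0
          · exact hgC 0 le_rfl
      _ = _ := by ring
  refine (norm_add_le _ _).trans ((add_le_add hbound h3).trans ?_)
  rw [← add_div]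
  exact div_le_div_of_nonneg_right (by linarith) (by positivity)

end LeftPotential

end TransverseAsymptotics

/-! ### Large `z`: the second and third columns at `x = 0` -/

section LeftSolutionAsymptotics

/-- The last two components of a column. -/
def lowerPart : (Fin 3 → ℂ) →L[ℂ] Vec2 :=
  (EuclideanSpace.equiv (Fin 2) ℂ).symm.toContinuousLinearMap.comp
    (ContinuousLinearMap.pi ![ContinuousLinearMap.proj 1, ContinuousLinearMap.proj 2])

theorem lowerPart_zero (w : Fin 3 → ℂ) : lowerPart w 0 = w 1 := rfl

theorem lowerPart_one (w : Fin 3 → ℂ) : lowerPart w 1 = w 2 := rfl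

theorem inner_vec2 (a b : Vec2) : inner ℂ a b = star (a 0) * b 0 + star (a 1) * b 1 := by
  simp [PiLp.inner_apply, Fin.sum_univ_two, mul_comm]

theorem inner_perp_self (v : Vec2) : inner ℂ v (perp v) = 0 := by
  rw [inner_vec2, perp_zero, perp_one]
  ring

variable {q₀ : ℝ} {q : ℝ → Vec2} {v p : Vec2} {z : ℂ} {j₀ : Fin 3}

theorem lowerPart_eigCol_two : lowerPart (eigCol q₀ v z 2) = v := by
  ext i
  fin_cases i <;> rfl

theorem lowerPart_eigCol_one : lowerPart (eigCol q₀ v z 1) = perp v := by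
  ext i
  fin_cases i <;> rfl

theorem norm_eigCol_one_le (hv : ‖v‖ = q₀) : ‖eigCol q₀ v z 1‖ ≤ q₀ := by
  have hq : 0 ≤ q₀ := hv ▸ norm_nonneg v
  have h0 := vec2_apply_norm_le v 0
  have h1 := vec2_apply_norm_le v 1
  rw [hv] at h0 h1
  refine (pi_norm_le_iff_of_nonneg hq).2 fun i => ?_
  fin_cases i <;> simpa [eigCol, perp_zero, perp_one]

theorem norm_eigCol_two_le (hq : 0 < q₀) (hv : ‖v‖ = q₀) (hz : 2 * q₀ ≤ ‖z‖) :
    ‖eigCol q₀ v z 2‖ ≤ q₀ := by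
  have h0 := vec2_apply_norm_le v 0
  have h1 := vec2_apply_norm_le v 1
  rw [hv] at h0 h1
  refine (pi_norm_le_iff_of_nonneg hq.le).2 fun i => ?_
  fin_cases i <;> simp [eigCol]
  · rw [div_le_iff₀ (by linarith)]
    nlinarith
  · exact h0
  · exact h1

namespace LeftPotential

/-- A uniform bound, for large `z`, of the left solutions on the left half-line. -/
theorem exists_norm_leftSol_le (h : LeftPotential q₀ q v) : ∃ K, 0 ≤ K ∧
    ∀ (z : ℂ) (j₀ : Fin 3), 2 * q₀ ≤ ‖z‖ → ‖eigCol q₀ v z j₀‖ ≤ q₀ →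
      (∀ j, (I * (freq q₀ z j - freq q₀ z j₀)).re ≤ 0) → ∀ x ≤ 0,
      ‖leftSol q₀ q v j₀ z x‖ ≤ K ∧ ‖lowerPart (leftSol q₀ q v j₀ z x)‖ ≤ K := by
  have hq := h.pos
  -- The constant `54` bounds the sum of the norms of the three projections, each at most `18`.
  set K := q₀ * Real.exp (2 * 54 * cumNorm (potPerturb q v) 0) with hK
  refine ⟨(1 + ‖lowerPart‖) * K, by positivity, fun z j₀ hz hcol hc x hx => ?_⟩
  have hM : ∑ j, ‖eigProj q₀ v j z‖ ≤ 54 := by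
    refine (Finset.sum_le_sum fun j _ => norm_eigProj_le hq h.norm_eq hz j).trans ?_
    norm_num
  have h1 : ‖leftSol q₀ q v j₀ z x‖ ≤ K := (h.norm_leftSol_le hM hc hx).trans
    (mul_le_mul_of_nonneg_right hcol (Real.exp_pos _).le)
  have hK0 : 0 ≤ K := by positivity
  have h2 : ‖lowerPart (leftSol q₀ q v j₀ z x)‖ ≤ ‖lowerPart‖ * K :=
    (lowerPart.le_opNorm _).trans (by gcongr)
  have h3 : 0 ≤ ‖lowerPart‖ * K := by positivity
  constructor <;> rw [add_mul, one_mul] <;> linarith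

/-- Removing the phase `freq j₀` shifts the diagonal entries `ik` and `-ik` to `i (2k - ε)` and
`-iε`. -/
theorem reducedColumn_leftSol (h : LeftPotential q₀ q v) {K : ℝ} {ε : ℂ}
    (hze : z ∉ exceptional q₀) (hz1 : 1 ≤ ‖z‖) (hε : ε = kOf q₀ z + freq q₀ z j₀)
    (hc : ∀ j, (I * (freq q₀ z j - freq q₀ z j₀)).re ≤ 0)
    (hK : ∀ x ≤ 0, ‖leftSol q₀ q v j₀ z x‖ ≤ K ∧ ‖lowerPart (leftSol q₀ q v j₀ z x)‖ ≤ K) :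
    ReducedColumn q₀ q K z ε (fun x => leftSol q₀ q v j₀ z x 0)
      (fun x => lowerPart (leftSol q₀ q v j₀ z x)) where
  one_le := hz1
  w_deriv x := by
    have hd := hasDerivAt_pi.1 (h.hasDerivAt_leftSol hze hc x) 0
    refine hd.congr_deriv ?_
    rw [matX_mulVec, inner_vec2, lowerPart_zero, lowerPart_one, hε]
    simp
    ring
  u_deriv x := by
    have hd := (lowerPart.restrictScalars ℝ).hasFDerivAt.comp_hasDerivAt x
      (h.hasDerivAt_leftSol hze hc x)
    refine hd.congr_deriv ?_
    rw [ContinuousLinearMap.coe_restrictScalars', matX_mulVec, hε, map_sub, map_smul]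
    ext i
    fin_cases i <;>
      simp [lowerPart_zero, lowerPart_one] <;> ring
  w_le x hx := (norm_le_pi_norm _ 0).trans (hK x hx).1
  u_le x hx := (hK x hx).2

/-- Here `ε = k - λ = q₀²/z`, and the column starts from `(q₀²/z, v)`: the fast combination vanishes
at `-∞` and the slow one tends to `q₀⁴/z² - q₀²`. -/
theorem exists_leftSol_two_bound (h : LeftPotential q₀ q v) (hp : inner ℂ p v = 0)
    (hpars : ∀ y : Vec2, q₀ ^ 2 * ‖y‖ ^ 2
      = ‖(inner ℂ v y : ℂ)‖ ^ 2 + ‖(inner ℂ p y : ℂ)‖ ^ 2) :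
    ∃ C, 0 ≤ C ∧ ∀ z : ℂ, 0 ≤ z.im → 2 * q₀ ≤ ‖z‖ → 1 ≤ ‖z‖ →
      ‖leftSol q₀ q v 2 z 0 0‖ ≤ C / ‖z‖ ∧
      ‖inner ℂ v (lowerPart (leftSol q₀ q v 2 z 0)) - (q₀ : ℂ) ^ 2‖ ≤ C / ‖z‖ ∧
      ‖inner ℂ p (lowerPart (leftSol q₀ q v 2 z 0))
        - I / z * ∫ x in Set.Iic 0, inner ℂ p (q x) * inner ℂ (q x) v‖ ≤ C / ‖z‖ ^ 2 := by
  obtain ⟨K, hK0, hK⟩ := h.exists_norm_leftSol_le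
  obtain ⟨C, hC0, hC⟩ := h.exists_transverse_bound hK0 hp hpars
  refine ⟨C, hC0, fun z hzim hz hz1 => ?_⟩
  have hc := re_I_mul_freq_sub_le (q₀ := q₀) hzim
  have hze := not_mem_exceptional_of_le h.pos hz
  have hzne := (not_mem_exceptional_iff.1 hze).1
  have hl := h.tendsto_leftSol hc
  have hl0 : Tendsto (fun x => leftSol q₀ q v 2 z x 0) atBot (𝓝 ((q₀ : ℂ) ^ 2 / z)) :=
    tendsto_pi_nhds.1 hl 0
  have hlu : Tendsto (fun x => lowerPart (leftSol q₀ q v 2 z x)) atBot (𝓝 v) := by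
    have := (lowerPart.continuous.tendsto _).comp hl
    rwa [lowerPart_eigCol_two] at this
  refine hC z _ _ (h.reducedColumn_leftSol hze hz1 ?_ hc
    (hK z 2 hz (norm_eigCol_two_le h.pos h.norm_eq hz) hc)) hzim hz ?_ ?_ ?_
  · simp [freq, kOf, lamOf]
    ring
  · have := (hl0.const_mul z).sub (h.tendsto.inner (𝕜 := ℂ) hlu)
    rw [h.inner_self] at this
    convert this using 2
    field_simp
    ring
  · have := (hl0.const_mul ((q₀ : ℂ) ^ 2 / z)).sub (tendsto_const_nhds.inner (𝕜 := ℂ) (x := v) hlu)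
    rw [h.inner_self] at this
    convert this using 2
    field_simp
  · rw [← hp]
    exact tendsto_const_nhds.inner hlu

theorem re_I_mul_freq_sub_real (z : ℝ) (j j₀ : Fin 3) :
    (I * (freq q₀ (z : ℂ) j - freq q₀ (z : ℂ) j₀)).re ≤ 0 := by
  rw [Complex.I_mul_re, Complex.sub_im, freq_ofReal_im, freq_ofReal_im]
  simp

/-- Here `ε = 0`, and the column starts from `(0, v^⊥)`, so both combinations vanish at `-∞`. An
error `O(1/z)` suffices, so no transverse expansion is needed. The parameter is real because off the
real axis the exponents `iz` and `i q₀²/z` have real parts of opposite signs. -/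
theorem exists_leftSol_one_bound (h : LeftPotential q₀ q v) :
    ∃ C, 0 ≤ C ∧ ∀ z : ℝ, 2 * q₀ ≤ |z| → 1 ≤ |z| →
      ‖leftSol q₀ q v 1 (z : ℂ) 0 0‖ ≤ C / |z| ∧
      ‖(inner ℂ v (lowerPart (leftSol q₀ q v 1 (z : ℂ) 0)) : ℂ)‖ ≤ C / |z| ∧
      ‖lowerPart (leftSol q₀ q v 1 (z : ℂ) 0)‖ ≤ C := by
  obtain ⟨K, hK0, hK⟩ := h.exists_norm_leftSol_le
  obtain ⟨C, hC0, hC⟩ := h.exists_reducedColumn_bound hK0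
  refine ⟨C + K, by positivity, fun z hz hz1 => ?_⟩
  have hnz : ‖(z : ℂ)‖ = |z| := by rw [Complex.norm_real, Real.norm_eq_abs]
  rw [← hnz] at hz hz1 ⊢
  have hc := fun j => re_I_mul_freq_sub_real (q₀ := q₀) z j 1
  have hze := not_mem_exceptional_of_le h.pos hz
  have hzne := (not_mem_exceptional_iff.1 hze).1
  have hl := h.tendsto_leftSol hc
  have hl0 : Tendsto (fun x => leftSol q₀ q v 1 z x 0) atBot (𝓝 0) :=
    tendsto_pi_nhds.1 hl 0
  have hlu : Tendsto (fun x => lowerPart (leftSol q₀ q v 1 z x)) atBot (𝓝 (perp v)) := by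
    have := (lowerPart.continuous.tendsto _).comp hl
    rwa [lowerPart_eigCol_one] at this
  have hKz := hK z 1 hz (norm_eigCol_one_le h.norm_eq) hc
  have hreal : ((q₀ : ℂ) ^ 2 / (z : ℂ)).im = 0 := by
    rw [← Complex.ofReal_pow, ← Complex.ofReal_div, Complex.ofReal_im]
  have key := hC z 0 _ _ 0 (h.reducedColumn_leftSol hze hz1 (by simp [freq]) hc hKz)
    (by simp) (by simp [hreal]) (by simp)
    (by
      have := (hl0.const_mul (z : ℂ)).sub (h.tendsto.inner (𝕜 := ℂ) hlu)
      rwa [inner_perp_self, mul_zero, sub_zero] at this)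
    (by
      have := (hl0.const_mul ((q₀ : ℂ) ^ 2 / z)).sub
        (tendsto_const_nhds.inner (𝕜 := ℂ) (x := v) hlu)
      rwa [inner_perp_self, mul_zero, sub_zero] at this) 0 le_rfl
  have hle : C / ‖(z : ℂ)‖ ≤ (C + K) / ‖(z : ℂ)‖ :=
    div_le_div_of_nonneg_right (by linarith) (norm_nonneg _)
  refine ⟨key.2.1.trans hle, ?_, (hKz 0 le_rfl).2.trans (by linarith)⟩
  have := key.2.2
  rw [add_zero] at this
  exact this.trans hle

end LeftPotential

end LeftSolutionAsymptotics

/-! ### Uniqueness of continuations from the real axis -/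

section BoundaryUniqueness

/-- A function that is holomorphic in a square, continuous up to the boundary and zero on one side
vanishes at the centre: the product of its four rotates vanishes on the whole boundary. -/
theorem eq_zero_at_centre_of_eq_zero_on_side {F : ℂ → ℂ} {c : ℂ} (hc : 0 < c.im)
    (hd : DifferentiableOn ℂ F {w | |(w - c).re| < c.im ∧ |(w - c).im| < c.im})
    (hcont : ContinuousOn F {w | |(w - c).re| ≤ c.im ∧ |(w - c).im| ≤ c.im})
    (h0 : ∀ w : ℂ, |(w - c).re| ≤ c.im → w.im = 0 → F w = 0) : F c = 0 := by
  obtain ⟨U, hU⟩ : ∃ U : Set ℂ, U = {w | |(w - c).re| < c.im ∧ |(w - c).im| < c.im} := ⟨_, rfl⟩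
  obtain ⟨T, hT⟩ : ∃ T : Set ℂ, T = {w | |(w - c).re| ≤ c.im ∧ |(w - c).im| ≤ c.im} := ⟨_, rfl⟩
  rw [← hU] at hd
  rw [← hT] at hcont
  have hcre : Continuous fun w : ℂ => |(w - c).re| := by fun_prop
  have hcim : Continuous fun w : ℂ => |(w - c).im| := by fun_prop
  have hUo : IsOpen U := by
    rw [hU]
    exact (isOpen_lt hcre continuous_const).inter (isOpen_lt hcim continuous_const)
  have hTc : IsClosed T := by
    rw [hT]
    exact (isClosed_le hcre continuous_const).inter (isClosed_le hcim continuous_const)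
  have hUT : closure U ⊆ T := closure_minimal (by
    rw [hU, hT]
    exact fun w hw => ⟨hw.1.le, hw.2.le⟩) hTc
  have hcU : c ∈ U := by
    rw [hU]
    simp [hc]
  have hbdd : Bornology.IsBounded U := by
    refine (Metric.isBounded_closedBall (x := c) (r := c.im + c.im)).subset fun w hw => ?_
    rw [hU] at hw
    rw [mem_closedBall_iff_norm]
    exact (Complex.norm_le_abs_re_add_abs_im _).trans (add_le_add hw.1.le hw.2.le)
  -- Quarter turns about the centre: each side of the square is carried by one of them to the side
  -- on the real axis.
  let rot : ℂ → ℂ → ℂ := fun ω w => c + ω * (w - c)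
  have hrotU : ∀ ω ∈ ({1, I, -1, -I} : Set ℂ), Set.MapsTo (rot ω) U U := by
    rw [hU]
    rintro ω (rfl | rfl | rfl | rfl) w ⟨h1, h2⟩ <;>
      simp only [rot, Set.mem_ofPred_eq, add_sub_cancel_left] <;>
      simp only [Complex.mul_re, Complex.mul_im, Complex.one_re, Complex.one_im, Complex.I_re,
        Complex.I_im, Complex.neg_re, Complex.neg_im] <;>
      constructor <;> rw [abs_lt] at * <;> constructor <;> linarith [h1.1, h1.2, h2.1, h2.2]
  have hrotT : ∀ ω ∈ ({1, I, -1, -I} : Set ℂ), Set.MapsTo (rot ω) T T := by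
    rw [hT]
    rintro ω (rfl | rfl | rfl | rfl) w ⟨h1, h2⟩ <;>
      simp only [rot, Set.mem_ofPred_eq, add_sub_cancel_left] <;>
      simp only [Complex.mul_re, Complex.mul_im, Complex.one_re, Complex.one_im, Complex.I_re,
        Complex.I_im, Complex.neg_re, Complex.neg_im] <;>
      constructor <;> rw [abs_le] at * <;> constructor <;> linarith [h1.1, h1.2, h2.1, h2.2]
  have hD : ∀ ω ∈ ({1, I, -1, -I} : Set ℂ), DiffContOnCl ℂ (fun w => F (rot ω w)) U := fun ω hω =>
    ⟨hd.comp (by fun_prop) (hrotU ω hω),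
      hcont.comp (by fun_prop) ((hrotT ω hω).mono_left hUT)⟩
  have hD4 : DiffContOnCl ℂ (fun w => F (rot 1 w) * F (rot I w) * (F (rot (-1) w) * F (rot (-I) w))) U :=
    ⟨(((hD 1 (by simp)).1.mul (hD I (by simp)).1).mul
        ((hD (-1) (by simp)).1.mul (hD (-I) (by simp)).1)),
      (((hD 1 (by simp)).2.mul (hD I (by simp)).2).mul
        ((hD (-1) (by simp)).2.mul (hD (-I) (by simp)).2))⟩
  have hzero : ∀ ω w, rot ω w ∈ T → (rot ω w).im = 0 → F (rot ω w) = 0 := fun ω w hw h => by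
    rw [hT] at hw
    exact h0 _ hw.1 h
  have hfr : ∀ w ∈ frontier U,
      ‖F (rot 1 w) * F (rot I w) * (F (rot (-1) w) * F (rot (-I) w))‖ ≤ 0 := fun w hw => by
    have hwT : w ∈ T := hUT hw.1
    have hwU : w ∉ U := hUo.interior_eq ▸ hw.2
    have him : (rot 1 w).im = c.im + (w - c).im ∧ (rot I w).im = c.im + (w - c).re ∧
        (rot (-1) w).im = c.im - (w - c).im ∧ (rot (-I) w).im = c.im - (w - c).re := by
      simp only [rot, Complex.add_im, Complex.mul_im, Complex.one_re, Complex.one_im,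
        Complex.I_re, Complex.I_im, Complex.neg_re, Complex.neg_im]
      refine ⟨?_, ?_, ?_, ?_⟩ <;> ring
    obtain ⟨i1, i2, i3, i4⟩ := him
    have hcases : (w - c).im = -c.im ∨ (w - c).re = -c.im ∨ (w - c).im = c.im
        ∨ (w - c).re = c.im := by
      rw [hU, Set.mem_ofPred_eq, not_and_or, not_lt, not_lt] at hwU
      rw [hT] at hwT
      rcases hwU with h | h
      · rcases abs_eq hc.le |>.1 (le_antisymm hwT.1 h) with h | h
        · exact Or.inr (Or.inr (Or.inr h))
        · exact Or.inr (Or.inl h)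
      · rcases abs_eq hc.le |>.1 (le_antisymm hwT.2 h) with h | h
        · exact Or.inr (Or.inr (Or.inl h))
        · exact Or.inl h
    rw [norm_le_zero_iff]
    rcases hcases with h | h | h | h
    · rw [hzero 1 w (hrotT 1 (by simp) hwT) (by rw [i1, h]; ring)]
      ring
    · rw [hzero I w (hrotT I (by simp) hwT) (by rw [i2, h]; ring)]
      ring
    · rw [hzero (-1) w (hrotT (-1) (by simp) hwT) (by rw [i3, h]; ring)]
      ring
    · rw [hzero (-I) w (hrotT (-I) (by simp) hwT) (by rw [i4, h]; ring)]
      ring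
  have hfin := Complex.norm_le_of_forall_mem_frontier_norm_le hbdd hD4 hfr (subset_closure hcU)
  rw [norm_le_zero_iff] at hfin
  simpa [rot] using hfin

variable {q₀ : ℝ} {f : ℝ → ℂ} {F G : ℂ → ℂ}

/-- Vanishing on the real axis forces vanishing at the centres of small squares resting on it, hence
near one interior point, and the identity theorem spreads this to the half-plane. -/
theorem eq_zero_of_extendsToUpper_zero (hq : 0 < q₀) (hF : ExtendsToUpper q₀ (fun _ => 0) F) {z : ℂ}
    (hz : 0 ≤ z.im) (hze : z ∉ exceptional q₀) : F z = 0 := by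
  rcases hz.eq_or_lt with h | h
  · have e : ((z.re : ℝ) : ℂ) = z := Complex.ext rfl (by simp [h])
    have := hF.boundary z.re (by simpa [realSpectrum, e] using hze)
    rwa [e] at this
  have ho : IsOpen {z : ℂ | 0 < z.im} := isOpen_lt continuous_const Complex.continuous_im
  have han : AnalyticOnNhd ℂ F {z : ℂ | 0 < z.im} := hF.holo.analyticOnNhd ho
  have hconn : IsPreconnected {z : ℂ | 0 < z.im} := (convex_halfSpace_im_gt 0).isPreconnected
  -- The centre is far enough to the right for every square used, with half side below `3/2`, to
  -- stay clear of `q₀`.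
  obtain ⟨c₀, hre, him⟩ : ∃ c₀ : ℂ, c₀.re = q₀ + 3 ∧ c₀.im = 1 := ⟨⟨q₀ + 3, 1⟩, rfl, rfl⟩
  have hev : F =ᶠ[𝓝 c₀] 0 := by
    filter_upwards [Metric.ball_mem_nhds c₀ (by norm_num : (0 : ℝ) < 1 / 2)] with c hcb
    rw [mem_ball_iff_norm] at hcb
    have h1 := abs_lt.1 ((Complex.abs_re_le_norm _).trans_lt hcb)
    have h2 := abs_lt.1 ((Complex.abs_im_le_norm _).trans_lt hcb)
    rw [Complex.sub_re, hre] at h1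
    rw [Complex.sub_im, him] at h2
    have hex : ∀ w : ℂ, |(w - c).re| ≤ c.im → w ∉ exceptional q₀ := fun w hw => by
      have h3 := (abs_le.1 hw).1
      rw [Complex.sub_re] at h3
      have h4 : q₀ < w.re := by linarith
      rintro (rfl | rfl | rfl) <;> simp at h4 <;> linarith
    refine eq_zero_at_centre_of_eq_zero_on_side (by linarith) (hF.holo.mono fun w hw => ?_)
      (hF.cont.mono fun w hw => ⟨?_, hex w hw.1⟩) fun w hw hw0 => ?_
    · have := (abs_lt.1 hw.2).1
      rw [Complex.sub_im] at this
      exact Set.mem_ofPred_eq ▸ (by linarith : 0 < w.im)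
    · have := (abs_le.1 hw.2).1
      rw [Complex.sub_im] at this
      exact Set.mem_ofPred_eq ▸ (by linarith : 0 ≤ w.im)
    · have e : ((w.re : ℝ) : ℂ) = w := Complex.ext rfl (by simp [hw0])
      have := hF.boundary w.re (by simpa [realSpectrum, e] using hex w hw)
      rwa [e] at this
  exact han.eqOn_zero_of_preconnected_of_eventuallyEq_zero hconn
    (by simp [him]) hev h

theorem ExtendsToUpper.unique (hq : 0 < q₀) (hF : ExtendsToUpper q₀ f F)
    (hG : ExtendsToUpper q₀ f G) {z : ℂ} (hz : 0 ≤ z.im) (hze : z ∉ exceptional q₀) :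
    F z = G z := by
  rw [← sub_eq_zero]
  exact eq_zero_of_extendsToUpper_zero (F := fun z => F z - G z) hq
    ⟨hF.holo.sub hG.holo, hF.cont.sub hG.cont, fun z hz => by
      rw [hF.boundary z hz, hG.boundary z hz, sub_self]⟩ hz hze

theorem neg_mem_exceptional_iff {z : ℂ} : -z ∈ exceptional q₀ ↔ z ∈ exceptional q₀ := by
  rw [← not_iff_not, not_mem_exceptional_iff, not_mem_exceptional_iff, neg_sq, neg_ne_zero]

theorem ExtendsToLower.reflect (hF : ExtendsToLower q₀ f F) :
    ExtendsToUpper q₀ (fun x => f (-x)) (fun z => F (-z)) where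
  holo := hF.holo.comp (differentiableOn_neg _) fun z hz => by simpa using hz
  cont := hF.cont.comp continuousOn_neg fun z hz =>
    ⟨by simpa using hz.1, fun h => hz.2 (neg_mem_exceptional_iff.1 h)⟩
  boundary z hz := by
    have := hF.boundary (-z) (fun h => hz (neg_mem_exceptional_iff.1 (by simpa using h)))
    simpa using this

theorem ExtendsToLower.unique (hq : 0 < q₀) (hF : ExtendsToLower q₀ f F)
    (hG : ExtendsToLower q₀ f G) {z : ℂ} (hz : z.im ≤ 0) (hze : z ∉ exceptional q₀) :
    F z = G z := by
  have := hF.reflect.unique hq hG.reflect (z := -z) (by simpa using hz)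
    (fun h => hze (neg_mem_exceptional_iff.1 h))
  simpa using this

end BoundaryUniqueness

/-! ### The conserved indefinite form -/

section IndefiniteForm

/-- The sesquilinear form `φ† J χ`. -/
def jform (φ χ : Fin 3 → ℂ) : ℂ := star (φ 0) * χ 0 - star (φ 1) * χ 1 - star (φ 2) * χ 2

theorem jform_smul_smul (a b : ℂ) (φ χ : Fin 3 → ℂ) :
    jform (a • φ) (b • χ) = star a * b * jform φ χ := by
  simp only [jform, Pi.smul_apply, smul_eq_mul, star_mul']
  ring

theorem norm_jform_le (φ χ : Fin 3 → ℂ) : ‖jform φ χ‖ ≤ 3 * (‖φ‖ * ‖χ‖) := by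
  have h : ∀ i, ‖star (φ i) * χ i‖ ≤ ‖φ‖ * ‖χ‖ := fun i => by
    rw [norm_mul, norm_star]
    exact mul_le_mul (norm_le_pi_norm φ i) (norm_le_pi_norm χ i) (norm_nonneg _) (norm_nonneg _)
  have h1 := norm_sub_le (star (φ 0) * χ 0 - star (φ 1) * χ 1) (star (φ 2) * χ 2)
  have h2 := norm_sub_le (star (φ 0) * χ 0) (star (φ 1) * χ 1)
  rw [jform]
  linarith [h 0, h 1, h 2]

/-- `φ` solves the scattering problem `φ' = X φ`. -/
def IsSol (q₀ : ℝ) (q : ℝ → Vec2) (z : ℂ) (φ : ℝ → Fin 3 → ℂ) : Prop :=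
  ∀ x, HasDerivAt φ ((matX q₀ (q x) z).mulVec (φ x)) x

variable {q₀ : ℝ} {q : ℝ → Vec2} {v : Vec2} {z : ℝ} {φ χ : ℝ → Fin 3 → ℂ}

theorem star_kOf_real : star (kOf q₀ (z : ℂ)) = kOf q₀ z := by simp [kOf]

theorem star_lamOf_real : star (lamOf q₀ (z : ℂ)) = lamOf q₀ z := by simp [lamOf]

theorem star_rhoHat_real : star (rhoHat q₀ (z : ℂ)) = rhoHat q₀ z := by simp [rhoHat]

theorem IsSol.smul {w : ℂ} (hφ : IsSol q₀ q w φ) (a : ℂ) : IsSol q₀ q w fun x => a • φ x :=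
  fun x => ((hφ x).const_smul a).congr_deriv (by rw [Matrix.mulVec_smul])

theorem IsSol.sub {w : ℂ} (hφ : IsSol q₀ q w φ) (hχ : IsSol q₀ q w χ) :
    IsSol q₀ q w fun x => φ x - χ x :=
  fun x => ((hφ x).sub (hχ x)).congr_deriv (by rw [Matrix.mulVec_sub])

/-- For real spectral parameter the form of two solutions does not depend on `x`. -/
theorem jform_eq_of_isSol (hφ : IsSol q₀ q z φ) (hχ : IsSol q₀ q z χ) (x y : ℝ) :
    jform (φ x) (χ x) = jform (φ y) (χ y) := by
  have hd : ∀ x, HasDerivAt (fun x => jform (φ x) (χ x)) 0 x := fun x => by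
    have h1 := fun i => hasDerivAt_pi.1 (hφ x) i
    have h2 := fun i => hasDerivAt_pi.1 (hχ x) i
    have h3 := fun i => (h1 i).star.mul (h2 i)
    -- Since `k` is real, `X† J + J X = 0`.
    refine (((h3 0).sub (h3 1)).sub (h3 2)).congr_deriv ?_
    rw [matX_mulVec, matX_mulVec]
    simp only [Matrix.cons_val_zero, Matrix.cons_val_one, Matrix.cons_val, star_sub, star_mul',
      star_add, star_star, star_kOf_real]
    have hI : star I = -I := by simp
    rw [hI]
    ring
  exact is_const_of_deriv_eq_zero (fun x => (hd x).differentiableAt) (fun x => (hd x).deriv) x y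

/-- The form of two solutions is determined by their asymptotic behaviour. -/
theorem jform_eq_of_asymptotic {l : Filter ℝ} [l.NeBot] {b b' : ℝ → Fin 3 → ℂ} {K : ℝ} {c : ℂ}
    (hφ : IsSol q₀ q z φ) (hχ : IsSol q₀ q z χ) (hb : ∀ x, ‖b x‖ ≤ K) (hb' : ∀ x, ‖b' x‖ ≤ K)
    (h1 : Tendsto (fun x => φ x - b x) l (𝓝 0)) (h2 : Tendsto (fun x => χ x - b' x) l (𝓝 0))
    (hc : ∀ x, jform (b x) (b' x) = c) (x : ℝ) : jform (φ x) (χ x) = c := by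
  have hK : 0 ≤ K := (norm_nonneg _).trans (hb 0)
  have n1 := tendsto_zero_iff_norm_tendsto_zero.1 h1
  have n2 := tendsto_zero_iff_norm_tendsto_zero.1 h2
  have hlim : Tendsto (fun y => jform (φ y) (χ y) - c) l (𝓝 0) := by
    refine squeeze_zero_norm (a := fun y => 3 * (‖φ y - b y‖ * ‖χ y - b' y‖)
      + 3 * (‖φ y - b y‖ * K) + 3 * (K * ‖χ y - b' y‖)) (fun y => ?_) ?_
    · have e : jform (φ y) (χ y) - c = jform (φ y - b y) (χ y - b' y) + jform (φ y - b y) (b' y)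
          + jform (b y) (χ y - b' y) := by
        rw [← hc y]
        simp only [jform, Pi.sub_apply, star_sub]
        ring
      rw [e]
      refine norm_add₃_le.trans (add_le_add (add_le_add (norm_jform_le _ _)
        ((norm_jform_le _ _).trans ?_)) ((norm_jform_le _ _).trans ?_))
      · gcongr
        exact hb' y
      · gcongr
        exact hb y
    · simpa using (((n1.mul n2).const_mul 3).add ((n1.mul_const K).const_mul 3)).add
        ((n2.const_mul K).const_mul 3)
  have hconst : (fun y => jform (φ y) (χ y) - c) = fun _ => jform (φ x) (χ x) - c := by
    ext y
    rw [jform_eq_of_isSol hφ hχ y x]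
  rw [hconst] at hlim
  exact sub_eq_zero.1 (tendsto_nhds_unique tendsto_const_nhds hlim)

/-- The plane-wave solutions for the constant potential `v`. -/
def eigWave (q₀ : ℝ) (v : Vec2) (z : ℂ) (j : Fin 3) (x : ℝ) : Fin 3 → ℂ :=
  Complex.exp (I * freq q₀ z j * x) • eigCol q₀ v z j

/-- The scalars relating the columns of `matY` to `eigCol`. -/
def colScale (q₀ : ℝ) (z : ℂ) : Fin 3 → ℂ := ![I * rhoHat q₀ z, 1 / q₀, rhoHat q₀ z / q₀]

/-- The time-dependent part of the phases. -/
def timePhase (q₀ σ t : ℝ) (z : ℂ) : Fin 3 → ℂ :=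
  ![2 * lamOf q₀ z * (kOf q₀ z + σ * (3 * kOf q₀ z ^ 2 - lamOf q₀ z ^ 2)) * t,
    -((lamOf q₀ z ^ 2 + kOf q₀ z ^ 2 + 4 * σ * kOf q₀ z ^ 3) * t),
    -(2 * lamOf q₀ z * (kOf q₀ z + σ * (3 * kOf q₀ z ^ 2 - lamOf q₀ z ^ 2)) * t)]

/-- The normalization of the Jost columns relative to `eigWave`. -/
def jostScale (q₀ σ t : ℝ) (z : ℂ) (j : Fin 3) : ℂ :=
  colScale q₀ z j * Complex.exp (I * timePhase q₀ σ t z j)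

theorem matY_mul_expDelta_apply (hq : 0 < q₀) (σ t : ℝ) (w : ℂ) (x : ℝ) (i j : Fin 3) :
    (matY q₀ v w * expDelta q₀ σ w x t) i j = (jostScale q₀ σ t w j • eigWave q₀ v w j x) i := by
  have hq' : (q₀ : ℂ) ≠ 0 := by exact_mod_cast hq.ne'
  have hphase : ∀ j, (![Complex.exp (I * delta₁ q₀ σ w x t), Complex.exp (I * delta₂ q₀ σ w x t),
      Complex.exp (-(I * delta₁ q₀ σ w x t))] : Fin 3 → ℂ) j
      = Complex.exp (I * timePhase q₀ σ t w j) * Complex.exp (I * freq q₀ w j * x) := fun j => by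
    rw [← Complex.exp_add]
    fin_cases j <;> simp [timePhase, freq, delta₁, delta₂] <;> ring_nf
  have hcol : matY q₀ v w i j = colScale q₀ w j * eigCol q₀ v w j i := by
    fin_cases i <;> fin_cases j <;> simp [matY, colScale, eigCol] <;> field_simp
  rw [expDelta, Matrix.mul_diagonal, hphase, hcol]
  simp only [jostScale, eigWave, Pi.smul_apply, smul_eq_mul]
  ring

theorem star_exp_mul_exp {w : ℂ} (hw : star w = w) :
    star (Complex.exp (I * w)) * Complex.exp (I * w) = 1 := by
  have : star (Complex.exp (I * w)) = Complex.exp (-(I * w)) := by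
    rw [← starRingEnd_apply, ← Complex.exp_conj, map_mul, Complex.conj_I, starRingEnd_apply, hw]
    ring_nf
  rw [this, ← Complex.exp_add, neg_add_cancel, Complex.exp_zero]

theorem star_freq_real (j : Fin 3) : star (freq q₀ (z : ℂ) j) = freq q₀ z j :=
  Complex.conj_eq_iff_im.2 (freq_ofReal_im z j)

theorem star_timePhase_real (σ t : ℝ) (j : Fin 3) :
    star (timePhase q₀ σ t (z : ℂ) j) = timePhase q₀ σ t z j := by
  have h1 := star_kOf_real (q₀ := q₀) (z := z)
  have h2 := star_lamOf_real (q₀ := q₀) (z := z)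
  rw [← starRingEnd_apply] at h1 h2
  fin_cases j <;> simp [timePhase, h1, h2]

/-- The time phase is real on the real spectrum, so `σ` and `t` drop out of all diagonal scattering
coefficients. -/
theorem star_jostScale_mul (σ t : ℝ) (j : Fin 3) :
    star (jostScale q₀ σ t (z : ℂ) j) * jostScale q₀ σ t z j
      = star (colScale q₀ z j) * colScale q₀ z j := by
  have h := star_exp_mul_exp (star_timePhase_real (q₀ := q₀) (z := z) σ t j)
  rw [jostScale, star_mul']
  linear_combination (star (colScale q₀ z j) * colScale q₀ z j) * h

/-- The diagonal of `Ŷ† J Ŷ`. -/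
def jDiag (q₀ : ℝ) (z : ℂ) : Fin 3 → ℂ := ![rhoHat q₀ z, -1, -rhoHat q₀ z]

theorem jform_eigCol (hq : 0 < q₀) (hz : z ∈ realSpectrum q₀) (hv : ‖v‖ = q₀) (i j : Fin 3) :
    star (colScale q₀ z i) * colScale q₀ z j * jform (eigCol q₀ v z i) (eigCol q₀ v z j)
      = if i = j then jDiag q₀ z i else 0 := by
  obtain ⟨hz0, hz1⟩ := not_mem_exceptional_iff.1 hz
  have hn := vec2_norm_sq v
  rw [hv] at hn
  push_cast at hn
  simp only [← starRingEnd_apply] at hn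
  have hq' : (q₀ : ℂ) ≠ 0 := by exact_mod_cast hq.ne'
  fin_cases i <;> fin_cases j <;>
    simp [eigCol, colScale, jDiag, jform, rhoHat, perp_zero, perp_one] <;> field_simp <;>
    first
    | (right; ring1)
    | (right; linear_combination -hn)
    | linear_combination -hn
    | linear_combination (-(z : ℂ) ^ 2) * hn
    | (rw [I_sq]; linear_combination -hn)

/-- The phases cancel on the diagonal; off the diagonal they do not, but the eigenvectors are
orthogonal for the form. -/
theorem jform_jostWave (hq : 0 < q₀) (hz : z ∈ realSpectrum q₀) (hv : ‖v‖ = q₀) (σ t : ℝ)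
    (i j : Fin 3) (x : ℝ) :
    jform (jostScale q₀ σ t z i • eigWave q₀ v z i x) (jostScale q₀ σ t z j • eigWave q₀ v z j x)
      = if i = j then jDiag q₀ z i else 0 := by
  have h := jform_eigCol hq hz hv i j
  have hx : ∀ j, star (freq q₀ (z : ℂ) j * x) = freq q₀ z j * x := fun j => by
    rw [star_mul', star_freq_real]
    simp
  have e1 := fun j => star_exp_mul_exp (hx j)
  have e2 := fun j => star_exp_mul_exp (star_timePhase_real (q₀ := q₀) (z := z) σ t j)
  simp only [eigWave, smul_smul]
  rw [jform_smul_smul]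
  simp only [jostScale, star_mul', mul_assoc I]
  split_ifs at h ⊢ with hij
  · subst hij
    rw [← h]
    have e3 := congrArg₂ (· * ·) (e1 i) (e2 i)
    simp only [mul_one] at e3
    linear_combination (star (colScale q₀ z i) * colScale q₀ z i
      * jform (eigCol q₀ v z i) (eigCol q₀ v z i)) * e3
  · linear_combination (star (Complex.exp (I * timePhase q₀ σ t z i))
      * star (Complex.exp (I * (freq q₀ z i * x))) * Complex.exp (I * timePhase q₀ σ t z j)
      * Complex.exp (I * (freq q₀ z j * x))) * h

theorem norm_eigWave (j : Fin 3) (x : ℝ) : ‖eigWave q₀ v z j x‖ = ‖eigCol q₀ v z j‖ := by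
  rw [eigWave, norm_smul, Complex.norm_exp, mul_assoc, Complex.I_mul_re, Complex.im_mul_ofReal,
    freq_ofReal_im]
  simp

end IndefiniteForm

/-! ### Jost matrices, their Gram matrix and the scattering relation -/

section JostColumns

/-- The matrix Jost solution at one real spectral value, column by column. -/
structure IsJostAt (q₀ σ t : ℝ) (q : ℝ → Vec2) (l : Filter ℝ) (v : Vec2) (z : ℝ) (ψ : ℝ → Mat3) :
    Prop where
  sol : ∀ j, IsSol q₀ q z fun x i => ψ x i j
  tendsto : ∀ j, Tendsto (fun x => (fun i => ψ x i j) - jostScale q₀ σ t z j • eigWave q₀ v z j x) l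
    (𝓝 0)

variable {q₀ σ t : ℝ} {v : Vec2} {z : ℝ} {l : Filter ℝ}

theorem isJost_iff {q : ℝ → ℝ → Vec2} {ψ : ℝ → ℝ → Mat3} (hq : 0 < q₀) :
    IsJost q₀ σ q t l v ψ
      ↔ ∀ z ∈ realSpectrum q₀, IsJostAt q₀ σ t (fun x => q x t) l v z (ψ z) := by
  constructor
  · refine fun h z hz => ⟨fun j x => hasDerivAt_pi.2 fun i => h.ode z hz x i j, fun j => ?_⟩
    refine tendsto_pi_nhds.2 fun i => ?_
    have := tendsto_pi_nhds.1 (tendsto_pi_nhds.1 (h.boundary z hz) i) j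
    simpa only [Matrix.sub_apply, Pi.sub_apply, Pi.zero_apply, Matrix.zero_apply,
      matY_mul_expDelta_apply hq] using this
  · refine fun h => ⟨fun z hz x i j => hasDerivAt_pi.1 ((h z hz).sol j x) i, fun z hz => ?_⟩
    refine tendsto_pi_nhds.2 fun i => tendsto_pi_nhds.2 fun j => ?_
    have := tendsto_pi_nhds.1 ((h z hz).tendsto j) i
    simpa only [Matrix.sub_apply, Pi.sub_apply, Pi.zero_apply, Matrix.zero_apply,
      matY_mul_expDelta_apply hq] using this

theorem conjTranspose_mul_matJ_mul (A B : Mat3) (i j : Fin 3) :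
    (A.conjTranspose * matJ * B) i j = jform (fun l => A l i) (fun l => B l j) := by
  rw [matJ, Matrix.mul_apply, Fin.sum_univ_three]
  simp [Matrix.mul_diagonal, jform]
  ring

theorem rhoHat_ne_zero {w : ℂ} (hw : w ∉ exceptional q₀) : rhoHat q₀ w ≠ 0 := by
  obtain ⟨h0, h1⟩ := not_mem_exceptional_iff.1 hw
  exact div_ne_zero (pow_ne_zero 2 h0) h1

theorem jDiag_ne_zero {w : ℂ} (hw : w ∉ exceptional q₀) (j : Fin 3) : jDiag q₀ w j ≠ 0 := by
  have := rhoHat_ne_zero hw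
  fin_cases j <;> simp [jDiag, this]

theorem star_jDiag_real (j : Fin 3) : star (jDiag q₀ (z : ℂ) j) = jDiag q₀ z j := by
  have h := star_rhoHat_real (q₀ := q₀) (z := z)
  rw [← starRingEnd_apply] at h
  fin_cases j <;> simp [jDiag, h]

namespace IsJostAt

variable {q : ℝ → Vec2} {ψ : ℝ → Mat3}

/-- The form is conserved, so the Gram matrix can be read off from the plane waves at infinity. -/
theorem gram [l.NeBot] (hq : 0 < q₀) (hz : z ∈ realSpectrum q₀) (hv : ‖v‖ = q₀)
    (h : IsJostAt q₀ σ t q l v z ψ) (x : ℝ) :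
    (ψ x).conjTranspose * matJ * ψ x = Matrix.diagonal (jDiag q₀ z) := by
  ext i j
  rw [conjTranspose_mul_matJ_mul, Matrix.diagonal_apply]
  refine jform_eq_of_asymptotic (K := max (‖jostScale q₀ σ t z i‖ * ‖eigCol q₀ v z i‖)
    (‖jostScale q₀ σ t z j‖ * ‖eigCol q₀ v z j‖)) (h.sol i) (h.sol j) (fun y => ?_) (fun y => ?_)
    (h.tendsto i) (h.tendsto j) (jform_jostWave hq hz hv σ t i j) x
  · rw [norm_smul, norm_eigWave]
    exact le_max_left _ _
  · rw [norm_smul, norm_eigWave]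
    exact le_max_right _ _

theorem mul_inverse [l.NeBot] (hq : 0 < q₀) (hz : z ∈ realSpectrum q₀) (hv : ‖v‖ = q₀)
    (h : IsJostAt q₀ σ t q l v z ψ) (x : ℝ) :
    ψ x * (Matrix.diagonal (fun j => (jDiag q₀ z j)⁻¹) * ((ψ x).conjTranspose * matJ)) = 1 := by
  rw [mul_eq_one_comm, Matrix.mul_assoc, h.gram hq hz hv, Matrix.diagonal_mul_diagonal]
  rw [← Matrix.diagonal_one]
  congr 1
  ext j
  exact inv_mul_cancel₀ (jDiag_ne_zero hz j)

/-- The difference of the two sides is a solution tending to `0`, hence orthogonal for the form to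
every Jost column; invertibility of the Jost matrix makes it zero. -/
theorem column_eq [l.NeBot] (hq : 0 < q₀) (hz : z ∈ realSpectrum q₀) (hv : ‖v‖ = q₀)
    (h : IsJostAt q₀ σ t q l v z ψ) {φ : ℝ → Fin 3 → ℂ} {j : Fin 3} (hφ : IsSol q₀ q z φ)
    (hlim : Tendsto (fun x => φ x - eigWave q₀ v z j x) l (𝓝 0)) (x : ℝ) :
    (fun i => ψ x i j) = jostScale q₀ σ t z j • φ x := by
  have hf : IsSol q₀ q z fun x => (fun i => ψ x i j) - jostScale q₀ σ t z j • φ x :=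
    (h.sol j).sub (hφ.smul _)
  have hf0 : Tendsto (fun x => (fun i => ψ x i j) - jostScale q₀ σ t z j • φ x) l (𝓝 0) := by
    have := (h.tendsto j).sub (hlim.const_smul (jostScale q₀ σ t z j))
    simp only [smul_zero, sub_zero] at this
    refine this.congr fun y => ?_
    rw [smul_sub]
    abel
  have hz0 : ∀ i, jform (fun l => ψ x l i) ((fun i => ψ x i j) - jostScale q₀ σ t z j • φ x) = 0 :=
    fun i => jform_eq_of_asymptotic (b' := fun _ => 0) (h.sol i) hf
      (fun y => by rw [norm_smul, norm_eigWave])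
      (fun y => by rw [norm_zero]; positivity) (h.tendsto i) (by simpa using hf0)
      (fun y => by simp [jform]) x
  rw [← sub_eq_zero]
  obtain ⟨f, hfd⟩ : ∃ f, f = (fun i => ψ x i j) - jostScale q₀ σ t z j • φ x := ⟨_, rfl⟩
  rw [← hfd] at hz0 ⊢
  have h1 : ((ψ x).conjTranspose * matJ).mulVec f = 0 := by
    ext i
    have := hz0 i
    rw [← Matrix.mulVec_mulVec]
    simpa [jform, matJ, Matrix.mulVec, dotProduct, Fin.sum_univ_three, Matrix.diagonal,
      sub_eq_add_neg] using this
  calc f = (1 : Mat3).mulVec f := (Matrix.one_mulVec f).symm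
    _ = 0 := by
      rw [← h.mul_inverse hq hz hv x, ← Matrix.mulVec_mulVec, ← Matrix.mulVec_mulVec, h1,
        Matrix.mulVec_zero, Matrix.mulVec_zero]

end IsJostAt

/-- The scattering relation at one real spectral value. -/
structure ScatteringAt (q₀ σ t : ℝ) (q : ℝ → Vec2) (qm qp : Vec2) (z : ℝ) (ψm ψp : ℝ → Mat3)
    (H S : Mat3) : Prop where
  minus : IsJostAt q₀ σ t q atBot qm z ψm
  plus : IsJostAt q₀ σ t q atTop qp z ψp
  scattering : ∀ x, ψp x = ψm x * H
  inverse : H * S = 1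

variable {q : ℝ → Vec2} {qm qp : Vec2} {ψm ψp : ℝ → Mat3} {H S : Mat3}

theorem ScatteringData.scatteringAt {q : ℝ → ℝ → Vec2} (hq : 0 < q₀)
    (D : ScatteringData q₀ σ q t qm qp) (hz : z ∈ realSpectrum q₀) :
    ScatteringAt q₀ σ t (fun x => q x t) qm qp z (D.ψm z) (D.ψp z) (D.H z) (D.S z) :=
  ⟨(isJost_iff hq).1 D.jost_minus z hz, (isJost_iff hq).1 D.jost_plus z hz,
    D.scattering z hz, (D.inverse z hz).1⟩

namespace ScatteringAt

theorem jDiag_mul_S (hq : 0 < q₀) (hz : z ∈ realSpectrum q₀) (hqp : ‖qp‖ = q₀)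
    (D : ScatteringAt q₀ σ t q qm qp z ψm ψp H S) (x : ℝ) :
    (ψp x).conjTranspose * matJ * ψm x = Matrix.diagonal (jDiag q₀ z) * S := by
  have h : ψm x = ψp x * S := by
    rw [D.scattering x, Matrix.mul_assoc, D.inverse, Matrix.mul_one]
  rw [h, ← Matrix.mul_assoc, D.plus.gram hq hz hqp]

theorem jDiag_mul_H (hq : 0 < q₀) (hz : z ∈ realSpectrum q₀) (hqm : ‖qm‖ = q₀)
    (D : ScatteringAt q₀ σ t q qm qp z ψm ψp H S) (x : ℝ) :
    (ψm x).conjTranspose * matJ * ψp x = Matrix.diagonal (jDiag q₀ z) * H := by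
  rw [D.scattering x, ← Matrix.mul_assoc, D.minus.gram hq hz hqm]

/-- `H` and `S` arise from the same pairing with the arguments exchanged; the form is Hermitian and
its normalization `jDiag` is real. -/
theorem H_diag (hq : 0 < q₀) (hz : z ∈ realSpectrum q₀) (hqm : ‖qm‖ = q₀) (hqp : ‖qp‖ = q₀)
    (D : ScatteringAt q₀ σ t q qm qp z ψm ψp H S) (j : Fin 3) : H j j = star (S j j) := by
  have h1 := congrFun (congrFun (D.jDiag_mul_S hq hz hqp 0) j) j
  have h2 := congrFun (congrFun (D.jDiag_mul_H hq hz hqm 0) j) j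
  rw [conjTranspose_mul_matJ_mul, Matrix.diagonal_mul] at h1 h2
  have h3 : jform (fun l => ψm 0 l j) (fun l => ψp 0 l j)
      = star (jform (fun l => ψp 0 l j) (fun l => ψm 0 l j)) := by
    simp only [jform, star_sub, star_mul', star_star]
    ring
  rw [h1, h2, star_mul', star_jDiag_real] at h3
  exact mul_left_cancel₀ (jDiag_ne_zero hz j) h3

/-- Any solutions with the right plane-wave asymptotics may stand for the Jost columns, and the form
may be evaluated at `x = 0`. -/
theorem S_diag (hq : 0 < q₀) (hz : z ∈ realSpectrum q₀) (hqm : ‖qm‖ = q₀) (hqp : ‖qp‖ = q₀)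
    (D : ScatteringAt q₀ σ t q qm qp z ψm ψp H S) {j : Fin 3} {φm φp : ℝ → Fin 3 → ℂ}
    (hm : IsSol q₀ q z φm) (hp : IsSol q₀ q z φp)
    (hml : Tendsto (fun x => φm x - eigWave q₀ qm z j x) atBot (𝓝 0))
    (hpl : Tendsto (fun x => φp x - eigWave q₀ qp z j x) atTop (𝓝 0)) :
    jDiag q₀ z j * S j j
      = star (colScale q₀ z j) * colScale q₀ z j * jform (φp 0) (φm 0) := by
  have h1 := congrFun (congrFun (D.jDiag_mul_S hq hz hqp 0) j) j
  rw [conjTranspose_mul_matJ_mul, Matrix.diagonal_mul,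
    D.minus.column_eq hq hz hqm hm hml 0, D.plus.column_eq hq hz hqp hp hpl 0, jform_smul_smul,
    star_jostScale_mul] at h1
  exact h1.symm

end ScatteringAt

end JostColumns

/-! ### Symmetries: reflection of the line and inversion of `z` -/

section Waves

/-- `φ` solves the scattering problem and is asymptotic along `l` to the `j`-th plane wave. -/
structure IsWave (q₀ : ℝ) (q : ℝ → Vec2) (l : Filter ℝ) (v : Vec2) (z : ℝ) (j : Fin 3)
    (φ : ℝ → Fin 3 → ℂ) : Prop where
  sol : IsSol q₀ q z φ
  tendsto : Tendsto (fun x => φ x - eigWave q₀ v z j x) l (𝓝 0)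

variable {q₀ : ℝ} {q : ℝ → Vec2} {v : Vec2} {z : ℝ} {l : Filter ℝ} {φ : ℝ → Fin 3 → ℂ}

theorem hasDerivAt_exp_freq (w : ℂ) (j : Fin 3) (x : ℝ) :
    HasDerivAt (fun x : ℝ => Complex.exp (I * freq q₀ w j * x))
      (Complex.exp (I * freq q₀ w j * x) * (I * freq q₀ w j)) x := by
  have := ((hasDerivAt_id x).ofReal_comp.const_mul (I * freq q₀ w j)).cexp
  simpa using this

theorem norm_exp_freq_real (j : Fin 3) (x : ℝ) :
    ‖Complex.exp (I * freq q₀ (z : ℂ) j * x)‖ = 1 := by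
  rw [Complex.norm_exp, mul_assoc, Complex.I_mul_re, Complex.im_mul_ofReal, freq_ofReal_im]
  simp

theorem isWave_of_reduced {w : ℝ → Fin 3 → ℂ} {j : Fin 3}
    (hd : ∀ x, HasDerivAt w ((matX q₀ (q x) z).mulVec (w x) - (I * freq q₀ z j) • w x) x)
    (hw : Tendsto w l (𝓝 (eigCol q₀ v z j))) :
    IsWave q₀ q l v z j fun x => Complex.exp (I * freq q₀ z j * x) • w x where
  sol x := by
    refine ((hasDerivAt_exp_freq (q₀ := q₀) (z : ℂ) j x).smul (hd x)).congr_deriv ?_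
    rw [Matrix.mulVec_smul]
    module
  tendsto := by
    have h1 : Tendsto (fun x => w x - eigCol q₀ v z j) l (𝓝 0) := by
      simpa using hw.sub_const (eigCol q₀ v z j)
    refine squeeze_zero_norm (fun x => le_of_eq ?_) (tendsto_zero_iff_norm_tendsto_zero.1 h1)
    rw [eigWave, ← smul_sub, norm_smul, norm_exp_freq_real, one_mul]

theorem LeftPotential.isWave_left (h : LeftPotential q₀ q v) (hz : z ∈ realSpectrum q₀)
    (j : Fin 3) :
    IsWave q₀ q atBot v z j fun x => Complex.exp (I * freq q₀ z j * x) • leftSol q₀ q v j z x :=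
  isWave_of_reduced
    (h.hasDerivAt_leftSol hz fun i => LeftPotential.re_I_mul_freq_sub_real z i j)
    (h.tendsto_leftSol fun i => LeftPotential.re_I_mul_freq_sub_real z i j)

theorem kOf_neg (w : ℂ) : kOf q₀ (-w) = -kOf q₀ w := by
  rw [kOf, kOf, div_neg]
  ring

theorem lamOf_neg (w : ℂ) : lamOf q₀ (-w) = -lamOf q₀ w := by
  rw [lamOf, lamOf, div_neg]
  ring

theorem freq_neg (w : ℂ) (j : Fin 3) : freq q₀ (-w) j = -freq q₀ w j := by
  fin_cases j <;> simp [freq, kOf_neg, lamOf_neg]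

theorem matX_neg_mulVec (v : Vec2) (w : ℂ) (u : Fin 3 → ℂ) :
    (matX q₀ (-v) (-w)).mulVec u = -(matX q₀ v w).mulVec u := by
  rw [matX_mulVec, matX_mulVec, kOf_neg]
  ext i
  fin_cases i <;> simp <;> ring

/-- The signs of the eigenvectors under `(v, z) ↦ (-v, -z)`. -/
def reflectSign : Fin 3 → ℂ := ![1, -1, -1]

theorem eigCol_neg (v : Vec2) (w : ℂ) (j : Fin 3) :
    eigCol q₀ (-v) (-w) j = reflectSign j • eigCol q₀ v w j := by
  ext i
  fin_cases j <;> fin_cases i <;> simp [eigCol, reflectSign, perp_zero, perp_one, div_neg] <;> ring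

/-- The potential of the problem reflected at `x = 0`. -/
def reflectPot (q : ℝ → Vec2) (x : ℝ) : Vec2 := -q (-x)

/-- If `χ` solves the problem for `-q(-x)` at `-z`, then `χ(-x)` solves the original one at `z`,
with the ends exchanged. The sign restores the normalization of the eigenvector. -/
theorem LeftPotential.isWave_right (h : LeftPotential q₀ (reflectPot q) (-v))
    (hz : z ∈ realSpectrum q₀) (j : Fin 3) :
    IsWave q₀ q atTop v z j fun x => Complex.exp (I * freq q₀ z j * x) •
      reflectSign j • leftSol q₀ (reflectPot q) (-v) j (-(z : ℂ)) (-x) := by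
  have hz' : -(z : ℂ) ∉ exceptional q₀ := fun h => hz (neg_mem_exceptional_iff.1 h)
  have hc : ∀ i, (I * (freq q₀ (-(z : ℂ)) i - freq q₀ (-(z : ℂ)) j)).re ≤ 0 := fun i => by
    have := LeftPotential.re_I_mul_freq_sub_real (q₀ := q₀) (-z) i j
    rwa [Complex.ofReal_neg] at this
  refine isWave_of_reduced (fun x => ?_) ?_
  · have h1 := (h.hasDerivAt_leftSol hz' hc (-x)).scomp x (hasDerivAt_neg x)
    refine (h1.const_smul (reflectSign j)).congr_deriv ?_
    rw [reflectPot, neg_neg, matX_neg_mulVec, freq_neg, Matrix.mulVec_smul]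
    module
  · have h1 := ((h.tendsto_leftSol hc).comp tendsto_neg_atTop_atBot).const_smul (reflectSign j)
    rw [eigCol_neg, smul_smul] at h1
    have : reflectSign j * reflectSign j = 1 := by fin_cases j <;> simp [reflectSign]
    rwa [this, one_smul] at h1

theorem not_mem_exceptional_inv (hq : 0 < q₀) {w : ℂ} (hw : w ∉ exceptional q₀) :
    (q₀ : ℂ) ^ 2 / w ∉ exceptional q₀ := by
  obtain ⟨h0, h1⟩ := not_mem_exceptional_iff.1 hw
  have hq' : (q₀ : ℂ) ≠ 0 := by exact_mod_cast hq.ne'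
  refine not_mem_exceptional_iff.2 ⟨by positivity, ?_⟩
  have : ((q₀ : ℂ) ^ 2 / w) ^ 2 - (q₀ : ℂ) ^ 2 = -((q₀ : ℂ) ^ 2 * (w ^ 2 - (q₀ : ℂ) ^ 2) / w ^ 2) := by
    field_simp
    ring
  rw [this]
  exact neg_ne_zero.2 (div_ne_zero (mul_ne_zero (pow_ne_zero 2 hq') h1) (pow_ne_zero 2 h0))

theorem inv_mem_realSpectrum (hq : 0 < q₀) (hz : z ∈ realSpectrum q₀) :
    q₀ ^ 2 / z ∈ realSpectrum q₀ := by
  have := not_mem_exceptional_inv hq hz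
  simpa [realSpectrum] using this

theorem kOf_inv (hq : 0 < q₀) {w : ℂ} (hw : w ≠ 0) : kOf q₀ ((q₀ : ℂ) ^ 2 / w) = kOf q₀ w := by
  have hq' : (q₀ : ℂ) ≠ 0 := by exact_mod_cast hq.ne'
  rw [kOf, kOf]
  field_simp
  ring

theorem lamOf_inv (hq : 0 < q₀) {w : ℂ} (hw : w ≠ 0) :
    lamOf q₀ ((q₀ : ℂ) ^ 2 / w) = -lamOf q₀ w := by
  have hq' : (q₀ : ℂ) ≠ 0 := by exact_mod_cast hq.ne'
  rw [lamOf, lamOf]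
  field_simp
  ring

theorem rhoHat_inv (hq : 0 < q₀) {w : ℂ} (hw : w ∉ exceptional q₀) :
    rhoHat q₀ ((q₀ : ℂ) ^ 2 / w) = -((q₀ : ℂ) ^ 2 / w ^ 2 * rhoHat q₀ w) := by
  obtain ⟨h0, h1⟩ := not_mem_exceptional_iff.1 hw
  have h2 := (not_mem_exceptional_iff.1 (not_mem_exceptional_inv hq hw)).2
  have hq' : (q₀ : ℂ) ≠ 0 := by exact_mod_cast hq.ne'
  have : ((q₀ : ℂ) ^ 2 / w) ^ 2 - (q₀ : ℂ) ^ 2 = -((q₀ : ℂ) ^ 2 * (w ^ 2 - (q₀ : ℂ) ^ 2) / w ^ 2) := by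
    field_simp
    ring
  rw [rhoHat, rhoHat, this]
  field_simp

theorem isSol_of_inv (hq : 0 < q₀) (hz : z ∈ realSpectrum q₀)
    (h : IsSol q₀ q ((q₀ ^ 2 / z : ℝ) : ℂ) φ) : IsSol q₀ q z φ := fun x => by
  have hz0 := (not_mem_exceptional_iff.1 hz).1
  refine (h x).congr_deriv ?_
  rw [matX_mulVec, matX_mulVec]
  push_cast
  rw [kOf_inv hq hz0]

/-- The equation depends on `z` only through `k`, which is invariant under inversion, while `λ`
changes sign. The third plane wave at `q₀²/z` is therefore `z` times the first at `z`. -/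
theorem IsWave.of_inv_two (hq : 0 < q₀) (hz : z ∈ realSpectrum q₀)
    (h : IsWave q₀ q l v (q₀ ^ 2 / z) 2 φ) :
    IsWave q₀ q l v z 0 fun x => ((z : ℂ)⁻¹) • φ x where
  sol := (isSol_of_inv hq hz h.sol).smul _
  tendsto := by
    have hz0 := (not_mem_exceptional_iff.1 hz).1
    have hq' : (q₀ : ℂ) ≠ 0 := by exact_mod_cast hq.ne'
    have e : ∀ x, eigWave q₀ v ((q₀ ^ 2 / z : ℝ) : ℂ) 2 x = (z : ℂ) • eigWave q₀ v z 0 x :=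
      fun x => by
        have hf : freq q₀ ((q₀ : ℂ) ^ 2 / z) 2 = freq q₀ z 0 := by
          simp [freq, lamOf_inv hq hz0]
        push_cast
        rw [eigWave, eigWave, hf, smul_comm]
        congr 1
        ext i
        fin_cases i <;> simp [eigCol] <;> field_simp
    have := h.tendsto.const_smul ((z : ℂ)⁻¹)
    rw [smul_zero] at this
    refine this.congr fun x => ?_
    rw [e, smul_sub, smul_smul, inv_mul_cancel₀ hz0, one_smul]

theorem IsWave.of_inv_one (hq : 0 < q₀) (hz : z ∈ realSpectrum q₀)
    (h : IsWave q₀ q l v (q₀ ^ 2 / z) 1 φ) : IsWave q₀ q l v z 1 φ where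
  sol := isSol_of_inv hq hz h.sol
  tendsto := by
    have hz0 := (not_mem_exceptional_iff.1 hz).1
    refine h.tendsto.congr fun x => ?_
    have hf : freq q₀ ((q₀ : ℂ) ^ 2 / z) 1 = freq q₀ z 1 := by
      simp [freq, kOf_inv hq hz0]
    push_cast
    rw [eigWave, eigWave, hf]
    rfl

end Waves

/-! ### Diagonal coefficients as pairings at `x = 0` -/

section ScatteringCoefficients

/-- The coefficient `s₃₃` in the closed upper half-plane, as the form of the left solution and the
reflected right solution at `x = 0`. -/
def scatCoeff (q₀ : ℝ) (q : ℝ → Vec2) (qm qp : Vec2) (z : ℂ) : ℂ :=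
  rhoHat q₀ z / (q₀ : ℂ) ^ 2
    * jform (leftSol q₀ (reflectPot q) (-qp) 2 (-star z) 0) (leftSol q₀ q qm 2 z 0)

/-- The coefficient `s₂₂` on the real line. -/
def scatCoeffMid (q₀ : ℝ) (q : ℝ → Vec2) (qm qp : Vec2) (z : ℝ) : ℂ :=
  1 / (q₀ : ℂ) ^ 2
    * jform (leftSol q₀ (reflectPot q) (-qp) 1 (-(z : ℂ)) 0) (leftSol q₀ q qm 1 z 0)

variable {q₀ σ t : ℝ} {q : ℝ → Vec2} {qm qp : Vec2} {z : ℝ} {ψm ψp : ℝ → Mat3}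
  {H S : Mat3}

namespace ScatteringAt

/-- The negative entry `-ρ̂` of `jDiag` is compensated by the sign `-1` of the reflected third
column. -/
theorem S_two_two (hm : LeftPotential q₀ q qm)
    (hp : LeftPotential q₀ (reflectPot q) (-qp)) (hqp : ‖qp‖ = q₀)
    (hz : z ∈ realSpectrum q₀) (D : ScatteringAt q₀ σ t q qm qp z ψm ψp H S) :
    S 2 2 = scatCoeff q₀ q qm qp z := by
  have hwm := hm.isWave_left hz 2
  have hwp := hp.isWave_right hz 2
  have h := D.S_diag hm.pos hz hm.norm_eq hqp hwm.sol hwp.sol hwm.tendsto hwp.tendsto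
  have hr := rhoHat_ne_zero hz
  have hq' : (q₀ : ℂ) ≠ 0 := by exact_mod_cast hm.pos.ne'
  rw [smul_smul, jform_smul_smul] at h
  have hs := star_rhoHat_real (q₀ := q₀) (z := z)
  simp only [← starRingEnd_apply] at h hs
  simp [jDiag, colScale, reflectSign, hs] at h
  rw [scatCoeff]
  have e : (-star (z : ℂ)) = -(z : ℂ) := by simp
  rw [e]
  refine mul_left_cancel₀ hr ?_
  rw [h]
  field_simp

theorem S_zero_zero (hm : LeftPotential q₀ q qm)
    (hp : LeftPotential q₀ (reflectPot q) (-qp)) (hqp : ‖qp‖ = q₀)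
    (hz : z ∈ realSpectrum q₀) (D : ScatteringAt q₀ σ t q qm qp z ψm ψp H S) :
    S 0 0 = scatCoeff q₀ q qm qp ((q₀ ^ 2 / z : ℝ) : ℂ) := by
  have hzi := inv_mem_realSpectrum hm.pos hz
  have hwm := (hm.isWave_left hzi 2).of_inv_two hm.pos hz
  have hwp := (hp.isWave_right hzi 2).of_inv_two hm.pos hz
  have h := D.S_diag hm.pos hz hm.norm_eq hqp hwm.sol hwp.sol hwm.tendsto hwp.tendsto
  have hr := rhoHat_ne_zero hz
  have hz0 := (not_mem_exceptional_iff.1 hz).1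
  have hq' : (q₀ : ℂ) ≠ 0 := by exact_mod_cast hm.pos.ne'
  rw [smul_smul, smul_smul, smul_smul, jform_smul_smul] at h
  have hs := star_rhoHat_real (q₀ := q₀) (z := z)
  simp only [← starRingEnd_apply] at h hs
  simp [jDiag, colScale, reflectSign, hs] at h
  rw [scatCoeff]
  have e : (-star ((q₀ ^ 2 / z : ℝ) : ℂ)) = -((q₀ : ℂ) ^ 2 / z) := by simp
  rw [e]
  push_cast
  rw [rhoHat_inv hm.pos hz]
  refine mul_left_cancel₀ hr ?_
  rw [h]
  field_simp
  rw [I_sq]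
  ring

/-- The second column is fixed by inversion, whence two formulas: one serves `z → ∞`, the other `z →
0`. -/
theorem S_one_one (hm : LeftPotential q₀ q qm)
    (hp : LeftPotential q₀ (reflectPot q) (-qp)) (hqp : ‖qp‖ = q₀)
    (hz : z ∈ realSpectrum q₀) (D : ScatteringAt q₀ σ t q qm qp z ψm ψp H S) :
    S 1 1 = scatCoeffMid q₀ q qm qp z ∧
    S 1 1 = scatCoeffMid q₀ q qm qp (q₀ ^ 2 / z) := by
  have hzi := inv_mem_realSpectrum hm.pos hz
  have hq' : (q₀ : ℂ) ≠ 0 := by exact_mod_cast hm.pos.ne'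
  constructor
  · have hwm := hm.isWave_left hz 1
    have hwp := hp.isWave_right hz 1
    have h := D.S_diag hm.pos hz hm.norm_eq hqp hwm.sol hwp.sol hwm.tendsto hwp.tendsto
    rw [smul_smul, jform_smul_smul] at h
    simp [jDiag, colScale, reflectSign] at h
    rw [scatCoeffMid, h]
    field_simp
  · have hwm := (hm.isWave_left hzi 1).of_inv_one hm.pos hz
    have hwp := (hp.isWave_right hzi 1).of_inv_one hm.pos hz
    have h := D.S_diag hm.pos hz hm.norm_eq hqp hwm.sol hwp.sol hwm.tendsto hwp.tendsto
    rw [smul_smul, jform_smul_smul] at h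
    simp [jDiag, colScale, reflectSign] at h
    rw [scatCoeffMid, h]
    push_cast
    field_simp

end ScatteringAt

end ScatteringCoefficients

/-! ### Continuation to the half-planes -/

section Extensions

variable {q₀ : ℝ} {f : ℝ → ℂ} {F : ℂ → ℂ}

theorem im_sq_div (q₀ : ℝ) (z : ℂ) : ((q₀ : ℂ) ^ 2 / z).im = -(q₀ ^ 2 * (z.im / Complex.normSq z)) := by
  rw [div_eq_mul_inv, ← Complex.ofReal_pow, Complex.im_ofReal_mul, Complex.inv_im]
  ring

theorem ne_zero_of_im_ne_zero {z : ℂ} (hz : z.im ≠ 0) : z ≠ 0 := by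
  rintro rfl
  simp at hz

theorem differentiableOn_sq_div {s : Set ℂ} (hs : ∀ z ∈ s, z ≠ 0) :
    DifferentiableOn ℂ (fun z => (q₀ : ℂ) ^ 2 / z) s :=
  (differentiableOn_const _).fun_div differentiableOn_id hs

theorem star_mem_exceptional_iff {z : ℂ} : star z ∈ exceptional q₀ ↔ z ∈ exceptional q₀ := by
  have h : star z ^ 2 - (q₀ : ℂ) ^ 2 = star (z ^ 2 - (q₀ : ℂ) ^ 2) := by simp
  rw [← not_iff_not, not_mem_exceptional_iff, not_mem_exceptional_iff, h,
    star_ne_zero, star_ne_zero]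

/-- Inversion exchanges the half-planes and preserves the complement of the exceptional set. -/
theorem ExtendsToUpper.inversion (hq : 0 < q₀) (hF : ExtendsToUpper q₀ f F) :
    ExtendsToLower q₀ (fun x => f (q₀ ^ 2 / x)) (fun z => F ((q₀ : ℂ) ^ 2 / z)) where
  holo := by
    refine hF.holo.comp (differentiableOn_sq_div fun z hz => ne_zero_of_im_ne_zero hz.ne)
      fun z hz => ?_
    have hz' : z.im < 0 := hz
    have hn := Complex.normSq_pos.2 (ne_zero_of_im_ne_zero hz'.ne)
    have := div_neg_of_neg_of_pos hz' hn
    rw [Set.mem_ofPred_eq, im_sq_div]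
    have h2 : 0 < q₀ ^ 2 := by positivity
    nlinarith
  cont := by
    refine hF.cont.comp (differentiableOn_sq_div fun z hz =>
      (not_mem_exceptional_iff.1 hz.2).1).continuousOn fun z hz =>
      ⟨?_, not_mem_exceptional_inv hq hz.2⟩
    have := div_nonpos_of_nonpos_of_nonneg (show z.im ≤ 0 from hz.1) (Complex.normSq_nonneg z)
    rw [Set.mem_ofPred_eq, im_sq_div]
    nlinarith [sq_nonneg q₀]
  boundary z hz := by
    have := hF.boundary _ (inv_mem_realSpectrum hq hz)
    push_cast at this
    exact this

theorem differentiableOn_star_star {s r : Set ℂ} (hr : IsOpen r) (hF : DifferentiableOn ℂ F r)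
    (hs : ∀ z ∈ s, star z ∈ r) : DifferentiableOn ℂ (fun z => star (F (star z))) s :=
  fun z hz => ((hF.differentiableAt (hr.mem_nhds (hs z hz))).star_star
    |> fun h => by simpa using h : DifferentiableAt ℂ (star ∘ F ∘ star) z).differentiableWithinAt

theorem isOpen_im_pos : IsOpen {z : ℂ | 0 < z.im} :=
  isOpen_lt continuous_const Complex.continuous_im

theorem ExtendsToUpper.conj (hF : ExtendsToUpper q₀ f F) :
    ExtendsToLower q₀ (fun x => star (f x)) (fun z => star (F (star z))) where
  holo := differentiableOn_star_star isOpen_im_pos hF.holo fun z hz => by simpa using hz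
  cont := continuous_star.comp_continuousOn (hF.cont.comp continuous_star.continuousOn fun z hz =>
    ⟨by simpa using hz.1, fun h => hz.2 (star_mem_exceptional_iff.1 h)⟩)
  boundary z hz := by
    rw [← hF.boundary z hz]
    simp

theorem ExtendsToLower.conj (hF : ExtendsToLower q₀ f F) :
    ExtendsToUpper q₀ (fun x => star (f x)) (fun z => star (F (star z))) where
  holo := differentiableOn_star_star (isOpen_lt Complex.continuous_im continuous_const) hF.holo
    fun z hz => by simpa using hz
  cont := continuous_star.comp_continuousOn (hF.cont.comp continuous_star.continuousOn fun z hz =>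
    ⟨by simpa using hz.1, fun h => hz.2 (star_mem_exceptional_iff.1 h)⟩)
  boundary z hz := by
    rw [← hF.boundary z hz]
    simp

theorem ExtendsToUpper.congr {g : ℝ → ℂ} (hF : ExtendsToUpper q₀ f F)
    (h : ∀ z ∈ realSpectrum q₀, f z = g z) : ExtendsToUpper q₀ g F :=
  ⟨hF.holo, hF.cont, fun z hz => (hF.boundary z hz).trans (h z hz)⟩

theorem ExtendsToLower.congr {g : ℝ → ℂ} (hF : ExtendsToLower q₀ f F)
    (h : ∀ z ∈ realSpectrum q₀, f z = g z) : ExtendsToLower q₀ g F :=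
  ⟨hF.holo, hF.cont, fun z hz => (hF.boundary z hz).trans (h z hz)⟩

variable {q : ℝ → Vec2} {qm qp : Vec2}

/-- The right column enters at `-z̄`, which lies in the upper half-plane together with `z`, and the
form conjugates its values; the two conjugations make the product holomorphic in `z`. -/
theorem extendsToUpper_scatCoeff (hm : LeftPotential q₀ q qm)
    (hp : LeftPotential q₀ (reflectPot q) (-qp)) :
    ExtendsToUpper q₀ (fun z => scatCoeff q₀ q qm qp z) (scatCoeff q₀ q qm qp) where
  holo := by
    have hsub : {z : ℂ | 0 < z.im} ⊆ (exceptional q₀)ᶜ := fun z hz => by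
      have hz' : z.im ≠ 0 := (show 0 < z.im from hz).ne'
      rintro (rfl | rfl | rfl) <;> simp at hz'
    have h1 := fun i => differentiableOn_pi.1 (hm.differentiableOn_leftSol 0) i
    have h2 : ∀ i, DifferentiableOn ℂ
        (fun z => star (leftSol q₀ (reflectPot q) (-qp) 2 (-star z) 0 i)) {z : ℂ | 0 < z.im} :=
      fun i => by
        refine differentiableOn_star_star (r := {z : ℂ | z.im < 0})
          (F := fun w => leftSol q₀ (reflectPot q) (-qp) 2 (-w) 0 i)
          (isOpen_lt Complex.continuous_im continuous_const) ?_ fun z hz => by simpa using hz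
        exact (differentiableOn_pi.1 (hp.differentiableOn_leftSol 0) i).comp
          (differentiableOn_neg _) fun z hz => by simpa using hz
    have h3 := fun i => (h2 i).mul (h1 i)
    exact ((differentiableOn_rhoHat.mono hsub).div_const _).mul (((h3 0).sub (h3 1)).sub (h3 2))
  cont := by
    have hsub : {z : ℂ | 0 ≤ z.im} \ exceptional q₀ ⊆ (exceptional q₀)ᶜ := fun z hz => hz.2
    have h1 := fun i => continuousOn_pi.1 (hm.continuousOn_leftSol 0) i
    have h2 : ∀ i, ContinuousOn
        (fun z => star (leftSol q₀ (reflectPot q) (-qp) 2 (-star z) 0 i))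
        ({z : ℂ | 0 ≤ z.im} \ exceptional q₀) := fun i => by
      refine continuous_star.comp_continuousOn ((continuousOn_pi.1 (hp.continuousOn_leftSol 0) i).comp
        continuous_star.neg.continuousOn fun z hz => ⟨by simpa using hz.1, fun h => hz.2 ?_⟩)
      exact star_mem_exceptional_iff.1 (neg_mem_exceptional_iff.1 h)
    have h3 := fun i => (h2 i).mul (h1 i)
    exact ((differentiableOn_rhoHat.continuousOn.mono hsub).div_const _).mul
      (((h3 0).sub (h3 1)).sub (h3 2))
  boundary _ _ := rfl

end Extensions

/-! ### Existence of the scattering data -/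

section Existence

variable {q₀ σ t : ℝ} {q : ℝ → ℝ → Vec2} {qm qp : Vec2}

theorem isJostAt_of_isWave {q : ℝ → Vec2} {l : Filter ℝ} {v : Vec2} {z : ℝ}
    {φ : Fin 3 → ℝ → Fin 3 → ℂ} (h : ∀ j, IsWave q₀ q l v z j (φ j)) :
    IsJostAt q₀ σ t q l v z fun x => Matrix.of fun i j => (jostScale q₀ σ t z j • φ j x) i where
  sol j := (h j).sol.smul _
  tendsto j := by
    have := (h j).tendsto.const_smul (jostScale q₀ σ t z j)
    rw [smul_zero] at this
    refine this.congr fun x => ?_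
    rw [smul_sub]
    rfl

/-- Two families of Jost solutions determine a scattering matrix and its inverse. -/
theorem exists_scattering_matrix {q : ℝ → Vec2} {z : ℝ} {ψm ψp : ℝ → Mat3} (hq : 0 < q₀)
    (hz : z ∈ realSpectrum q₀) (hqm : ‖qm‖ = q₀) (hqp : ‖qp‖ = q₀)
    (hm : IsJostAt q₀ σ t q atBot qm z ψm) (hp : IsJostAt q₀ σ t q atTop qp z ψp) :
    ∃ H S : Mat3, (∀ x, ψp x = ψm x * H) ∧ H * S = 1 ∧ S * H = 1 := by
  set C : Mat3 := Matrix.diagonal fun j => (jDiag q₀ z j)⁻¹ with hC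
  have im := hm.mul_inverse hq hz hqm
  have ip := hp.mul_inverse hq hz hqp
  -- The candidate `H = C ψ₋† J ψ₊` is independent of `x` by conservation of the form.
  have hconst : ∀ x, (ψm x).conjTranspose * matJ * ψp x = (ψm 0).conjTranspose * matJ * ψp 0 :=
    fun x => by
      ext i j
      rw [conjTranspose_mul_matJ_mul, conjTranspose_mul_matJ_mul]
      exact jform_eq_of_isSol (hm.sol i) (hp.sol j) x 0
  have hHS : (C * ((ψm 0).conjTranspose * matJ) * ψp 0)
      * (C * ((ψp 0).conjTranspose * matJ) * ψm 0) = 1 := by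
    calc _ = C * ((ψm 0).conjTranspose * matJ)
          * (ψp 0 * (C * ((ψp 0).conjTranspose * matJ))) * ψm 0 := by
          simp only [Matrix.mul_assoc]
      _ = 1 := by rw [ip, Matrix.mul_one]; exact mul_eq_one_comm.1 (im 0)
  refine ⟨_, _, fun x => ?_, hHS, mul_eq_one_comm.1 hHS⟩
  calc ψp x = ψm x * (C * ((ψm x).conjTranspose * matJ)) * ψp x := by rw [im, Matrix.one_mul]
    _ = ψm x * (C * ((ψm x).conjTranspose * matJ * ψp x)) := by simp only [Matrix.mul_assoc]
    _ = _ := by rw [hconst]; simp only [Matrix.mul_assoc]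

/-- The continuations of the scattering coefficients. -/
theorem extensions {q : ℝ → Vec2} {ψm ψp : ℝ → ℝ → Mat3} {H S : ℝ → Mat3}
    (hm : LeftPotential q₀ q qm) (hp : LeftPotential q₀ (reflectPot q) (-qp)) (hqp : ‖qp‖ = q₀)
    (hA : ∀ z ∈ realSpectrum q₀, ScatteringAt q₀ σ t q qm qp z (ψm z) (ψp z) (H z) (S z)) :
    ExtendsToLower q₀ (fun z => S z 0 0) (fun z => scatCoeff q₀ q qm qp ((q₀ : ℂ) ^ 2 / z)) ∧
    ExtendsToUpper q₀ (fun z => S z 2 2) (scatCoeff q₀ q qm qp) ∧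
    ExtendsToUpper q₀ (fun z => H z 0 0)
      (fun z => star (scatCoeff q₀ q qm qp ((q₀ : ℂ) ^ 2 / star z))) ∧
    ExtendsToLower q₀ (fun z => H z 2 2) (fun z => star (scatCoeff q₀ q qm qp (star z))) := by
  have hq := hm.pos
  have h33 := extendsToUpper_scatCoeff hm hp
  have h11 := h33.inversion hq
  have hH := fun z hz j => (hA z hz).H_diag hq hz hm.norm_eq hqp j
  have h0 := fun z hz => (hA z hz).S_zero_zero hm hp hqp hz
  have h2 := fun z hz => (hA z hz).S_two_two hm hp hqp hz
  exact ⟨h11.congr fun z hz => (h0 z hz).symm, h33.congr fun z hz => (h2 z hz).symm,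
    h11.conj.congr fun z hz => by rw [hH z hz, h0 z hz],
    h33.conj.congr fun z hz => by rw [hH z hz, h2 z hz]⟩

theorem nonempty_scatteringData (hm : LeftPotential q₀ (fun x => q x t) qm)
    (hp : LeftPotential q₀ (reflectPot fun x => q x t) (-qp)) (hqp : ‖qp‖ = q₀) :
    Nonempty (ScatteringData q₀ σ q t qm qp) := by
  have hq := hm.pos
  let ψm : ℝ → ℝ → Mat3 := fun z x => Matrix.of fun i j => (jostScale q₀ σ t z j •
    (Complex.exp (I * freq q₀ z j * x) • leftSol q₀ (fun x => q x t) qm j z x)) i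
  let ψp : ℝ → ℝ → Mat3 := fun z x => Matrix.of fun i j => (jostScale q₀ σ t z j •
    (Complex.exp (I * freq q₀ z j * x) • reflectSign j •
      leftSol q₀ (reflectPot fun x => q x t) (-qp) j (-(z : ℂ)) (-x))) i
  have hψm : ∀ z ∈ realSpectrum q₀, IsJostAt q₀ σ t (fun x => q x t) atBot qm z (ψm z) :=
    fun z hz => isJostAt_of_isWave (hm.isWave_left hz)
  have hψp : ∀ z ∈ realSpectrum q₀, IsJostAt q₀ σ t (fun x => q x t) atTop qp z (ψp z) :=
    fun z hz => isJostAt_of_isWave (hp.isWave_right hz)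
  -- Nothing is required of the matrices at exceptional values; zero serves there.
  have hHS : ∀ z, ∃ HS : Mat3 × Mat3, z ∈ realSpectrum q₀ →
      (∀ x, ψp z x = ψm z x * HS.1) ∧ HS.1 * HS.2 = 1 ∧ HS.2 * HS.1 = 1 := fun z => by
    by_cases hz : z ∈ realSpectrum q₀
    · obtain ⟨H, S, h⟩ := exists_scattering_matrix hq hz hm.norm_eq hqp (hψm z hz) (hψp z hz)
      exact ⟨(H, S), fun _ => h⟩
    · exact ⟨(0, 0), fun h => absurd h hz⟩
  choose HS hHS using hHS
  have hA : ∀ z ∈ realSpectrum q₀, ScatteringAt q₀ σ t (fun x => q x t) qm qp z (ψm z) (ψp z)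
      (HS z).1 (HS z).2 := fun z hz =>
    ⟨hψm z hz, hψp z hz, (hHS z hz).1, (hHS z hz).2.1⟩
  obtain ⟨e₁₁, e₃₃, g₁₁, g₃₃⟩ := extensions hm hp hqp hA
  exact ⟨{
    ψm := ψm
    ψp := ψp
    H := fun z => (HS z).1
    S := fun z => (HS z).2
    s₁₁ := _
    s₃₃ := _
    h₁₁ := _
    h₃₃ := _
    jost_minus := (isJost_iff hq).2 hψm
    jost_plus := (isJost_iff hq).2 hψp
    scattering := fun z hz => (hHS z hz).1
    inverse := fun z hz => (hHS z hz).2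
    s₁₁_ext := e₁₁
    s₃₃_ext := e₃₃
    h₁₁_ext := g₁₁
    h₃₃_ext := g₃₃ }⟩

end Existence

/-! ### Reflection of the hypotheses on the potential -/

section Potential

theorem exists_norm_le_of_tendsto {f : ℝ → Vec2} {a b : Vec2} (hf : Continuous f)
    (ha : Tendsto f atBot (𝓝 a)) (hb : Tendsto f atTop (𝓝 b)) : ∃ R, ∀ x, ‖f x‖ ≤ R := by
  obtain ⟨A, hA⟩ := eventually_atBot.1 (ha.norm.eventually_le_const (lt_add_one _))
  obtain ⟨B, hB⟩ := eventually_atTop.1 (hb.norm.eventually_le_const (lt_add_one _))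
  obtain ⟨C, hC⟩ := isCompact_Icc.exists_bound_of_continuousOn (s := Set.Icc A B) hf.continuousOn
  refine ⟨max (max (‖a‖ + 1) (‖b‖ + 1)) C, fun x => ?_⟩
  rcases le_total x A with h | h
  · exact (hA x h).trans ((le_max_left _ _).trans (le_max_left _ _))
  rcases le_total B x with h' | h'
  · exact (hB x h').trans ((le_max_right _ _).trans (le_max_left _ _))
  · exact (hC x ⟨h, h'⟩).trans (le_max_right _ _)

theorem integrableOn_Iic_comp_neg {F : Type*} [NormedAddCommGroup F] {f : ℝ → F}
    (hf : IntegrableOn f (Set.Ici 0)) : IntegrableOn (fun x => f (-x)) (Set.Iic 0) := by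
  have := ((Measure.measurePreserving_neg (volume : Measure ℝ)).integrableOn_comp_preimage
    (Homeomorph.neg ℝ).measurableEmbedding (f := f) (s := Set.Ici 0)).2 hf
  simpa [Function.comp_def] using this

variable {q₀ : ℝ} {q : ℝ → Vec2} {qm qp : Vec2}

theorem leftPotential_reflectPot (hq : 0 < q₀) (hqp : ‖qp‖ = q₀) (hlim : Tendsto q atTop (𝓝 qp))
    (hb : ∃ R, ∀ x, ‖q x‖ ≤ R) (hint : IntegrableOn (fun x => (1 + |x|) • (q x - qp)) (Set.Ici 0))
    (hd : Differentiable ℝ q) (hdi : Integrable (deriv q)) :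
    LeftPotential q₀ (reflectPot q) (-qp) where
  pos := hq
  norm_eq := by rw [norm_neg, hqp]
  tendsto := (hlim.comp tendsto_neg_atBot_atTop).neg
  bdd := by
    obtain ⟨R, hR⟩ := hb
    exact ⟨R, fun x => by rw [reflectPot, norm_neg]; exact hR _⟩
  integrableOn := by
    refine (integrableOn_Iic_comp_neg hint).neg.congr (Eventually.of_forall fun x => ?_)
    simp only [Pi.neg_apply, reflectPot, abs_neg]
    rw [← smul_neg]
    congr 1
    abel
  diff := by
    unfold reflectPot
    fun_prop
  deriv_integrableOn := by
    have h : deriv (reflectPot q) = fun x => deriv q (-x) := by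
      ext1 x
      have := ((hd (-x)).hasDerivAt.scomp x (hasDerivAt_neg x)).neg
      simp only [neg_smul, one_smul, neg_neg] at this
      exact this.deriv
    rw [h]
    exact hdi.comp_neg.integrableOn

end Potential

/-! ### The orthogonal basis formed by the boundary vectors -/

section Orthogonality

variable {q₀ : ℝ} {qm qp : Vec2}

theorem vec2_resolution (v x y : Vec2) : ((‖v‖ ^ 2 : ℝ) : ℂ) * inner ℂ x y
    = inner ℂ x v * inner ℂ v y + inner ℂ x (perp v) * inner ℂ (perp v) y := by
  rw [← vec2_norm_sq]
  simp only [inner_vec2, perp_zero, perp_one, star_neg, star_star]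
  ring

/-- A vector of the same length orthogonal to `v` is `v^⊥` up to a phase. -/
theorem exists_phase_of_orthogonal (hq : 0 < q₀) (hqm : ‖qm‖ = q₀) (hqp : ‖qp‖ = q₀)
    (horth : inner ℂ qp qm = 0) : ∃ ϑ : ℝ, qp = Complex.exp (-(I * ϑ)) • perp qm := by
  have hq' : (q₀ : ℂ) ≠ 0 := by exact_mod_cast hq.ne'
  have horth' : inner ℂ qm qp = 0 := by rw [← inner_conj_symm, horth, map_zero]
  obtain ⟨c, hc⟩ : ∃ c : ℂ, c = inner ℂ (perp qm) qp / (q₀ : ℂ) ^ 2 := ⟨_, rfl⟩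
  have h1 : qp = c • perp qm := by
    refine ext_inner_left ℂ fun x => ?_
    have := vec2_resolution qm x qp
    rw [hqm, horth', mul_zero, zero_add] at this
    push_cast at this
    rw [inner_smul_right, hc]
    field_simp
    linear_combination this
  have hcn : ‖c‖ = 1 := by
    have := congrArg norm h1
    rw [norm_smul, perp_norm, hqm, hqp] at this
    exact mul_right_cancel₀ hq.ne' (by rw [one_mul]; exact this.symm)
  refine ⟨-Complex.arg c, ?_⟩
  have : Complex.exp (-(I * ((-Complex.arg c : ℝ) : ℂ))) = c := by
    have h := Complex.norm_mul_exp_arg_mul_I c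
    rw [hcn] at h
    rw [ofReal_one, one_mul] at h
    refine Eq.trans ?_ h
    push_cast
    rw [mul_neg, neg_neg, mul_comm]
  rw [this]
  exact h1

/-- `q₊` is a phase times `q₋^⊥`, and the phase cancels. Expanding in this basis separates the
components of a column with known size from the small ones. -/
theorem inner_resolution (hq : 0 < q₀) (hqm : ‖qm‖ = q₀) (hqp : ‖qp‖ = q₀)
    (horth : inner ℂ qp qm = 0) (x y : Vec2) : (q₀ : ℂ) ^ 2 * inner ℂ x y
      = inner ℂ x qm * inner ℂ qm y + inner ℂ x qp * inner ℂ qp y := by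
  obtain ⟨ϑ, hϑ⟩ := exists_phase_of_orthogonal hq hqm hqp horth
  have h := vec2_resolution qm x y
  rw [hqm] at h
  push_cast at h
  rw [h, hϑ, inner_smul_left, inner_smul_right]
  have he := star_exp_mul_exp (w := -(ϑ : ℂ)) (by simp)
  rw [mul_neg, ← starRingEnd_apply] at he
  linear_combination (-inner ℂ x (perp qm) * inner ℂ (perp qm) y) * he

theorem norm_sq_resolution {v p : Vec2} (h : ∀ x y : Vec2, (q₀ : ℂ) ^ 2 * inner ℂ x y
      = inner ℂ x v * inner ℂ v y + inner ℂ x p * inner ℂ p y) (y : Vec2) :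
    q₀ ^ 2 * ‖y‖ ^ 2 = ‖(inner ℂ v y : ℂ)‖ ^ 2 + ‖(inner ℂ p y : ℂ)‖ ^ 2 := by
  have h1 := h y y
  rw [inner_self_eq_norm_sq_to_K, ← inner_conj_symm y v, ← inner_conj_symm y p,
    Complex.conj_mul', Complex.conj_mul'] at h1
  refine Complex.ofReal_injective ?_
  push_cast
  exact h1

end Orthogonality

/-! ### The integral `ϑ₁` and its two halves -/

section ThetaOne

variable {q₀ : ℝ} {q : ℝ → Vec2} {v p qm qp : Vec2}

/-- By `p ⟂ v` the first factor equals `p†(q - v)`, which is integrable; the second is bounded. -/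
theorem LeftPotential.integrableOn_inner_mul_inner (h : LeftPotential q₀ q v)
    (hp : inner ℂ p v = 0) :
    IntegrableOn (fun x => inner ℂ p (q x) * inner ℂ (q x) v) (Set.Iic 0) := by
  obtain ⟨R, hR⟩ := h.bdd
  have hqc := h.continuous
  refine Integrable.mono' (h.integrableOn_sub.norm.const_mul (‖p‖ * (R * ‖v‖))) (by fun_prop)
    (Eventually.of_forall fun x => ?_)
  have e : (inner ℂ p (q x) : ℂ) = inner ℂ p (q x - v) := by rw [inner_sub_right, hp, sub_zero]
  rw [norm_mul, e]
  have h1 : ‖(inner ℂ (q x) v : ℂ)‖ ≤ R * ‖v‖ :=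
    (norm_inner_le_norm _ _).trans (by gcongr; exact hR x)
  calc _ ≤ (‖p‖ * ‖q x - v‖) * (R * ‖v‖) :=
        mul_le_mul (norm_inner_le_norm _ _) h1 (norm_nonneg _) (by positivity)
    _ = _ := by ring

/-- The integrand of `ϑ₁` on the right half-line in terms of the reflected potential. -/
theorem inner_reflectPot (x : ℝ) :
    (inner ℂ qm (reflectPot q x) * inner ℂ (reflectPot q x) (-qp) : ℂ)
      = -star (inner ℂ qp (q (-x)) * inner ℂ (q (-x)) qm) := by
  rw [← starRingEnd_apply, map_mul, inner_conj_symm, inner_conj_symm]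
  simp only [reflectPot, inner_neg_left, inner_neg_right]
  ring

theorem integrable_thetaOne (hm : LeftPotential q₀ q qm)
    (hp : LeftPotential q₀ (reflectPot q) (-qp)) (horth : inner ℂ qp qm = 0) :
    Integrable fun x => inner ℂ qp (q x) * inner ℂ (q x) qm := by
  have h1 := hm.integrableOn_inner_mul_inner horth
  have h2 := hp.integrableOn_inner_mul_inner (p := qm)
    (by rw [inner_neg_right, ← inner_conj_symm, horth, map_zero, neg_zero])
  simp only [inner_reflectPot] at h2
  have h3 : IntegrableOn (fun x => inner ℂ qp (q (-x)) * inner ℂ (q (-x)) qm) (Set.Iic 0) := by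
    refine (integrable_norm_iff ?_).1 ?_
    · have := hm.continuous
      fun_prop
    · refine h2.norm.congr (Eventually.of_forall fun x => ?_)
      simp only [norm_neg, norm_star]
  have h4 : IntegrableOn (fun x => inner ℂ qp (q x) * inner ℂ (q x) qm) (Set.Ici 0) := by
    have := ((Measure.measurePreserving_neg (volume : Measure ℝ)).integrableOn_comp_preimage
      (Homeomorph.neg ℝ).measurableEmbedding
      (f := fun x => inner ℂ qp (q x) * inner ℂ (q x) qm) (s := Set.Ici 0)).1
      (by simpa [Function.comp_def] using h3)
    exact this
  rw [← integrableOn_univ, ← Set.Iic_union_Ici (a := (0 : ℝ))]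
  exact h1.union h4

/-- The right half appears as minus the conjugate of the integral belonging to the reflected
problem, the form in which the right column delivers it. -/
theorem integral_thetaOne_split
    (h : Integrable fun x => (inner ℂ qp (q x) * inner ℂ (q x) qm : ℂ)) :
    ∫ x, (inner ℂ qp (q x) * inner ℂ (q x) qm : ℂ)
      = (∫ x in Set.Iic 0, inner ℂ qp (q x) * inner ℂ (q x) qm)
        - star (∫ x in Set.Iic 0,
          (inner ℂ qm (reflectPot q x) * inner ℂ (reflectPot q x) (-qp) : ℂ)) := by
  have h1 := integral_comp_neg_Iic (0 : ℝ) fun x => (inner ℂ qp (q x) * inner ℂ (q x) qm : ℂ)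
  rw [neg_zero] at h1
  simp only [inner_reflectPot]
  rw [integral_neg, star_neg, sub_neg_eq_add]
  have h2 : star (∫ x in Set.Iic (0 : ℝ), star (inner ℂ qp (q (-x)) * inner ℂ (q (-x)) qm : ℂ))
      = ∫ x in Set.Iic (0 : ℝ), (inner ℂ qp (q (-x)) * inner ℂ (q (-x)) qm : ℂ) := by
    have := integral_conj (μ := volume.restrict (Set.Iic (0 : ℝ)))
      (f := fun x => star (inner ℂ qp (q (-x)) * inner ℂ (q (-x)) qm : ℂ))
    rw [← starRingEnd_apply, ← this]
    simp only [starRingEnd_apply, star_star]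
  rw [h2, h1]
  exact (intervalIntegral.integral_Iic_add_Ioi h.integrableOn h.integrableOn).symm

end ThetaOne

/-! ### Expansion of the coefficients at infinity -/

section LargeZ

variable {q₀ : ℝ} {q : ℝ → Vec2} {v p qm qp : Vec2}

theorem jform_eq_inner (φ χ : Fin 3 → ℂ) :
    jform φ χ = star (φ 0) * χ 0 - inner ℂ (lowerPart φ) (lowerPart χ) := by
  rw [jform, inner_vec2, lowerPart_zero, lowerPart_one, lowerPart_zero, lowerPart_one]
  ring

theorem isBigO_inv_of_le {α : Type*} {l : Filter α} {s : α → ℂ} {f : α → ℂ} {C : ℝ} (n : ℕ)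
    (h : ∀ᶠ x in l, ‖f x‖ ≤ C / ‖s x‖ ^ n) : f =O[l] fun x => (s x)⁻¹ ^ n := by
  refine IsBigO.of_bound C (h.mono fun x hx => hx.trans_eq ?_)
  rw [norm_pow, norm_inv, inv_pow, div_eq_mul_inv]

theorem eventually_upper_cobounded (q₀ : ℝ) :
    ∀ᶠ z in Bornology.cobounded ℂ ⊓ 𝓟 {z : ℂ | 0 ≤ z.im}, 0 ≤ z.im ∧ 2 * q₀ ≤ ‖z‖ ∧ 1 ≤ ‖z‖ := by
  rw [eventually_inf_principal]
  filter_upwards [eventually_cobounded_le_norm (E := ℂ) (2 * q₀),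
    eventually_cobounded_le_norm (E := ℂ) 1] with z h1 h2 hz
  exact ⟨hz, h1, h2⟩

theorem isBigO_inv_one_cobounded {s : Set ℂ} :
    (fun z : ℂ => z⁻¹) =O[Bornology.cobounded ℂ ⊓ 𝓟 s] fun _ => (1 : ℂ) :=
  (tendsto_inv₀_cobounded.mono_left inf_le_left).isBigO_one ℂ

/-- Expansion of `r (e f - (d a + c b) / m) / m` when `a → m`, `c → -m`, `r → 1`, and `b`, `d` are
`O(1/z)` with known leading terms. -/
theorem isBigO_expansion {l : Filter ℂ} {a b c d e f r : ℂ → ℂ} {m θ θ' : ℂ} (hm : m ≠ 0)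
    (o1 : (fun z : ℂ => z⁻¹) =O[l] fun _ => (1 : ℂ))
    (ha : (fun z => a z - m) =O[l] fun z => z⁻¹)
    (hb : (fun z => b z - I * θ * z⁻¹) =O[l] fun z => z⁻¹ ^ 2)
    (hc : (fun z => c z + m) =O[l] fun z => z⁻¹)
    (hd : (fun z => d z - I * θ' * z⁻¹) =O[l] fun z => z⁻¹ ^ 2)
    (he : e =O[l] fun z => z⁻¹) (hf : f =O[l] fun z => z⁻¹)
    (hr : (fun z => r z - 1) =O[l] fun z => z⁻¹ ^ 2) :
    (fun z => r z / m * (e z * f z - m⁻¹ * (d z * a z + c z * b z)) - I * (θ - θ') / (m * z))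
      =O[l] fun z => z⁻¹ ^ 2 := by
  have hcst : ∀ c : ℂ, (fun _ : ℂ => c) =O[l] fun _ => (1 : ℂ) := fun c =>
    isBigO_const_const c one_ne_zero l
  have ha1 : a =O[l] fun _ => (1 : ℂ) :=
    ((ha.trans o1).add (hcst m)).congr_left fun z => sub_add_cancel _ _
  have hc1 : c =O[l] fun _ => (1 : ℂ) :=
    ((hc.trans o1).sub (hcst m)).congr_left fun z => add_sub_cancel_right _ _
  have hlin : ∀ c : ℂ, (fun z : ℂ => c * z⁻¹) =O[l] fun z => z⁻¹ := fun c =>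
    (isBigO_refl _ _).const_mul_left c
  have o2 : (fun z : ℂ => z⁻¹ ^ 2) =O[l] fun _ => (1 : ℂ) := by simpa using o1.pow 2
  -- The four products telescope to `d a + c b` minus its leading part `m (i θ' - i θ) / z`.
  have hsum := (((hd.mul ha1).congr_right fun z => mul_one _).add
    (((hlin (I * θ')).mul ha).congr_right fun z => (sq _).symm)).add
    (((hb.mul hc1).congr_right fun z => mul_one _).add
      (((hlin (I * θ)).mul hc).congr_right fun z => (sq _).symm))
  have hX := ((he.mul hf).congr_right fun z => (sq _).symm).sub
    (hsum.const_mul_left m⁻¹)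
  have hX1 := (hX.trans o2).add ((hlin (I * (θ - θ'))).trans o1)
  have hfin := (((hr.mul hX1).congr_right fun z => mul_one _).add hX).const_mul_left
    m⁻¹
  refine hfin.congr_left fun z => ?_
  rw [div_eq_mul_inv (I * _), mul_inv]
  field_simp
  ring

/-- The left column is close to `q₋` and the reflected right column to `-q₊`, so `jform` has no term
of order one by orthogonality. Its `1/z` term pairs each limit vector with the transverse component
of the other column; the product of first components is already second order. -/
theorem isBigO_scatCoeff (hm : LeftPotential q₀ q qm) (hp : LeftPotential q₀ (reflectPot q) (-qp))
    (horth : inner ℂ qp qm = 0) :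
    (fun z : ℂ => scatCoeff q₀ q qm qp z
        - I * (∫ x, inner ℂ qp (q x) * inner ℂ (q x) qm) / ((q₀ : ℂ) ^ 2 * z))
      =O[Bornology.cobounded ℂ ⊓ 𝓟 {z : ℂ | 0 ≤ z.im}] fun z => 1 / z ^ 2 := by
  have hq' : (q₀ : ℂ) ≠ 0 := by exact_mod_cast hm.pos.ne'
  have hqp : ‖qp‖ = q₀ := by rw [← norm_neg, hp.norm_eq]
  have horth' : inner ℂ qm (-qp) = 0 := by
    rw [inner_neg_right, ← inner_conj_symm, horth, map_zero, neg_zero]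
  have hres := inner_resolution hm.pos hm.norm_eq hqp horth
  have hres' : ∀ x y : Vec2, (q₀ : ℂ) ^ 2 * inner ℂ x y
      = inner ℂ x (-qp) * inner ℂ (-qp) y + inner ℂ x qm * inner ℂ qm y := fun x y => by
    rw [hres, inner_neg_left, inner_neg_right]; ring
  obtain ⟨C, -, hC⟩ := hm.exists_leftSol_two_bound horth (norm_sq_resolution hres)
  obtain ⟨C', -, hC'⟩ := hp.exists_leftSol_two_bound horth' (norm_sq_resolution hres')
  rw [integral_thetaOne_split (integrable_thetaOne hm hp horth)]
  set θ := ∫ x in Set.Iic 0, (inner ℂ qp (q x) * inner ℂ (q x) qm : ℂ)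
  set θr := ∫ x in Set.Iic 0,
    (inner ℂ qm (reflectPot q x) * inner ℂ (reflectPot q x) (-qp) : ℂ)
  set l := Bornology.cobounded ℂ ⊓ 𝓟 {z : ℂ | 0 ≤ z.im}
  have hev : ∀ᶠ z in l, 0 ≤ z.im ∧ 2 * q₀ ≤ ‖z‖ ∧ 1 ≤ ‖z‖ := eventually_upper_cobounded q₀
  set w : ℂ → Fin 3 → ℂ := fun z => leftSol q₀ q qm 2 z 0
  set w' : ℂ → Fin 3 → ℂ := fun z => leftSol q₀ (reflectPot q) (-qp) 2 (-star z) 0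
  -- The bounds for the reflected column at `-z̄` are conjugated, which swaps the arguments of the
  -- inner product and replaces `θr` by its conjugate.
  have hCr : ∀ᶠ z in l, ‖w' z 0‖ ≤ C' / ‖z‖ ∧
      ‖inner ℂ (lowerPart (w' z)) qp + (q₀ : ℂ) ^ 2‖ ≤ C' / ‖z‖ ∧
      ‖inner ℂ (lowerPart (w' z)) qm - I * star θr * z⁻¹‖ ≤ C' / ‖z‖ ^ 2 := by
    refine hev.mono fun z hz => ?_
    have hn : ‖-star z‖ = ‖z‖ := by rw [norm_neg, norm_star]
    obtain ⟨h1, h2, h3⟩ := hC' (-star z) (by simpa using hz.1) (by rw [hn]; exact hz.2.1)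
      (by rw [hn]; exact hz.2.2)
    rw [hn] at h1 h2 h3
    refine ⟨h1, ?_, ?_⟩
    · refine le_trans (le_of_eq ?_) h2
      rw [← norm_neg, ← RCLike.norm_conj]
      congr 1
      simp only [map_neg, map_add, map_pow, inner_conj_symm, conj_ofReal, inner_neg_left]
      ring
    · refine le_trans (le_of_eq ?_) h3
      rw [← RCLike.norm_conj]
      congr 1
      rw [map_sub, map_mul, map_mul, inner_conj_symm, conj_I, map_inv₀, starRingEnd_apply,
        star_star, starRingEnd_apply, div_eq_mul_inv, inv_neg]
      ring
  have hinv : (fun z : ℂ => z⁻¹ ^ 1) =O[l] fun z => z⁻¹ := by simpa using isBigO_refl _ _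
  have hw : (fun z => w z 0) =O[l] fun z => z⁻¹ :=
    (isBigO_inv_of_le (C := C) 1 (hev.mono fun z hz => by
      simpa using (hC z hz.1 hz.2.1 hz.2.2).1)).trans hinv
  have hw' : (fun z => star (w' z 0)) =O[l] fun z => z⁻¹ :=
    (isBigO_inv_of_le (C := C') 1 (hCr.mono fun z hz => by
      simpa using hz.1)).trans hinv
  have ha : (fun z => inner ℂ qm (lowerPart (w z)) - (q₀ : ℂ) ^ 2) =O[l] fun z => z⁻¹ :=
    (isBigO_inv_of_le (C := C) 1 (hev.mono fun z hz => by
      simpa using (hC z hz.1 hz.2.1 hz.2.2).2.1)).trans hinv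
  have hb : (fun z => inner ℂ qp (lowerPart (w z)) - I * θ * z⁻¹) =O[l] fun z => z⁻¹ ^ 2 :=
    isBigO_inv_of_le (C := C) 2 (hev.mono fun z hz => by
      have := (hC z hz.1 hz.2.1 hz.2.2).2.2
      rwa [show I / z * θ = I * θ * z⁻¹ by ring] at this)
  have hc : (fun z => inner ℂ (lowerPart (w' z)) qp + (q₀ : ℂ) ^ 2) =O[l] fun z => z⁻¹ :=
    (isBigO_inv_of_le (C := C') 1 (hCr.mono fun z hz => by simpa using hz.2.1)).trans hinv
  have hd : (fun z => inner ℂ (lowerPart (w' z)) qm - I * star θr * z⁻¹) =O[l] fun z => z⁻¹ ^ 2 :=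
    isBigO_inv_of_le (C := C') 2 (hCr.mono fun z hz => hz.2.2)
  have hρ : (fun z => rhoHat q₀ z - 1) =O[l] fun z => z⁻¹ ^ 2 :=
    isBigO_inv_of_le (C := 2 * q₀ ^ 2) 2 (hev.mono fun z hz =>
      norm_rhoHat_sub_one_le hm.pos hz.2.1)
  refine (isBigO_expansion (pow_ne_zero 2 hq') isBigO_inv_one_cobounded ha hb hc hd hw' hw
    hρ).congr (fun z => ?_) fun z => by rw [inv_pow, one_div]
  have hj : (q₀ : ℂ) ^ 2 * inner ℂ (lowerPart (w' z)) (lowerPart (w z))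
    = _ := hres (lowerPart (w' z)) (lowerPart (w z))
  have hj' : inner ℂ (lowerPart (w' z)) (lowerPart (w z)) = ((q₀ : ℂ) ^ 2)⁻¹ *
      (inner ℂ (lowerPart (w' z)) qm * inner ℂ qm (lowerPart (w z))
        + inner ℂ (lowerPart (w' z)) qp * inner ℂ qp (lowerPart (w z))) := by
    rw [← hj]; field_simp
  rw [scatCoeff, jform_eq_inner]
  change _ = rhoHat q₀ z / q₀ ^ 2 * (star (w' z 0) * w z 0
    - inner ℂ (lowerPart (w' z)) (lowerPart (w z))) - _
  rw [hj']

/-- In the expansion along `q₋, q₊` each product has one factor `O(1/z)`: the left column is nearly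
orthogonal to `q₋`, the right one to `q₊`. -/
theorem isBigO_scatCoeffMid (hm : LeftPotential q₀ q qm)
    (hp : LeftPotential q₀ (reflectPot q) (-qp)) (horth : inner ℂ qp qm = 0) :
    scatCoeffMid q₀ q qm qp =O[Bornology.cobounded ℝ] fun z => 1 / z := by
  have hq' : (q₀ : ℂ) ≠ 0 := by exact_mod_cast hm.pos.ne'
  have hqp : ‖qp‖ = q₀ := by rw [← norm_neg, hp.norm_eq]
  have hres := inner_resolution hm.pos hm.norm_eq hqp horth
  obtain ⟨C, hC0, hC⟩ := hm.exists_leftSol_one_bound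
  obtain ⟨C', hC0', hC'⟩ := hp.exists_leftSol_one_bound
  refine IsBigO.of_bound ((C' * C + (C' * q₀ * C + C' * (q₀ * C)) / q₀ ^ 2) / q₀ ^ 2) ?_
  filter_upwards [eventually_cobounded_le_norm (E := ℝ) (2 * q₀),
    eventually_cobounded_le_norm (E := ℝ) 1] with z h1 h2
  rw [Real.norm_eq_abs] at h1 h2
  have hz0 : 0 < |z| := lt_of_lt_of_le one_pos h2
  obtain ⟨b1, b2, b3⟩ := hC z h1 h2
  obtain ⟨c1, c2, c3⟩ := hC' (-z) (by rwa [abs_neg]) (by rwa [abs_neg])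
  rw [abs_neg, ofReal_neg] at c1 c2
  rw [ofReal_neg] at c3
  rw [scatCoeffMid, jform_eq_inner]
  generalize leftSol q₀ q qm 1 z 0 = w at *
  generalize leftSol q₀ (reflectPot q) (-qp) 1 (-(z : ℂ)) 0 = w' at *
  have hpos := hm.pos
  have d1 : ‖(inner ℂ (lowerPart w') qm : ℂ)‖ ≤ C' * q₀ :=
    (norm_inner_le_norm _ _).trans (by rw [hm.norm_eq]; gcongr)
  have d2 : ‖(inner ℂ qp (lowerPart w) : ℂ)‖ ≤ q₀ * C :=
    (norm_inner_le_norm _ _).trans (by rw [hqp]; gcongr)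
  have d3 : ‖(inner ℂ (lowerPart w') qp : ℂ)‖ ≤ C' / |z| := by
    rw [← inner_conj_symm, RCLike.norm_conj]
    rwa [inner_neg_left, norm_neg] at c2
  have hj' : inner ℂ (lowerPart w') (lowerPart w) = (inner ℂ (lowerPart w') qm *
      inner ℂ qm (lowerPart w) + inner ℂ (lowerPart w') qp * inner ℂ qp (lowerPart w))
      / (q₀ : ℂ) ^ 2 := by
    rw [← hres]; field_simp
  have e1 : ‖star (w' 0) * w 0‖ ≤ C' / |z| * C := by
    rw [norm_mul, norm_star]
    exact mul_le_mul c1 (b1.trans (div_le_self hC0 h2)) (norm_nonneg _) (by positivity)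
  have e2 : ‖(inner ℂ (lowerPart w') (lowerPart w) : ℂ)‖
      ≤ (C' * q₀ * (C / |z|) + C' / |z| * (q₀ * C)) / q₀ ^ 2 := by
    rw [hj', norm_div, norm_pow, norm_real, Real.norm_of_nonneg hpos.le]
    gcongr
    refine (norm_add_le _ _).trans ?_
    rw [norm_mul, norm_mul]
    gcongr
  rw [norm_mul, norm_div, norm_pow, norm_real, Real.norm_of_nonneg hpos.le, norm_one, norm_div,
    norm_one, Real.norm_eq_abs]
  calc _ ≤ 1 / q₀ ^ 2 * (C' / |z| * C
        + (C' * q₀ * (C / |z|) + C' / |z| * (q₀ * C)) / q₀ ^ 2) := by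
        gcongr
        exact (norm_sub_le _ _).trans (add_le_add e1 e2)
    _ = _ := by ring

end LargeZ

/-! ### Filters at infinity and at zero under inversion and conjugation -/

section Limits

variable {q₀ : ℝ}

theorem tendsto_const_div_cobounded {𝕜 : Type*} [NormedDivisionRing 𝕜] {a : 𝕜} (ha : a ≠ 0) :
    Tendsto (fun z => a / z) (𝓝[≠] 0) (Bornology.cobounded 𝕜) := by
  simp only [div_eq_mul_inv]
  exact (tendsto_mul_left_cobounded ha).comp tendsto_inv₀_nhdsNE_zero

theorem tendsto_sq_div_lower (hq : 0 < q₀) :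
    Tendsto (fun z : ℂ => (q₀ : ℂ) ^ 2 / z) (𝓝[{z : ℂ | z.im ≤ 0} \ {0}] 0)
      (Bornology.cobounded ℂ ⊓ 𝓟 {z : ℂ | 0 ≤ z.im}) := by
  have hq' : (q₀ : ℂ) ^ 2 ≠ 0 := pow_ne_zero 2 (by exact_mod_cast hq.ne')
  refine tendsto_inf.2 ⟨(tendsto_const_div_cobounded hq').mono_left
    (nhdsWithin_mono _ fun z hz => hz.2), tendsto_principal.2 ?_⟩
  filter_upwards [self_mem_nhdsWithin] with z hz
  rw [im_sq_div]
  have := div_nonpos_of_nonpos_of_nonneg (show z.im ≤ 0 from hz.1) (Complex.normSq_nonneg z)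
  nlinarith [sq_nonneg q₀]

theorem tendsto_star_cobounded : Tendsto (star : ℂ → ℂ) (Bornology.cobounded ℂ ⊓ 𝓟 {z | z.im ≤ 0})
    (Bornology.cobounded ℂ ⊓ 𝓟 {z | 0 ≤ z.im}) := by
  refine tendsto_inf.2 ⟨?_, tendsto_principal.2 ?_⟩
  · rw [← tendsto_norm_atTop_iff_cobounded]
    simp only [norm_star]
    exact tendsto_norm_cobounded_atTop.mono_left inf_le_left
  · refine Eventually.filter_mono inf_le_right (eventually_principal.2 fun z hz => ?_)
    have hz' : z.im ≤ 0 := hz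
    simpa using hz'

theorem tendsto_star_nhds_zero : Tendsto (star : ℂ → ℂ) (𝓝[{z : ℂ | 0 ≤ z.im} \ {0}] 0)
    (𝓝[{z : ℂ | z.im ≤ 0} \ {0}] 0) := by
  refine tendsto_nhdsWithin_of_tendsto_nhds_of_eventually_within _ ?_ ?_
  · have := (continuous_star (R := ℂ)).tendsto 0
    rw [star_zero] at this
    exact this.mono_left nhdsWithin_le_nhds
  · filter_upwards [self_mem_nhdsWithin] with z hz
    have hz' : 0 ≤ z.im := hz.1
    exact ⟨by simpa using hz', by simpa using hz.2⟩

theorem isBigO_star_comp {f g : ℂ → ℂ} {l l' : Filter ℂ} (h : f =O[l] g)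
    (hs : Tendsto star l' l) :
    (fun z => star (f (star z))) =O[l'] fun z => star (g (star z)) :=
  IsBigO.of_norm_norm (by simpa only [norm_star, Function.comp_def] using (h.comp_tendsto hs).norm_norm)

theorem not_mem_exceptional_of_inv (hq : 0 < q₀) {z : ℂ}
    (h : 2 * q₀ ≤ ‖(q₀ : ℂ) ^ 2 / z‖) : z ∉ exceptional q₀ := by
  have hq' : (q₀ : ℂ) ≠ 0 := by exact_mod_cast hq.ne'
  have := not_mem_exceptional_inv hq (not_mem_exceptional_of_le hq h)
  rwa [div_div_cancel₀ (pow_ne_zero 2 hq')] at this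

theorem eventually_nhdsNE_not_mem_exceptional (hq : 0 < q₀) :
    ∀ᶠ z : ℂ in 𝓝[≠] 0, z ∉ exceptional q₀ := by
  have hq' : (q₀ : ℂ) ^ 2 ≠ 0 := pow_ne_zero 2 (by exact_mod_cast hq.ne')
  filter_upwards [(tendsto_const_div_cobounded hq').eventually
    (eventually_cobounded_le_norm (2 * q₀))] with z hz
  exact not_mem_exceptional_of_inv hq hz

theorem eventually_nhdsNE_mem_realSpectrum (hq : 0 < q₀) :
    ∀ᶠ z : ℝ in 𝓝[≠] 0, z ∈ realSpectrum q₀ := by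
  have hq' : q₀ ^ 2 ≠ 0 := pow_ne_zero 2 hq.ne'
  filter_upwards [(tendsto_const_div_cobounded hq').eventually
    (eventually_cobounded_le_norm (2 * q₀))] with z hz
  refine not_mem_exceptional_of_inv hq ?_
  have : (q₀ : ℂ) ^ 2 / z = ((q₀ ^ 2 / z : ℝ) : ℂ) := by push_cast; rfl
  rwa [this, norm_real]

theorem eventually_cobounded_mem_realSpectrum (hq : 0 < q₀) :
    ∀ᶠ z : ℝ in Bornology.cobounded ℝ, z ∈ realSpectrum q₀ := by
  filter_upwards [eventually_cobounded_le_norm (E := ℝ) (2 * q₀)] with z hz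
  exact not_mem_exceptional_of_le hq (by rwa [norm_real])

end Limits

/-! ### Transport of the expansion by the symmetries -/

section Transfer

variable {q₀ : ℝ} {F : ℂ → ℂ} {θ : ℂ}

theorem isBigO_comp_star_cobounded
    (h : (fun z : ℂ => F z - I * θ / ((q₀ : ℂ) ^ 2 * z))
      =O[Bornology.cobounded ℂ ⊓ 𝓟 {z : ℂ | 0 ≤ z.im}] fun z => 1 / z ^ 2) :
    (fun z : ℂ => star (F (star z)) - -(I * star θ / ((q₀ : ℂ) ^ 2 * z)))
      =O[Bornology.cobounded ℂ ⊓ 𝓟 {z : ℂ | z.im ≤ 0}] fun z => 1 / z ^ 2 := by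
  refine (isBigO_star_comp h tendsto_star_cobounded).congr (fun z => ?_) fun z => by simp
  simp only [← starRingEnd_apply, map_sub, map_div₀, map_mul, map_pow, conj_I, conj_ofReal,
    conj_conj]
  ring

theorem isBigO_comp_inv_zero (hq : 0 < q₀)
    (h : (fun z : ℂ => F z - I * θ / ((q₀ : ℂ) ^ 2 * z))
      =O[Bornology.cobounded ℂ ⊓ 𝓟 {z : ℂ | 0 ≤ z.im}] fun z => 1 / z ^ 2) :
    (fun z : ℂ => F ((q₀ : ℂ) ^ 2 / z) - I * θ / (q₀ : ℂ) ^ 4 * z)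
      =O[𝓝[{z : ℂ | z.im ≤ 0} \ {0}] 0] fun z => z ^ 2 := by
  have hq' : (q₀ : ℂ) ≠ 0 := by exact_mod_cast hq.ne'
  have h1 := h.comp_tendsto (tendsto_sq_div_lower hq)
  refine (h1.congr' ?_ (Eventually.of_forall fun z => ?_)).trans
    (isBigO_const_mul_self (((q₀ : ℂ) ^ 4)⁻¹) (fun z : ℂ => z ^ 2) _)
  · filter_upwards [self_mem_nhdsWithin] with z hz
    have hz0 : z ≠ 0 := hz.2
    simp only [Function.comp_apply]
    congr 1
    field_simp
  · simp only [Function.comp_apply]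
    rw [div_pow, one_div_div]
    ring

theorem isBigO_comp_star_zero
    (h : (fun z : ℂ => F z - I * θ / (q₀ : ℂ) ^ 4 * z)
      =O[𝓝[{z : ℂ | z.im ≤ 0} \ {0}] 0] fun z => z ^ 2) :
    (fun z : ℂ => star (F (star z)) - -(I * star θ / (q₀ : ℂ) ^ 4 * z))
      =O[𝓝[{z : ℂ | 0 ≤ z.im} \ {0}] 0] fun z => z ^ 2 := by
  refine (isBigO_star_comp h tendsto_star_nhds_zero).congr (fun z => ?_) fun z => by simp
  simp only [← starRingEnd_apply, map_sub, map_div₀, map_mul, map_pow, conj_I, conj_ofReal,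
    conj_conj]
  ring

end Transfer

/-- In the basis `q₋, q₋^⊥` the vector `q₊` sees only the second component of `q`. -/
theorem integral_inner_eq_perp {q₀ : ℝ} {q : ℝ → Vec2} {qm qp : Vec2} (hq : 0 < q₀)
    (hqm : ‖qm‖ = q₀) (horth : inner ℂ qp qm = 0) :
    ∫ x, (inner ℂ qp (q x) * inner ℂ (q x) qm : ℂ)
      = inner ℂ qp (perp qm) / (q₀ : ℂ) ^ 2
        * ∫ x, inner ℂ (perp qm) (q x) * inner ℂ (q x) qm := by
  have hq' : (q₀ : ℂ) ≠ 0 := by exact_mod_cast hq.ne'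
  rw [← integral_const_mul]
  congr 1
  ext x
  have h := vec2_resolution qm qp (q x)
  rw [hqm, horth, zero_mul, zero_add] at h
  push_cast at h
  field_simp
  linear_combination inner ℂ (q x) qm * h

/-! ### Asymptotics for arbitrary scattering data -/

section Coefficients

variable {q₀ σ t : ℝ} {q : ℝ → ℝ → Vec2} {qm qp : Vec2}

theorem ScatteringData.isBigO_S_one_one (hm : LeftPotential q₀ (fun x => q x t) qm)
    (hp : LeftPotential q₀ (reflectPot fun x => q x t) (-qp)) (horth : inner ℂ qp qm = 0)
    (D : ScatteringData q₀ σ q t qm qp) :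
    ((fun z : ℝ => D.S z 1 1) =O[Bornology.cobounded ℝ] fun z => 1 / z) ∧
      ((fun z : ℝ => D.S z 1 1) =O[𝓝[≠] 0] fun z => z) := by
  have hqp : ‖qp‖ = q₀ := by rw [← norm_neg, hp.norm_eq]
  have hq := hm.pos
  have hmid := isBigO_scatCoeffMid hm hp horth
  constructor
  · refine hmid.congr' ?_ EventuallyEq.rfl
    filter_upwards [eventually_cobounded_mem_realSpectrum hq] with z hz
    exact ((D.scatteringAt hq hz).S_one_one hm hp hqp hz).1.symm
  · have h0 := hmid.comp_tendsto (tendsto_const_div_cobounded (pow_ne_zero 2 hq.ne'))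
    refine (h0.congr' ?_ (Eventually.of_forall fun z => ?_)).trans
      (isBigO_const_mul_self (q₀ ^ 2)⁻¹ (fun z : ℝ => z) _)
    · filter_upwards [eventually_nhdsNE_mem_realSpectrum hq] with z hz
      exact ((D.scatteringAt hq hz).S_one_one hm hp hqp hz).2.symm
    · simp only [Function.comp_apply]
      rw [one_div_div, div_eq_inv_mul]

theorem ScatteringData.isBigO_H_of_S {g : ℝ → ℝ} {l : Filter ℝ} (hq : 0 < q₀) (hqm : ‖qm‖ = q₀)
    (hqp : ‖qp‖ = q₀) (D : ScatteringData q₀ σ q t qm qp) (j : Fin 3)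
    (hl : ∀ᶠ z in l, z ∈ realSpectrum q₀) (h : (fun z => D.S z j j) =O[l] g) :
    (fun z => D.H z j j) =O[l] g := by
  refine IsBigO.of_norm_left (h.norm_left.congr' ?_ EventuallyEq.rfl)
  filter_upwards [hl] with z hz
  rw [(D.scatteringAt hq hz).H_diag hq hz hqm hqp j, norm_star]

theorem ScatteringData.isBigO_extensions (hm : LeftPotential q₀ (fun x => q x t) qm)
    (hp : LeftPotential q₀ (reflectPot fun x => q x t) (-qp)) (horth : inner ℂ qp qm = 0)
    (D : ScatteringData q₀ σ q t qm qp) :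
    ((fun z : ℂ => D.s₃₃ z - I * thetaOne q t qm qp / ((q₀ : ℂ) ^ 2 * z))
      =O[Bornology.cobounded ℂ ⊓ 𝓟 {z : ℂ | 0 ≤ z.im}] fun z => 1 / z ^ 2) ∧
    ((fun z : ℂ => D.h₃₃ z - -(I * star (thetaOne q t qm qp) / ((q₀ : ℂ) ^ 2 * z)))
      =O[Bornology.cobounded ℂ ⊓ 𝓟 {z : ℂ | z.im ≤ 0}] fun z => 1 / z ^ 2) ∧
    ((fun z : ℂ => D.s₁₁ z - I * thetaOne q t qm qp / (q₀ : ℂ) ^ 4 * z)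
      =O[𝓝[{z : ℂ | z.im ≤ 0} \ {0}] 0] fun z => z ^ 2) ∧
    ((fun z : ℂ => D.h₁₁ z - -(I * star (thetaOne q t qm qp) / (q₀ : ℂ) ^ 4 * z))
      =O[𝓝[{z : ℂ | 0 ≤ z.im} \ {0}] 0] fun z => z ^ 2) := by
  have hqp : ‖qp‖ = q₀ := by rw [← norm_neg, hp.norm_eq]
  have hq := hm.pos
  -- The continuations in `D` agree with these explicit ones by uniqueness, away from the
  -- exceptional points, which both limits eventually avoid.
  obtain ⟨e11, e33, g11, g33⟩ := extensions (σ := σ) (t := t) hm hp hqp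
    fun z hz => D.scatteringAt hq hz
  have h33 := isBigO_scatCoeff hm hp horth
  change (fun z : ℂ => _ - I * thetaOne q t qm qp / _) =O[_] _ at h33
  have h11 := isBigO_comp_inv_zero hq h33
  have hex : ∀ᶠ z : ℂ in Bornology.cobounded ℂ, z ∉ exceptional q₀ :=
    (eventually_cobounded_le_norm (2 * q₀)).mono fun z hz => not_mem_exceptional_of_le hq hz
  have hex0 := eventually_nhdsNE_not_mem_exceptional hq
  refine ⟨h33.congr' ?_ EventuallyEq.rfl,
    (isBigO_comp_star_cobounded h33).congr' ?_ EventuallyEq.rfl,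
    h11.congr' ?_ EventuallyEq.rfl, (isBigO_comp_star_zero (F := fun z =>
      scatCoeff q₀ (fun x => q x t) qm qp ((q₀ : ℂ) ^ 2 / z)) h11).congr' ?_ EventuallyEq.rfl⟩
  · filter_upwards [hex.filter_mono inf_le_left, mem_inf_of_right (mem_principal_self _)]
      with z hz hi
    rw [e33.unique hq D.s₃₃_ext hi hz]
  · filter_upwards [hex.filter_mono inf_le_left, mem_inf_of_right (mem_principal_self _)]
      with z hz hi
    rw [← g33.unique hq D.h₃₃_ext hi hz]
  · filter_upwards [hex0.filter_mono (nhdsWithin_mono _ fun z hz => hz.2), self_mem_nhdsWithin]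
      with z hz hi
    rw [← e11.unique hq D.s₁₁_ext hi.1 hz]
  · filter_upwards [hex0.filter_mono (nhdsWithin_mono _ fun z hz => hz.2), self_mem_nhdsWithin]
      with z hz hi
    rw [← g11.unique hq D.h₁₁_ext hi.1 hz]

end Coefficients

end CoupledHirota

end

theorem proposition14 (q₀ σ t : ℝ) (hq₀ : 0 < q₀)
    (q : ℝ → ℝ → CoupledHirota.Vec2) (qm qp : CoupledHirota.Vec2)
    (hqm : ‖qm‖ = q₀) (hqp : ‖qp‖ = q₀)
    -- boundary conditions
    (hlim_m : Tendsto (fun x => q x t) atBot (𝓝 qm))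
    (hlim_p : Tendsto (fun x => q x t) atTop (𝓝 qp))
    -- `q - q₋ ∈ L^{1,1}(ℝ⁻)`, `q - q₊ ∈ L^{1,1}(ℝ⁺)`, `q_x ∈ L¹(ℝ)`
    (hint_m : IntegrableOn (fun x => (1 + |x|) • (q x t - qm)) (Set.Iic 0))
    (hint_p : IntegrableOn (fun x => (1 + |x|) • (q x t - qp)) (Set.Ici 0))
    (hdiff : Differentiable ℝ (fun x => q x t))
    (hderiv : Integrable (deriv (fun x => q x t)))
    -- orthogonality `q₊† q₋ = 0`
    (horth : inner ℂ qp qm = 0) :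
    (∃ ϑ : ℝ, qp = Complex.exp (-(I * ϑ)) • CoupledHirota.perp qm) ∧
    Integrable (fun x : ℝ => inner ℂ qp (q x t) * inner ℂ (q x t) qm) ∧
    CoupledHirota.thetaOne q t qm qp =
      inner ℂ qp (CoupledHirota.perp qm) / (q₀ : ℂ) ^ 2 *
        ∫ x : ℝ, inner ℂ (CoupledHirota.perp qm) (q x t) * inner ℂ (q x t) qm ∧
    Nonempty (CoupledHirota.ScatteringData q₀ σ q t qm qp) ∧
    ∀ D : CoupledHirota.ScatteringData q₀ σ q t qm qp,
      -- `z → ∞`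
      ((fun z : ℂ => D.s₃₃ z - I * CoupledHirota.thetaOne q t qm qp / ((q₀ : ℂ) ^ 2 * z))
        =O[Bornology.cobounded ℂ ⊓ 𝓟 {z : ℂ | 0 ≤ z.im}] fun z => 1 / z ^ 2) ∧
      ((fun z : ℂ => D.h₃₃ z -
          -(I * star (CoupledHirota.thetaOne q t qm qp) / ((q₀ : ℂ) ^ 2 * z)))
        =O[Bornology.cobounded ℂ ⊓ 𝓟 {z : ℂ | z.im ≤ 0}] fun z => 1 / z ^ 2) ∧
      ((fun z : ℝ => D.S z 1 1) =O[Bornology.cobounded ℝ] fun z => 1 / z) ∧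
      ((fun z : ℝ => D.H z 1 1) =O[Bornology.cobounded ℝ] fun z => 1 / z) ∧
      -- `z → 0`
      ((fun z : ℂ => D.s₁₁ z - I * CoupledHirota.thetaOne q t qm qp / (q₀ : ℂ) ^ 4 * z)
        =O[𝓝[{z : ℂ | z.im ≤ 0} \ {0}] 0] fun z => z ^ 2) ∧
      ((fun z : ℂ => D.h₁₁ z -
          -(I * star (CoupledHirota.thetaOne q t qm qp) / (q₀ : ℂ) ^ 4 * z))
        =O[𝓝[{z : ℂ | 0 ≤ z.im} \ {0}] 0] fun z => z ^ 2) ∧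
      ((fun z : ℝ => D.S z 1 1) =O[𝓝[≠] 0] fun z => z) ∧
      ((fun z : ℝ => D.H z 1 1) =O[𝓝[≠] 0] fun z => z) := by
  -- Both ends are brought to the same form: the right end becomes a left end for the reflected
  -- potential `-q(-x)` with limit `-q₊`.
  have hb := CoupledHirota.exists_norm_le_of_tendsto hdiff.continuous hlim_m hlim_p
  have hm : CoupledHirota.LeftPotential q₀ (fun x => q x t) qm :=
    ⟨hq₀, hqm, hlim_m, hb, hint_m, hdiff, hderiv.integrableOn⟩
  have hp := CoupledHirota.leftPotential_reflectPot hq₀ hqp hlim_p hb hint_p hdiff hderiv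
  refine ⟨CoupledHirota.exists_phase_of_orthogonal hq₀ hqm hqp horth,
    CoupledHirota.integrable_thetaOne hm hp horth,
    CoupledHirota.integral_inner_eq_perp hq₀ hqm horth,
    CoupledHirota.nonempty_scatteringData hm hp hqp, fun D => ?_⟩
  obtain ⟨h33, g33, h11, g11⟩ := D.isBigO_extensions hm hp horth
  obtain ⟨hS, hS0⟩ := D.isBigO_S_one_one hm hp horth
  exact ⟨h33, g33, hS,
    D.isBigO_H_of_S hq₀ hqm hqp 1 (CoupledHirota.eventually_cobounded_mem_realSpectrum hq₀) hS,
    h11, g11, hS0,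
    D.isBigO_H_of_S hq₀ hqm hqp 1 (CoupledHirota.eventually_nhdsNE_mem_realSpectrum hq₀) hS0⟩
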